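/- **Theorem 3.1.** Let $(M,g)$ be a connected smooth 3-dimensional Lorentzian manifold of signature $(-,+,+)$ and let $h$ be a smooth positive function on $M$ that is nowhere constant, that is, $\nabla h$ vanishes identically on no nonempty open set. For $\Lambda\in\mathbb R$, the *vacuum weighted Einstein equation* is $$h\,\rho-\operatorname{Hes}_h+(\Delta h+\Lambda)\,g=0,$$ where $\rho$ is the Ricci tensor, $\operatorname{Hes}_h$ the Hessian and $\Delta h$ its trace. A *$pp$-wave* is a Lorentzian manifold with a parallel lightlike vector field $V$ such that $R(V^\perp,V^\perp)=0$, and it is a *plane wave* if moreover $\nabla_{V^\perp}R=0$ for such a $V$. Suppose that $(M,g)$ is a $pp$-wave that is not flat (its curvature tensor $R$ does not vanish identically) and that $(g,h)$ solves the vacuum weighted Einstein equation for a constant $\Lambda$. Then $\Lambda=0$ and one of the following holds. 1. $\nabla h$ is lightlike (at every point where it is nonzero), $(M,g)$ is a plane wave, and around every point there are local coordinates $(u,v,x)$ in which $$g=dv\Bigl(2\,du-\frac{\alpha''(v)}{\alpha(v)}\,x^2\,dv\Bigr)+dx^2,\qquad h(u,v,x)=\alpha(v),$$ with $\alpha$ a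 smooth function such that $\alpha''(v)\neq0$ exactly at the points where $R\neq 0$. 2. $\nabla h$ is spacelike at every point, and around every point there are local coordinates $(u,v,x)$ in which $$g=dv\,(2\,du+F(v,x)\,dv)+dx^2,\qquad h(u,v,x)=\gamma_1x+\gamma_0(v),$$ $$F(v,x)=\frac{\bigl(\gamma_1\alpha(v)+2\gamma_0(v)\gamma_0''(v)\bigr)\log(\gamma_0(v)+\gamma_1x)}{\gamma_1^2}-\frac{2x\,\gamma_0''(v)}{\gamma_1}+\beta(v),$$ with $\gamma_1\in\mathbb R\setminus\{0\}$ a constant and $\gamma_0,\alpha,\beta$ smooth functions such that $\gamma_1\alpha(v)+2\gamma_0(v)\gamma_0''(v)\neq0$ exactly at the points where $R\neq0$. Conversely, the functions in these local forms are arbitrary: let $(M,g)$ be any connected smooth 3-dimensional Lorentzian manifold and $h$ a smooth positive nowhere constant function on it. If around every point $g$ and $h$ have the form in (1) with $\alpha$ smooth and $\alpha''\neq0$ everywhere, or if around every point they have the form in (2) with $\gamma_1\ne 0$, with $\gamma_0,\alpha,\beta$ smooth and $\gamma_1\alpha+2\gamma_0\gamma_0''\neq0$ everywhere, then $(g,h)$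 solves the vacuum weighted Einstein equation with $\Lambda=0$ and $R\neq0$ at every point; in the first case $\nabla h$ is lightlike wherever it is nonzero, and in the second case it is spacelike at every point. -/

import Mathlib

open scoped Manifold ContDiff Topology

-- Make sure that `ℝⁿ` carries its standard manifold structure everywhere below.
attribute [local instance 2000] chartedSpaceSelf

noncomputable section

/-- Partial derivative in the `i`-th Cartesian coordinate of `ℝⁿ`. -/
def pd {n : ℕ} (i : Fin n) (f : EuclideanSpace ℝ (Fin n) → ℝ)
    (y : EuclideanSpace ℝ (Fin n)) : ℝ :=
  fderiv ℝ f y (EuclideanSpace.single i 1)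

/-- A smooth Lorentzian metric on an `n`-manifold: a smooth field of symmetric bilinear forms of
signature `(-,+,…,+)`, i.e. each tangent space has a timelike vector whose orthogonal complement
is positive definite. -/
structure LorentzMetric (n : ℕ) (M : Type*) [TopologicalSpace M]
    [ChartedSpace (EuclideanSpace ℝ (Fin n)) M] [IsManifold (𝓡 n) ∞ M] where
  val (p : M) : TangentSpace (𝓡 n) p →L[ℝ] TangentSpace (𝓡 n) p →L[ℝ] ℝ
  symm (p : M) (v w : TangentSpace (𝓡 n) p) : val p v w = val p w v
  signature (p : M) : ∃ t : TangentSpace (𝓡 n) p, val p t t < 0 ∧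
    ∀ w : TangentSpace (𝓡 n) p, val p t w = 0 → w ≠ 0 → 0 < val p w w
  contMDiff : ContMDiff (𝓡 n)
    ((𝓡 n).prod 𝓘(ℝ, EuclideanSpace ℝ (Fin n) →L[ℝ] EuclideanSpace ℝ (Fin n) →L[ℝ] ℝ)) ∞
    (fun p : M ↦ Bundle.TotalSpace.mk'
      (E := fun p : M ↦ TangentSpace (𝓡 n) p →L[ℝ] TangentSpace (𝓡 n) p →L[ℝ] ℝ)
      (EuclideanSpace ℝ (Fin n) →L[ℝ] EuclideanSpace ℝ (Fin n) →L[ℝ] ℝ) p (val p))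

namespace LorentzMetric

/-- Coordinate systems are the charts `φ` of the maximal smooth atlas; a point of the chart domain
is represented by its coordinates `y ∈ φ.target`. -/
abbrev IsChart {n : ℕ} {M : Type*} [TopologicalSpace M]
    [ChartedSpace (EuclideanSpace ℝ (Fin n)) M]
    (φ : OpenPartialHomeomorph M (EuclideanSpace ℝ (Fin n))) : Prop :=
  φ ∈ IsManifold.maximalAtlas (𝓡 n) ∞ M

variable {n : ℕ} {M : Type*} [TopologicalSpace M]
  [ChartedSpace (EuclideanSpace ℝ (Fin n)) M] [IsManifold (𝓡 n) ∞ M]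

/-- The bilinear form at a point, without its continuity. -/
def form (g : LorentzMetric n M) (p : M) : LinearMap.BilinForm ℝ (TangentSpace (𝓡 n) p) :=
  LinearMap.mk₂ ℝ (fun v w ↦ g.val p v w)
    (by intros; simp) (by intros; simp) (by intros; simp) (by intros; simp)

theorem form_nondegenerate (g : LorentzMetric n M) (p : M) : (g.form p).Nondegenerate := by
  have key : ∀ v : TangentSpace (𝓡 n) p, (∀ w, g.val p v w = 0) → v = 0 := by
    intro v hv
    obtain ⟨t, -, ht⟩ := g.signature p
    by_contra hne
    have h1 := ht v (by rw [g.symm]; exact hv t) hne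
    rw [hv v] at h1
    exact lt_irrefl _ h1
  refine ⟨fun v hv ↦ key v hv, fun v hv ↦ key v fun w ↦ ?_⟩
  rw [g.symm]
  exact hv w

instance (p : M) : FiniteDimensional ℝ (TangentSpace (𝓡 n) p) :=
  inferInstanceAs (FiniteDimensional ℝ (EuclideanSpace ℝ (Fin n)))

/-- The gradient `∇h`, i.e. the vector field with `g(∇h, Z) = dh(Z)` for all `Z`. -/
def grad (g : LorentzMetric n M) (h : M → ℝ) (p : M) : TangentSpace (𝓡 n) p :=
  ((g.form p).toDual (g.form_nondegenerate p)).symm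
    (mfderiv (𝓡 n) 𝓘(ℝ, ℝ) h p : TangentSpace (𝓡 n) p →L[ℝ] ℝ).toLinearMap

theorem val_grad (g : LorentzMetric n M) (h : M → ℝ) (p : M) (z : TangentSpace (𝓡 n) p) :
    g.val p (g.grad h p) z = mfderiv (𝓡 n) 𝓘(ℝ, ℝ) h p z :=
  LinearMap.BilinForm.apply_toDual_symm_apply
    (hB := g.form_nondegenerate p)
    (f := (mfderiv (𝓡 n) 𝓘(ℝ, ℝ) h p : TangentSpace (𝓡 n) p →L[ℝ] ℝ).toLinearMap) z

/-- Lightlike vectors: nonzero and null. -/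
def IsLightlike (g : LorentzMetric n M) (p : M) (v : TangentSpace (𝓡 n) p) : Prop :=
  v ≠ 0 ∧ g.val p v v = 0

/-- Spacelike (nonzero) vectors. -/
def IsSpacelike (g : LorentzMetric n M) (p : M) (v : TangentSpace (𝓡 n) p) : Prop :=
  0 < g.val p v v

/-- The coordinate vector field `∂ᵢ` of the chart `φ`, at the point with coordinates `y`. -/
def coordVec (φ : OpenPartialHomeomorph M (EuclideanSpace ℝ (Fin n)))
    (y : EuclideanSpace ℝ (Fin n)) (i : Fin n) : TangentSpace (𝓡 n) (φ.symm y) :=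
  mfderiv (𝓡 n) (𝓡 n) φ.symm y (EuclideanSpace.single i (1 : ℝ) : EuclideanSpace ℝ (Fin n))

/-- The components `Vⁱ` of a vector field, `V = ∑ Vⁱ ∂ᵢ`. -/
def vecComp (φ : OpenPartialHomeomorph M (EuclideanSpace ℝ (Fin n)))
    (V : ∀ p : M, TangentSpace (𝓡 n) p) (i : Fin n) (y : EuclideanSpace ℝ (Fin n)) : ℝ :=
  WithLp.ofLp (p := 2) (V := Fin n → ℝ) (mfderiv (𝓡 n) (𝓡 n) φ (φ.symm y) (V (φ.symm y))) i

variable (g : LorentzMetric n M) (φ : OpenPartialHomeomorph M (EuclideanSpace ℝ (Fin n)))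

/-- The matrix `g_{ij} = g(∂ᵢ, ∂ⱼ)`. -/
def mat (y : EuclideanSpace ℝ (Fin n)) : Matrix (Fin n) (Fin n) ℝ :=
  Matrix.of fun i j ↦ g.val (φ.symm y) (coordVec φ y i) (coordVec φ y j)

/-- The inverse matrix `g^{ij}`. -/
def invMat (y : EuclideanSpace ℝ (Fin n)) : Matrix (Fin n) (Fin n) ℝ :=
  (g.mat φ y)⁻¹

/-- Christoffel symbols `Γᵏᵢⱼ` of the Levi-Civita connection, `∇_{∂ᵢ} ∂ⱼ = ∑ₖ Γᵏᵢⱼ ∂ₖ`. -/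
def christoffel (k i j : Fin n) (y : EuclideanSpace ℝ (Fin n)) : ℝ :=
  (1 / 2) * ∑ l, g.invMat φ y k l *
    (pd i (fun z ↦ g.mat φ z j l) y + pd j (fun z ↦ g.mat φ z i l) y
      - pd l (fun z ↦ g.mat φ z i j) y)

/-- Curvature components: `R(∂ᵢ, ∂ⱼ) ∂ₖ = ∑ₗ Rˡᵢⱼₖ ∂ₗ`, where
`R(X, Y) = ∇_X ∇_Y - ∇_Y ∇_X - ∇_[X,Y]`. -/
def riem (l i j k : Fin n) (y : EuclideanSpace ℝ (Fin n)) : ℝ :=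
  pd i (g.christoffel φ l j k) y - pd j (g.christoffel φ l i k) y
    + ∑ m, (g.christoffel φ l i m y * g.christoffel φ m j k y
      - g.christoffel φ l j m y * g.christoffel φ m i k y)

/-- Ricci tensor `ρ(Y, Z) = tr (X ↦ R(X, Y) Z)`. -/
def ricci (j k : Fin n) (y : EuclideanSpace ℝ (Fin n)) : ℝ :=
  ∑ i, g.riem φ i i j k y

/-- Components `(∇_{∂ₘ} R)ˡᵢⱼₖ` of the covariant derivative of the curvature tensor. -/
def covRiem (m l i j k : Fin n) (y : EuclideanSpace ℝ (Fin n)) : ℝ :=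
  pd m (g.riem φ l i j k) y
    + ∑ a, (g.christoffel φ l m a y * g.riem φ a i j k y
      - g.christoffel φ a m i y * g.riem φ l a j k y
      - g.christoffel φ a m j y * g.riem φ l i a k y
      - g.christoffel φ a m k y * g.riem φ l i j a y)

/-- Hessian `Hes_h(∂ᵢ, ∂ⱼ)`. -/
def hess (h : M → ℝ) (i j : Fin n) (y : EuclideanSpace ℝ (Fin n)) : ℝ :=
  pd i (pd j (h ∘ φ.symm)) y - ∑ k, g.christoffel φ k i j y * pd k (h ∘ φ.symm) y

/-- Laplacian `Δh`, the trace of the Hessian. -/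
def lap (h : M → ℝ) (y : EuclideanSpace ℝ (Fin n)) : ℝ :=
  ∑ i, ∑ j, g.invMat φ y i j * g.hess φ h i j y

/-- Components of the weighted Einstein tensor `G^h = h ρ - Hes_h + (Δh + Λ) g`. -/
def weightedEinstein (h : M → ℝ) (Λ : ℝ) (i j : Fin n) (y : EuclideanSpace ℝ (Fin n)) : ℝ :=
  h (φ.symm y) * g.ricci φ i j y - g.hess φ h i j y
    + (g.lap φ h y + Λ) * g.mat φ y i j

/-- The vacuum weighted Einstein field equation `G^h = 0`, in every chart. -/
def SolvesVacuum (g : LorentzMetric n M) (h : M → ℝ) (Λ : ℝ) : Prop :=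
  ∀ φ : OpenPartialHomeomorph M (EuclideanSpace ℝ (Fin n)), IsChart φ →
    ∀ y ∈ φ.target, ∀ i j, g.weightedEinstein φ h Λ i j y = 0

/-- Admissible densities of a (proper) smooth metric measure space: `h` is smooth, positive and
nowhere constant, i.e. `∇h` vanishes identically on no nonempty open set. -/
def IsDensity (g : LorentzMetric n M) (h : M → ℝ) : Prop :=
  ContMDiff (𝓡 n) 𝓘(ℝ, ℝ) ∞ h ∧ (∀ p, 0 < h p) ∧ Dense {p : M | g.grad h p ≠ 0}

/-- The curvature tensor vanishes at the point `p`. -/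
def IsFlatAt (g : LorentzMetric n M) (p : M) : Prop :=
  ∀ φ : OpenPartialHomeomorph M (EuclideanSpace ℝ (Fin n)), IsChart φ → p ∈ φ.source →
    ∀ l i j k, g.riem φ l i j k (φ p) = 0

/-- `(M, g)` is flat: its curvature tensor vanishes identically. -/
def IsFlat (g : LorentzMetric n M) : Prop := ∀ p, g.IsFlatAt p

/-- `V` is parallel, `∇V = 0`. -/
def IsParallel (g : LorentzMetric n M) (V : ∀ p : M, TangentSpace (𝓡 n) p) : Prop :=
  ∀ φ : OpenPartialHomeomorph M (EuclideanSpace ℝ (Fin n)), IsChart φ →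
    ∀ y ∈ φ.target, ∀ i k,
      pd i (vecComp φ V k) y + ∑ j, g.christoffel φ k i j y * vecComp φ V j y = 0

/-- The vector `∑ Xⁱ ∂ᵢ` at the point with coordinates `y` is orthogonal to `V`. -/
def IsPerp (g : LorentzMetric n M) (V : ∀ p : M, TangentSpace (𝓡 n) p)
    (φ : OpenPartialHomeomorph M (EuclideanSpace ℝ (Fin n))) (y : EuclideanSpace ℝ (Fin n))
    (X : Fin n → ℝ) : Prop :=
  g.val (φ.symm y) (V (φ.symm y)) (∑ i, X i • coordVec φ y i) = 0

/-- `V` is a smooth parallel lightlike vector field with `R(V^⊥, V^⊥) = 0`. -/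
def IsPPField (g : LorentzMetric n M) (V : ∀ p : M, TangentSpace (𝓡 n) p) : Prop :=
  ContMDiff (𝓡 n) (𝓡 n).tangent ∞ (fun p ↦ (⟨p, V p⟩ : TangentBundle (𝓡 n) M)) ∧
  (∀ p, g.IsLightlike p (V p)) ∧ g.IsParallel V ∧
  ∀ φ : OpenPartialHomeomorph M (EuclideanSpace ℝ (Fin n)), IsChart φ →
    ∀ y ∈ φ.target, ∀ X Y : Fin n → ℝ, g.IsPerp V φ y X → g.IsPerp V φ y Y →
      ∀ l k, ∑ i, ∑ j, X i * Y j * g.riem φ l i j k y = 0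

/-- `pp`-waves: there is a parallel lightlike vector field `V` with `R(V^⊥, V^⊥) = 0`. -/
def IsPPWave (g : LorentzMetric n M) : Prop :=
  ∃ V : ∀ p : M, TangentSpace (𝓡 n) p, g.IsPPField V

/-- Plane waves: `pp`-waves with transversally parallel curvature, `∇_{V^⊥} R = 0`. -/
def IsPlaneWave (g : LorentzMetric n M) : Prop :=
  ∃ V : ∀ p : M, TangentSpace (𝓡 n) p, g.IsPPField V ∧
    ∀ φ : OpenPartialHomeomorph M (EuclideanSpace ℝ (Fin n)), IsChart φ →
      ∀ y ∈ φ.target, ∀ X : Fin n → ℝ, g.IsPerp V φ y X →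
        ∀ l i j k, ∑ m, X m * g.covRiem φ m l i j k y = 0

end LorentzMetric

section DimensionThree

variable {M : Type*} [TopologicalSpace M]
  [ChartedSpace (EuclideanSpace ℝ (Fin 3)) M] [IsManifold (𝓡 3) ∞ M]

/-- In the coordinates `(u, v, x) = (y 0, y 1, y 2)` of `φ` the metric is
`dv (2 du + F(v, x) dv) + dx²`. -/
def IsPPChart (g : LorentzMetric 3 M)
    (φ : OpenPartialHomeomorph M (EuclideanSpace ℝ (Fin 3))) (F : ℝ → ℝ → ℝ) : Prop :=
  LorentzMetric.IsChart φ ∧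
    ∀ y ∈ φ.target, g.mat φ y = !![0, 1, 0; 1, F (y 1) (y 2), 0; 0, 0, 1]

/-- The set of values of the coordinate `v = y 1`, an open subset of `ℝ`. -/
def vRange (φ : OpenPartialHomeomorph M (EuclideanSpace ℝ (Fin 3))) : Set ℝ :=
  (fun y : EuclideanSpace ℝ (Fin 3) ↦ y 1) '' φ.target

/-- `g = dv (2 du - (α''(v) / α(v)) x² dv) + dx²` and `h = α(v)`, with `α` smooth. -/
def IsPlaneWaveChart (g : LorentzMetric 3 M) (h : M → ℝ)
    (φ : OpenPartialHomeomorph M (EuclideanSpace ℝ (Fin 3))) (α : ℝ → ℝ) : Prop :=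
  ContDiffOn ℝ ∞ α (vRange φ) ∧
  IsPPChart g φ (fun v x ↦ -(deriv (deriv α) v / α v) * x ^ 2) ∧
  ∀ y ∈ φ.target, h (φ.symm y) = α (y 1)

/-- `g = dv (2 du + F(v, x) dv) + dx²`, where
`F = (γ₁ α + 2 γ₀ γ₀'') log(γ₀ + γ₁ x) / γ₁² - 2 x γ₀'' / γ₁ + β`, and `h = γ₁ x + γ₀(v)`, with
`γ₁ ≠ 0` constant and `γ₀`, `α`, `β` smooth functions of `v`. -/
def IsLogWaveChart (g : LorentzMetric 3 M) (h : M → ℝ)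
    (φ : OpenPartialHomeomorph M (EuclideanSpace ℝ (Fin 3)))
    (γ₁ : ℝ) (γ₀ α β : ℝ → ℝ) : Prop :=
  γ₁ ≠ 0 ∧ ContDiffOn ℝ ∞ γ₀ (vRange φ) ∧ ContDiffOn ℝ ∞ α (vRange φ) ∧
  ContDiffOn ℝ ∞ β (vRange φ) ∧
  IsPPChart g φ (fun v x ↦
    (γ₁ * α v + 2 * γ₀ v * deriv (deriv γ₀) v) * Real.log (γ₀ v + γ₁ * x) / γ₁ ^ 2
      - 2 * x * deriv (deriv γ₀) v / γ₁ + β v) ∧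
  ∀ y ∈ φ.target, h (φ.symm y) = γ₁ * y 2 + γ₀ (y 1)

end DimensionThree

end

/-! Everything reduces to a computation in Brinkmann coordinates, followed by the integration of a
small system of differential equations.

Coordinates. A parallel field V is Killing and its metric dual form is closed. Since V is null, this
form is a differential dv with dv(V) = 0. On a leaf v = const the metric is degenerate with kernel
V, hence the square of a one-form. The Killing equation makes this form closed along the leaf, and
its primitive is x; a second closedness statement of the same kind gives u. The primitives must vary
smoothly with the leaf, which is the content of `exists_leafwise_primitive`. The outcome,
`IsPPField.exists_brinkmann_chart`, is g = 2 du dv + f dv² + dx² with V = ∂_u and f_u = 0; its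
curvature is governed by the single function f_xx.

Reduction. By `weightedEinstein_eq_zero_iff` the field equation says h_uu = h_ux = 0, h_uv = h_xx =
-Λ/2, h_vx = f_x h_u / 2, together with one equation for h_vv. The u-derivative of the latter is h_u
f_xx = 0. Near a point with R ≠ 0 this forces h_u = 0, so h_uv = 0 and Λ = 0. Now h_u = dh(V) is a
globally defined, locally constant function. As M is connected it vanishes everywhere, also where g
is flat. What remains is h = c x + γ(v) and γ'' + c f_x / 2 = -h f_xx / 2. Since |∇h|² = c² is
globally constant too, either c = 0 in all these charts or c ≠ 0 in all of them. This is the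
dichotomy of the theorem.

Integration. If c ≠ 0, the quantity h f_x + 2 γ'' x does not depend on x, and one more integration
produces the logarithm. If c = 0, then f_xx = -2 γ''/γ, so f is a quadratic polynomial in x. Moving
a suitable curve to the axis removes its linear and constant terms, and f_xxx = 0 gives the plane
wave condition.

The converse is substitution into the same formulas. The equation, flatness and the plane wave
condition are imposed in every chart of the maximal atlas, whereas each computation uses one well
chosen chart. The transformation law of the Christoffel symbols, `connection_transition`, bridges
this: it makes the curvature, its covariant derivative, the Hessian and the Laplacian tensorial. -/

noncomputable section

set_option linter.unusedSectionVars false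
set_option maxSynthPendingDepth 3

namespace LorentzMetric

/-! ### Differentials of charts and smoothness of components -/

section Charts

variable {n : ℕ} {M : Type*} [TopologicalSpace M]
  [ChartedSpace (EuclideanSpace ℝ (Fin n)) M] [IsManifold (𝓡 n) ∞ M]
  {φ ψ : OpenPartialHomeomorph M (EuclideanSpace ℝ (Fin n))}

/-- The differential of the inverse of a chart, with the tangent spaces of `M` read as `ℝⁿ`. -/
def dsymm (φ : OpenPartialHomeomorph M (EuclideanSpace ℝ (Fin n)))
    (y : EuclideanSpace ℝ (Fin n)) :
    EuclideanSpace ℝ (Fin n) →L[ℝ] EuclideanSpace ℝ (Fin n) :=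
  mfderiv (𝓡 n) (𝓡 n) φ.symm y

/-- The differential of a chart, with the tangent spaces of `M` read as `ℝⁿ`. -/
def dchart (φ : OpenPartialHomeomorph M (EuclideanSpace ℝ (Fin n))) (p : M) :
    EuclideanSpace ℝ (Fin n) →L[ℝ] EuclideanSpace ℝ (Fin n) :=
  mfderiv (𝓡 n) (𝓡 n) φ p

/-- The metric at a point, with the tangent space read as `ℝⁿ`. -/
def valE (g : LorentzMetric n M) (p : M) :
    EuclideanSpace ℝ (Fin n) →L[ℝ] EuclideanSpace ℝ (Fin n) →L[ℝ] ℝ :=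
  g.val p

/-- The metric pulled back to the target of a chart. -/
def chartForm (g : LorentzMetric n M) (φ : OpenPartialHomeomorph M (EuclideanSpace ℝ (Fin n)))
    (y : EuclideanSpace ℝ (Fin n)) :
    EuclideanSpace ℝ (Fin n) →L[ℝ] EuclideanSpace ℝ (Fin n) →L[ℝ] ℝ :=
  (g.valE (φ.symm y)).bilinearComp (dsymm φ y) (dsymm φ y)

theorem IsChart.contMDiffAt (hφ : IsChart φ) {p : M} (hp : p ∈ φ.source) :
    ContMDiffAt (𝓡 n) (𝓡 n) ∞ φ p :=
  contMDiffAt_of_mem_maximalAtlas hφ hp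

theorem IsChart.contMDiffAt_symm (hφ : IsChart φ) {y : EuclideanSpace ℝ (Fin n)}
    (hy : y ∈ φ.target) : ContMDiffAt (𝓡 n) (𝓡 n) ∞ φ.symm y :=
  contMDiffAt_symm_of_mem_maximalAtlas hφ hy

theorem IsChart.mdifferentiableAt (hφ : IsChart φ) {p : M} (hp : p ∈ φ.source) :
    MDifferentiableAt (𝓡 n) (𝓡 n) φ p :=
  (hφ.contMDiffAt hp).mdifferentiableAt (by simp)

theorem IsChart.mdifferentiableAt_symm (hφ : IsChart φ) {y : EuclideanSpace ℝ (Fin n)}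
    (hy : y ∈ φ.target) : MDifferentiableAt (𝓡 n) (𝓡 n) φ.symm y :=
  (hφ.contMDiffAt_symm hy).mdifferentiableAt (by simp)

theorem contDiffAt_transition (hφ : IsChart φ) (hψ : IsChart ψ) {y : EuclideanSpace ℝ (Fin n)}
    (hy : y ∈ φ.target) (hy' : φ.symm y ∈ ψ.source) : ContDiffAt ℝ ∞ (ψ ∘ φ.symm) y :=
  ((hψ.contMDiffAt hy').comp y (hφ.contMDiffAt_symm hy)).contDiffAt

theorem transition_mem_target {y : EuclideanSpace ℝ (Fin n)}
    (hy' : φ.symm y ∈ ψ.source) : (ψ ∘ φ.symm) y ∈ ψ.target := ψ.map_source hy'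

theorem symm_transition {y : EuclideanSpace ℝ (Fin n)}
    (hy' : φ.symm y ∈ ψ.source) : ψ.symm ((ψ ∘ φ.symm) y) = φ.symm y := ψ.left_inv hy'

theorem eventually_overlap {y : EuclideanSpace ℝ (Fin n)}
    (hy : y ∈ φ.target) (hy' : φ.symm y ∈ ψ.source) :
    ∀ᶠ z in 𝓝 y, z ∈ φ.target ∧ φ.symm z ∈ ψ.source :=
  (φ.open_target.mem_nhds hy |> fun h => Filter.Eventually.and h
    ((φ.continuousAt_symm hy).eventually (ψ.open_source.mem_nhds hy')))

theorem dsymm_transition (hφ : IsChart φ) (hψ : IsChart ψ) {y : EuclideanSpace ℝ (Fin n)}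
    (hy : y ∈ φ.target) (hy' : φ.symm y ∈ ψ.source) :
    dsymm φ y = (dsymm ψ ((ψ ∘ φ.symm) y)).comp (fderiv ℝ (ψ ∘ φ.symm) y) := by
  have h1 : φ.symm =ᶠ[𝓝 y] ψ.symm ∘ (ψ ∘ φ.symm) :=
    (eventually_overlap hy hy').mono fun z hz => (symm_transition hz.2).symm
  unfold dsymm
  rw [h1.mfderiv_eq, mfderiv_comp y
    (hψ.mdifferentiableAt_symm (transition_mem_target hy'))
    ((contDiffAt_transition hφ hψ hy hy').contMDiffAt.mdifferentiableAt (by simp)),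
    mfderiv_eq_fderiv]
  rfl

theorem dchart_transition (hφ : IsChart φ) (hψ : IsChart ψ) {y : EuclideanSpace ℝ (Fin n)}
    (hy : y ∈ φ.target) (hy' : φ.symm y ∈ ψ.source) :
    dchart ψ (φ.symm y) = (fderiv ℝ (ψ ∘ φ.symm) y).comp (dchart φ (φ.symm y)) := by
  have h1 : ψ =ᶠ[𝓝 (φ.symm y)] (ψ ∘ φ.symm) ∘ φ :=
    (φ.open_source.eventually_mem (φ.map_target hy)).mono fun z hz => by
      simp [φ.left_inv hz]
  have h2 : φ (φ.symm y) = y := φ.right_inv hy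
  unfold dchart
  rw [h1.mfderiv_eq, mfderiv_comp (φ.symm y)
    (by rw [h2]; exact (contDiffAt_transition hφ hψ hy hy').contMDiffAt.mdifferentiableAt (by simp))
    (hφ.mdifferentiableAt (φ.map_target hy)), mfderiv_eq_fderiv, h2]
  rfl

theorem dchart_comp_dsymm (hφ : IsChart φ) {y : EuclideanSpace ℝ (Fin n)} (hy : y ∈ φ.target) :
    (dchart φ (φ.symm y)).comp (dsymm φ y) = ContinuousLinearMap.id ℝ _ := by
  have h1 : φ ∘ φ.symm =ᶠ[𝓝 y] id :=
    (φ.open_target.eventually_mem hy).mono fun z hz => φ.right_inv hz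
  have h := mfderiv_comp (I := 𝓡 n) (I' := 𝓡 n) (I'' := 𝓡 n) y
    (hφ.mdifferentiableAt (φ.map_target hy)) (hφ.mdifferentiableAt_symm hy)
  rw [h1.mfderiv_eq, mfderiv_id] at h
  exact h.symm

/-- A one-sided inverse of an endomorphism of a finite-dimensional space is two-sided, so no second
differentiation is needed. -/
theorem dsymm_comp_dchart (hφ : IsChart φ) {y : EuclideanSpace ℝ (Fin n)} (hy : y ∈ φ.target) :
    (dsymm φ y).comp (dchart φ (φ.symm y)) = ContinuousLinearMap.id ℝ _ := by
  have h := dchart_comp_dsymm hφ hy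
  ext1 v
  have h2 : Function.Surjective (dsymm φ y) := by
    have : Function.Injective (dsymm φ y) := fun a b hab => by
      have h3 := congrArg (dchart φ (φ.symm y)) hab
      have ha := DFunLike.congr_fun h a
      have hb := DFunLike.congr_fun h b
      simp only [ContinuousLinearMap.comp_apply, ContinuousLinearMap.id_apply] at ha hb
      rw [ha, hb] at h3
      exact h3
    exact LinearMap.surjective_of_injective (f := (dsymm φ y).toLinearMap) this
  obtain ⟨w, rfl⟩ := h2 v
  have hw := DFunLike.congr_fun h w
  simp only [ContinuousLinearMap.comp_apply, ContinuousLinearMap.id_apply] at hw ⊢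
  rw [hw]

variable (g : LorentzMetric n M)

theorem mat_eq_chartForm (y : EuclideanSpace ℝ (Fin n)) (i j : Fin n) :
    g.mat φ y i j = g.chartForm φ y (EuclideanSpace.single i 1) (EuclideanSpace.single j 1) := rfl

theorem chartForm_symm (y X Y : EuclideanSpace ℝ (Fin n)) :
    g.chartForm φ y X Y = g.chartForm φ y Y X := g.symm _ _ _

theorem mat_symm (y : EuclideanSpace ℝ (Fin n)) (i j : Fin n) :
    g.mat φ y i j = g.mat φ y j i := g.symm _ _ _

theorem chartForm_transition (hφ : IsChart φ) (hψ : IsChart ψ) {y : EuclideanSpace ℝ (Fin n)}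
    (hy : y ∈ φ.target) (hy' : φ.symm y ∈ ψ.source) (X Y : EuclideanSpace ℝ (Fin n)) :
    g.chartForm φ y X Y = g.chartForm ψ ((ψ ∘ φ.symm) y) (fderiv ℝ (ψ ∘ φ.symm) y X)
      (fderiv ℝ (ψ ∘ φ.symm) y Y) := by
  simp only [chartForm, ContinuousLinearMap.bilinearComp_apply, dsymm_transition hφ hψ hy hy',
    symm_transition hy', ContinuousLinearMap.comp_apply]

theorem single_sum (X : EuclideanSpace ℝ (Fin n)) :
    ∑ i, X i • EuclideanSpace.single i (1 : ℝ) = X := by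
  simpa using (EuclideanSpace.basisFun (Fin n) ℝ).sum_repr X

/-- The coordinate fields are the images of constant fields under the tangent map of `φ.symm`, hence
smooth along `φ.symm`. Pairing them with the smooth section `g.val` is smooth in the bundle sense,
and the target bundle is trivial. -/
theorem contDiffAt_mat (hφ : IsChart φ) {y : EuclideanSpace ℝ (Fin n)} (hy : y ∈ φ.target)
    (i j : Fin n) : ContDiffAt ℝ ∞ (fun z => g.mat φ z i j) y := by
  have key : ∀ i : Fin n, ContMDiffAt (𝓡 n) (𝓡 n).tangent ∞
      (fun z : EuclideanSpace ℝ (Fin n) =>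
        (⟨φ.symm z, coordVec φ z i⟩ : TangentBundle (𝓡 n) M)) y := by
    intro i
    have h1 : ContMDiffOn (𝓡 n) (𝓡 n) ∞ φ.symm φ.target :=
      contMDiffOn_symm_of_mem_maximalAtlas hφ
    have h2 := h1.contMDiffOn_tangentMapWithin (m := ∞) (by simp)
      φ.open_target.uniqueMDiffOn
    have h3 : ContMDiffOn (𝓡 n) (𝓡 n).tangent ∞
        (fun z : EuclideanSpace ℝ (Fin n) => (⟨z, EuclideanSpace.single i (1:ℝ)⟩ :
          TangentBundle (𝓡 n) (EuclideanSpace ℝ (Fin n)))) φ.target := by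
      exact contMDiffOn_vectorSpace_iff_contDiffOn.2 contDiffOn_const
    have h4 := h2.comp h3 (fun z hz => hz)
    refine (h4.contMDiffAt (φ.open_target.mem_nhds hy)).congr_of_eventuallyEq ?_
    filter_upwards [φ.open_target.mem_nhds hy] with z hz
    simp only [tangentMapWithin, Function.comp, coordVec]
    rw [mfderivWithin_of_isOpen φ.open_target hz]
  have hg : ContMDiffAt (𝓡 n)
    ((𝓡 n).prod 𝓘(ℝ, EuclideanSpace ℝ (Fin n) →L[ℝ] EuclideanSpace ℝ (Fin n) →L[ℝ] ℝ)) ∞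
    (fun z ↦ Bundle.TotalSpace.mk'
      (E := fun p : M ↦ TangentSpace (𝓡 n) p →L[ℝ] TangentSpace (𝓡 n) p →L[ℝ] ℝ)
      (EuclideanSpace ℝ (Fin n) →L[ℝ] EuclideanSpace ℝ (Fin n) →L[ℝ] ℝ) (φ.symm z)
        (g.val (φ.symm z))) y :=
    g.contMDiff.contMDiffAt.comp y (hφ.contMDiffAt_symm hy)
  have : ContMDiffAt (𝓡 n) ((𝓡 n).prod 𝓘(ℝ)) ∞
      (fun z ↦ Bundle.TotalSpace.mk' ℝ (E := Bundle.Trivial M ℝ) (φ.symm z) 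
        (g.val (φ.symm z) (coordVec φ z i) (coordVec φ z j))) y := by
    apply ContMDiffAt.clm_bundle_apply₂ (F₁ := EuclideanSpace ℝ (Fin n))
      (F₂ := EuclideanSpace ℝ (Fin n))
    · exact hg
    · exact key i
    · exact key j
  rw [Bundle.contMDiffAt_totalSpace] at this
  exact this.2.contDiffAt

theorem contDiffAt_comp_symm {h : M → ℝ} (hh : ContMDiff (𝓡 n) 𝓘(ℝ, ℝ) ∞ h) (hφ : IsChart φ)
    {y : EuclideanSpace ℝ (Fin n)} (hy : y ∈ φ.target) : ContDiffAt ℝ ∞ (h ∘ φ.symm) y :=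
  (hh.contMDiffAt.comp y (hφ.contMDiffAt_symm hy)).contDiffAt

theorem contDiffAt_vecComp {V : ∀ p : M, TangentSpace (𝓡 n) p}
    (hV : ContMDiff (𝓡 n) (𝓡 n).tangent ∞ (fun p ↦ (⟨p, V p⟩ : TangentBundle (𝓡 n) M)))
    (hφ : IsChart φ) {y : EuclideanSpace ℝ (Fin n)} (hy : y ∈ φ.target) (i : Fin n) :
    ContDiffAt ℝ ∞ (vecComp φ V i) y := by
  have h1 : ContMDiffOn (𝓡 n) (𝓡 n) ∞ φ φ.source := contMDiffOn_of_mem_maximalAtlas hφ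
  have h2 := h1.contMDiffOn_tangentMapWithin (m := ∞) (by simp) φ.open_source.uniqueMDiffOn
  have h3 := h2.comp (hV.contMDiffOn (s := φ.source)) (fun z hz => hz)
  have h4 := ((h3.contMDiffAt (φ.open_source.mem_nhds (φ.map_target hy))).comp y
    (hφ.contMDiffAt_symm hy))
  rw [Bundle.contMDiffAt_totalSpace] at h4
  have h5 := h4.2.contDiffAt
  have h6 := (contDiff_euclidean.1 contDiff_id i).contDiffAt.comp y h5
  refine h6.congr_of_eventuallyEq ?_
  filter_upwards [φ.open_target.mem_nhds hy] with z hz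
  simp only [vecComp, Function.comp, tangentMapWithin, id]
  rw [mfderivWithin_of_isOpen φ.open_source (φ.map_target hz)]
  simp

end Charts

end LorentzMetric

/-! ### Transformation laws of connection, curvature and Hessian -/

theorem two_le_infty : (2 : WithTop ℕ∞) ≤ ∞ := WithTop.coe_le_coe.2 (le_top : (2:ℕ∞) ≤ ⊤)

section Connections

variable {E F : Type*} [NormedAddCommGroup E] [NormedSpace ℝ E] [NormedAddCommGroup F] [NormedSpace ℝ F]

/-- The map `X ↦ (Y ↦ Γ X ∘ Γ Y)`. -/
def compSelf (Γ : E →L[ℝ] E →L[ℝ] E) : E →L[ℝ] E →L[ℝ] E →L[ℝ] E :=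
  (((ContinuousLinearMap.compL ℝ E E E).comp Γ).flip.comp Γ).flip

/-- The curvature of the connection with Christoffel symbols `Γ` on an open subset of `E`. -/
def curv (Γ : E → E →L[ℝ] E →L[ℝ] E) (y : E) : E →L[ℝ] E →L[ℝ] E →L[ℝ] E :=
  fderiv ℝ Γ y - (fderiv ℝ Γ y).flip + (compSelf (Γ y) - (compSelf (Γ y)).flip)

theorem curv_apply (Γ : E → E →L[ℝ] E →L[ℝ] E) (y X Y Z : E) :
    curv Γ y X Y Z = fderiv ℝ Γ y X Y Z - fderiv ℝ Γ y Y X Z + (Γ y X (Γ y Y Z) - Γ y Y (Γ y X Z)) :=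
  rfl

theorem contDiffAt_flip {G : Type*} [NormedAddCommGroup G] [NormedSpace ℝ G] {f : E → E →L[ℝ] F →L[ℝ] G} {y : E}
   (hf : ContDiffAt ℝ ∞ f y) :
    ContDiffAt ℝ ∞ (fun z => (f z).flip) y :=
  (ContinuousLinearMap.flipₗᵢ ℝ E F G).contDiff.contDiffAt.comp y hf

theorem contDiffAt_curv {Γ : E → E →L[ℝ] E →L[ℝ] E} {y : E} (hΓ : ContDiffAt ℝ ∞ Γ y) :
    ContDiffAt ℝ ∞ (curv Γ) y := by
  have h1 := hΓ.fderiv_right (m := ∞) (by simp)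
  have h2 : ContDiffAt ℝ ∞ (fun z => compSelf (Γ z)) y := by
    unfold compSelf
    exact contDiffAt_flip ((contDiffAt_flip (contDiffAt_const.clm_comp hΓ)).clm_comp hΓ)
  exact (h1.sub (contDiffAt_flip h1)).add (h2.sub (contDiffAt_flip h2))

end Connections
namespace LorentzMetric

section Tensors

variable {n : ℕ}

/-- Reduces multilinear identities to basis vectors one slot at a time. `IsLinearMap` is used,
rather than bundled maps, so that any slot of an expression can be treated after a `revert`. -/
theorem linear_ext_single {F : Type*} [AddCommGroup F] [Module ℝ F]
    {f f' : EuclideanSpace ℝ (Fin n) → F} (hf : IsLinearMap ℝ f) (hf' : IsLinearMap ℝ f')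
    (h : ∀ i, f (EuclideanSpace.single i 1) = f' (EuclideanSpace.single i 1))
    (X : EuclideanSpace ℝ (Fin n)) : f X = f' X := by
  have : hf.mk' f = hf'.mk' f' :=
    (EuclideanSpace.basisFun (Fin n) ℝ).toBasis.ext fun i => by simpa using h i
  exact DFunLike.congr_fun this X

/-- The vector-valued bilinear map with components `c k i j`. -/
def tensorTwo (c : Fin n → Fin n → Fin n → ℝ) :
    EuclideanSpace ℝ (Fin n) →L[ℝ] EuclideanSpace ℝ (Fin n) →L[ℝ] EuclideanSpace ℝ (Fin n) :=
  ∑ k, ∑ i, ∑ j, c k i j • (EuclideanSpace.proj i : EuclideanSpace ℝ (Fin n) →L[ℝ] ℝ).smulRight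
    ((EuclideanSpace.proj j : EuclideanSpace ℝ (Fin n) →L[ℝ] ℝ).smulRight
      (EuclideanSpace.single k (1 : ℝ)))

theorem tensorTwo_single (c : Fin n → Fin n → Fin n → ℝ) (k i j : Fin n) :
    tensorTwo c (EuclideanSpace.single i 1) (EuclideanSpace.single j 1) k = c k i j := by
  simp [tensorTwo, sum_apply, Pi.single_apply, PiLp.single_apply,
    Finset.sum_ite_eq]

theorem contDiffAt_tensorTwo {c : Fin n → Fin n → Fin n → EuclideanSpace ℝ (Fin n) → ℝ}
    {y : EuclideanSpace ℝ (Fin n)} (hc : ∀ k i j, ContDiffAt ℝ ∞ (c k i j) y) :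
    ContDiffAt ℝ ∞ (fun z => tensorTwo fun k i j => c k i j z) y := by
  unfold tensorTwo
  exact ContDiffAt.sum fun k _ => ContDiffAt.sum fun i _ => ContDiffAt.sum fun j _ =>
    (hc k i j).smul contDiffAt_const

theorem contDiffAt_pd {f : EuclideanSpace ℝ (Fin n) → ℝ} {y : EuclideanSpace ℝ (Fin n)}
    (hf : ContDiffAt ℝ ∞ f y) (i : Fin n) : ContDiffAt ℝ ∞ (pd i f) y :=
  (hf.fderiv_right (m := ∞) (by simp)).clm_apply contDiffAt_const

theorem expand_apply_left {F : Type*} [AddCommGroup F] [Module ℝ F] [TopologicalSpace F]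
    (L : EuclideanSpace ℝ (Fin n) →L[ℝ] F) (X : EuclideanSpace ℝ (Fin n)) :
    L X = ∑ i, X i • L (EuclideanSpace.single i 1) := by
  conv_lhs => rw [← single_sum X, map_sum]
  simp

end Tensors

section Tensoriality

variable {n : ℕ} {M : Type*} [TopologicalSpace M]
  [ChartedSpace (EuclideanSpace ℝ (Fin n)) M] [IsManifold (𝓡 n) ∞ M]
  (g : LorentzMetric n M) {φ ψ : OpenPartialHomeomorph M (EuclideanSpace ℝ (Fin n))}

/-- The differential of a chart is invertible, so nondegeneracy passes to the pulled-back form. It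
serves as the cancellation rule for vector identities obtained by pairing with the metric. -/
theorem chartForm_nondegenerate (hφ : IsChart φ) {y : EuclideanSpace ℝ (Fin n)}
    (hy : y ∈ φ.target) {X : EuclideanSpace ℝ (Fin n)} (h : ∀ Z, g.chartForm φ y X Z = 0) :
    X = 0 := by
  have h1 : dsymm φ y X = 0 := by
    have : ∀ W : EuclideanSpace ℝ (Fin n), g.valE (φ.symm y) (dsymm φ y X) W = 0 := ?_
    · exact (g.form_nondegenerate (φ.symm y)).1 (dsymm φ y X) this
    intro W
    have h2 := h (dchart φ (φ.symm y) W)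
    have h3 := DFunLike.congr_fun (dsymm_comp_dchart hφ hy) W
    simp only [ContinuousLinearMap.comp_apply, ContinuousLinearMap.id_apply] at h3
    simp only [chartForm, ContinuousLinearMap.bilinearComp_apply, h3] at h2
    exact h2
  have h2 := DFunLike.congr_fun (dchart_comp_dsymm hφ hy) X
  simp only [ContinuousLinearMap.comp_apply, ContinuousLinearMap.id_apply, h1, map_zero] at h2
  exact h2.symm

theorem isUnit_mat (hφ : IsChart φ) {y : EuclideanSpace ℝ (Fin n)}
    (hy : y ∈ φ.target) : IsUnit (g.mat φ y) := by
  rw [← Matrix.mulVec_injective_iff_isUnit]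
  refine (injective_iff_map_eq_zero (g.mat φ y).mulVecLin).2 fun v hv => ?_
  have h : (WithLp.toLp 2 v : EuclideanSpace ℝ (Fin n)) = 0 := by
    refine g.chartForm_nondegenerate hφ hy fun Z => ?_
    refine linear_ext_single (f' := fun _ => (0 : ℝ)) ⟨by simp, by simp⟩ ⟨by simp, by simp⟩
      (fun i => ?_) Z
    rw [chartForm_symm, expand_apply_left]
    have := congrFun hv i
    simp only [Matrix.mulVecLin_apply, Matrix.mulVec, dotProduct, mat_eq_chartForm] at this
    simpa [mul_comm] using this
  simpa using h

theorem mat_mul_invMat (hφ : IsChart φ) {y : EuclideanSpace ℝ (Fin n)}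
    (hy : y ∈ φ.target) : g.mat φ y * g.invMat φ y = 1 :=
  Matrix.mul_nonsing_inv _ ((Matrix.isUnit_iff_isUnit_det _).1 (g.isUnit_mat hφ hy))

/-- By Cramer's rule the entries are quotients of polynomials in the entries of the metric by its
nonvanishing determinant. -/
theorem contDiffAt_invMat (hφ : IsChart φ) {y : EuclideanSpace ℝ (Fin n)} (hy : y ∈ φ.target)
    (i j : Fin n) : ContDiffAt ℝ ∞ (fun z => g.invMat φ z i j) y := by
  have hd : ∀ A : EuclideanSpace ℝ (Fin n) → Matrix (Fin n) (Fin n) ℝ,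
      (∀ i j, ContDiffAt ℝ ∞ (fun z => A z i j) y) → ContDiffAt ℝ ∞ (fun z => (A z).det) y := by
    intro A hA
    simp only [Matrix.det_apply]
    exact ContDiffAt.sum fun σ _ => (contDiffAt_prod fun i _ => hA _ _).const_smul _
  have h0 : (g.mat φ y).det ≠ 0 :=
    ((Matrix.isUnit_iff_isUnit_det _).1 (g.isUnit_mat hφ hy)).ne_zero
  have hm := fun i j => g.contDiffAt_mat hφ hy i j
  simp only [invMat, Matrix.inv_def, Matrix.smul_apply, Matrix.adjugate_apply, smul_eq_mul,
    Ring.inverse_eq_inv']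
  refine ((hd _ hm).inv h0).mul (hd _ fun k l => ?_)
  simp only [Matrix.updateRow_apply]
  split_ifs
  · exact contDiffAt_const
  · exact hm k l

theorem contDiffAt_christoffel (hφ : IsChart φ) {y : EuclideanSpace ℝ (Fin n)}
    (hy : y ∈ φ.target) (k i j : Fin n) : ContDiffAt ℝ ∞ (g.christoffel φ k i j) y := by
  have hm := fun i j k => contDiffAt_pd (g.contDiffAt_mat hφ hy i j) k
  exact contDiffAt_const.mul (ContDiffAt.sum fun l _ => (g.contDiffAt_invMat hφ hy k l).mul
    (((hm _ _ _).add (hm _ _ _)).sub (hm _ _ _)))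

theorem contDiffAt_chartForm (hφ : IsChart φ) {y : EuclideanSpace ℝ (Fin n)}
    (hy : y ∈ φ.target) : ContDiffAt ℝ ∞ (g.chartForm φ) y := by
  have : g.chartForm φ = fun z => ∑ i, ∑ j, g.mat φ z i j •
      (EuclideanSpace.proj i : EuclideanSpace ℝ (Fin n) →L[ℝ] ℝ).smulRight
        (EuclideanSpace.proj j : EuclideanSpace ℝ (Fin n) →L[ℝ] ℝ) := by
    ext z X Y
    rw [expand_apply_left (g.chartForm φ z) X]
    simp only [sum_apply, smul_apply, smul_eq_mul,
      ContinuousLinearMap.smulRight_apply, PiLp.proj_apply, mat_eq_chartForm]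
    refine Finset.sum_congr rfl fun i _ => ?_
    rw [expand_apply_left (g.chartForm φ z (EuclideanSpace.single i 1)) Y, Finset.mul_sum]
    exact Finset.sum_congr rfl fun j _ => by simp only [smul_eq_mul]; ring
  rw [this]
  exact ContDiffAt.sum fun i _ => ContDiffAt.sum fun j _ =>
    (g.contDiffAt_mat hφ hy i j).smul contDiffAt_const

theorem pd_mat (hφ : IsChart φ) {y : EuclideanSpace ℝ (Fin n)} (hy : y ∈ φ.target)
    (i j k : Fin n) : pd k (fun z => g.mat φ z i j) y = fderiv ℝ (g.chartForm φ) y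
      (EuclideanSpace.single k 1) (EuclideanSpace.single i 1) (EuclideanSpace.single j 1) := by
  have hG := ((g.contDiffAt_chartForm hφ hy).differentiableAt (by simp)).hasFDerivAt
  have h := (hG.clm_apply (hasFDerivAt_const (EuclideanSpace.single i (1:ℝ)) y)).clm_apply
    (hasFDerivAt_const (EuclideanSpace.single j (1:ℝ)) y)
  have h2 : (fun z => g.mat φ z i j) = fun z => g.chartForm φ z (EuclideanSpace.single i 1)
    (EuclideanSpace.single j 1) := rfl
  rw [pd, h2, h.fderiv]
  simp

/-- The Christoffel symbols as a bilinear map. -/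
def connection (φ : OpenPartialHomeomorph M (EuclideanSpace ℝ (Fin n)))
    (y : EuclideanSpace ℝ (Fin n)) :
    EuclideanSpace ℝ (Fin n) →L[ℝ] EuclideanSpace ℝ (Fin n) →L[ℝ] EuclideanSpace ℝ (Fin n) :=
  tensorTwo fun k i j => g.christoffel φ k i j y

theorem contDiffAt_connection (hφ : IsChart φ) {y : EuclideanSpace ℝ (Fin n)}
    (hy : y ∈ φ.target) : ContDiffAt ℝ ∞ (g.connection φ) y :=
  contDiffAt_tensorTwo fun k i j => g.contDiffAt_christoffel hφ hy k i j

theorem connection_single (y : EuclideanSpace ℝ (Fin n)) (k i j : Fin n) :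
    g.connection φ y (EuclideanSpace.single i 1) (EuclideanSpace.single j 1) k
      = g.christoffel φ k i j y := tensorTwo_single _ _ _ _

/-- Lowering the upper index cancels the inverse matrix and leaves the symbols of the first kind.
Arguments based on this form never meet the inverse metric. -/
theorem sum_mat_christoffel (hφ : IsChart φ) {y : EuclideanSpace ℝ (Fin n)}
    (hy : y ∈ φ.target) (l i j : Fin n) :
    ∑ k, g.mat φ y l k * g.christoffel φ k i j y = (1 / 2) *
      (pd i (fun z ↦ g.mat φ z j l) y + pd j (fun z ↦ g.mat φ z i l) y
      - pd l (fun z ↦ g.mat φ z i j) y) := by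
  set w : Fin n → ℝ := fun l => (pd i (fun z ↦ g.mat φ z j l) y + pd j (fun z ↦ g.mat φ z i l) y
      - pd l (fun z ↦ g.mat φ z i j) y) with hw
  have h : (g.mat φ y).mulVec ((g.invMat φ y).mulVec w) = w := by
    rw [Matrix.mulVec_mulVec, g.mat_mul_invMat hφ hy, Matrix.one_mulVec]
  have h2 := congrFun h l
  simp only [Matrix.mulVec, dotProduct] at h2
  simp only [christoffel]
  change _ = 1 / 2 * w l
  rw [← h2, Finset.mul_sum]
  exact Finset.sum_congr rfl fun k _ => by ring

/-- The Koszul formula for coordinate fields. -/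
theorem chartForm_connection (hφ : IsChart φ) {y : EuclideanSpace ℝ (Fin n)}
    (hy : y ∈ φ.target) (X Y Z : EuclideanSpace ℝ (Fin n)) :
    g.chartForm φ y (g.connection φ y X Y) Z = (1 / 2) *
      (fderiv ℝ (g.chartForm φ) y X Y Z + fderiv ℝ (g.chartForm φ) y Y X Z
        - fderiv ℝ (g.chartForm φ) y Z X Y) := by
  revert X
  refine linear_ext_single ⟨by simp, by simp⟩
    ⟨fun a b => by simp; ring, fun a b => by simp; ring⟩ fun i => ?_
  revert Y
  refine linear_ext_single ⟨by simp, by simp⟩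
    ⟨fun a b => by simp; ring, fun a b => by simp; ring⟩ fun j => ?_
  revert Z
  refine linear_ext_single ⟨by simp, by simp⟩
    ⟨fun a b => by simp; ring, fun a b => by simp; ring⟩ fun l => ?_
  rw [← g.pd_mat hφ hy, ← g.pd_mat hφ hy, ← g.pd_mat hφ hy, ← g.sum_mat_christoffel hφ hy,
    chartForm_symm, expand_apply_left]
  refine Finset.sum_congr rfl fun k _ => ?_
  rw [connection_single, mat_eq_chartForm, smul_eq_mul, mul_comm]

/-- The transformation law of the Christoffel symbols. -/
theorem connection_transition (hφ : IsChart φ) (hψ : IsChart ψ) {y : EuclideanSpace ℝ (Fin n)}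
    (hy : y ∈ φ.target) (hy' : φ.symm y ∈ ψ.source) (X Y : EuclideanSpace ℝ (Fin n)) :
    fderiv ℝ (ψ ∘ φ.symm) y (g.connection φ y X Y) =
      g.connection ψ ((ψ ∘ φ.symm) y) (fderiv ℝ (ψ ∘ φ.symm) y X) (fderiv ℝ (ψ ∘ φ.symm) y Y)
        + fderiv ℝ (fderiv ℝ (ψ ∘ φ.symm)) y X Y := by
  have hT := contDiffAt_transition hφ hψ hy hy'
  have hyψ := transition_mem_target hy'
  have hback : ψ.symm ((ψ ∘ φ.symm) y) ∈ φ.source := by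
    rw [symm_transition hy']; exact φ.map_target hy
  have hsurj : Function.Surjective (fderiv ℝ (ψ ∘ φ.symm) y) := by
    have h1 := dsymm_transition hφ hψ hy hy'
    refine LinearMap.surjective_of_injective (f := (fderiv ℝ (ψ ∘ φ.symm) y).toLinearMap)
      ((injective_iff_map_eq_zero _).2 fun a ha => ?_)
    have h2 := DFunLike.congr_fun (dchart_comp_dsymm hφ hy) a
    rw [h1] at h2
    simp only [ContinuousLinearMap.comp_apply, ContinuousLinearMap.id_apply] at h2
    have ha' : fderiv ℝ (ψ ∘ φ.symm) y a = 0 := ha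
    rw [ha', map_zero, map_zero] at h2
    exact h2.symm
  have hT1 := (hT.differentiableAt (by simp)).hasFDerivAt
  have hT2 := ((hT.fderiv_right (m := ∞) (by simp)).differentiableAt (by simp)).hasFDerivAt
  have hG := ((g.contDiffAt_chartForm hφ hy).differentiableAt (by simp)).hasFDerivAt
  have hG' := ((g.contDiffAt_chartForm hψ hyψ).differentiableAt (by simp)).hasFDerivAt
  have hsymm : ∀ A B, fderiv ℝ (fderiv ℝ (ψ ∘ φ.symm)) y A B
      = fderiv ℝ (fderiv ℝ (ψ ∘ φ.symm)) y B A := fun A B =>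
    (hT.isSymmSndFDerivAt (by simpa using two_le_infty)) A B
  -- The metric of `φ` is the pullback of that of `ψ`. The product rule gives the pulled-back
  -- derivative and two terms containing the second derivative of the transition map.
  have key : ∀ A B C, fderiv ℝ (g.chartForm φ) y A B C =
      fderiv ℝ (g.chartForm ψ) ((ψ ∘ φ.symm) y) (fderiv ℝ (ψ ∘ φ.symm) y A)
          (fderiv ℝ (ψ ∘ φ.symm) y B) (fderiv ℝ (ψ ∘ φ.symm) y C)
        + g.chartForm ψ ((ψ ∘ φ.symm) y) (fderiv ℝ (fderiv ℝ (ψ ∘ φ.symm)) y A B)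
          (fderiv ℝ (ψ ∘ φ.symm) y C)
        + g.chartForm ψ ((ψ ∘ φ.symm) y) (fderiv ℝ (ψ ∘ φ.symm) y B)
          (fderiv ℝ (fderiv ℝ (ψ ∘ φ.symm)) y A C) := by
    intro A B C
    have e1 := (hG.clm_apply (hasFDerivAt_const B y)).clm_apply (hasFDerivAt_const C y)
    have e2 := ((hG'.comp y hT1).clm_apply (hT2.clm_apply (hasFDerivAt_const B y))).clm_apply
      (hT2.clm_apply (hasFDerivAt_const C y))
    have e3 : (fun z => g.chartForm φ z B C) =ᶠ[𝓝 y] fun z =>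
        (g.chartForm ψ ∘ (ψ ∘ φ.symm)) z (fderiv ℝ (ψ ∘ φ.symm) z B)
          (fderiv ℝ (ψ ∘ φ.symm) z C) :=
      (eventually_overlap hy hy').mono fun z hz => g.chartForm_transition hφ hψ hz.1 hz.2 B C
    have e4 := DFunLike.congr_fun (e1.unique (e2.congr_of_eventuallyEq e3)) A
    simp at e4
    simp only [Function.comp_apply]
    rw [e4]
    ring
  -- Pairing with an arbitrary vector reduces the claim to the Koszul formula in both charts. Of the
  -- six second-derivative terms supplied by `key`, four cancel by symmetry and the other two
  -- coincide, giving exactly the inhomogeneous term.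
  rw [← sub_eq_zero]
  refine g.chartForm_nondegenerate hψ hyψ fun Z => ?_
  obtain ⟨Z, rfl⟩ := hsurj Z
  rw [map_sub, map_add, sub_apply, add_apply,
    ← g.chartForm_transition hφ hψ hy hy', g.chartForm_connection hφ hy,
    g.chartForm_connection hψ hyψ, key, key, key, hsymm Y X, hsymm Z X, hsymm Z Y,
    g.chartForm_symm _ (fderiv ℝ (fderiv ℝ (ψ ∘ φ.symm)) y X Z)]
  ring

end Tensoriality

end LorentzMetric

section Connections

variable {E : Type*} [NormedAddCommGroup E] [NormedSpace ℝ E]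

/-- The covariant derivative of the curvature. -/
def covCurv (Γ : E → E →L[ℝ] E →L[ℝ] E) (y W X Y Z : E) : E :=
  fderiv ℝ (curv Γ) y W X Y Z + Γ y W (curv Γ y X Y Z) - curv Γ y (Γ y W X) Y Z
    - curv Γ y X (Γ y W Y) Z - curv Γ y X Y (Γ y W Z)

/-- The Hessian of a function. -/
def hessian (Γ : E → E →L[ℝ] E →L[ℝ] E) (H : E → ℝ) (y X Y : E) : ℝ :=
  fderiv ℝ (fderiv ℝ H) y X Y - fderiv ℝ H y (Γ y X Y)

variable {Γ Γ' : E → E →L[ℝ] E →L[ℝ] E} {T : E → E} {y : E}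

/-- A formal consequence of the law for `Γ`. Differentiating that law introduces third derivatives
of `T`, which are symmetric and disappear under antisymmetrisation; the second derivatives cancel
against those produced by the quadratic part of the curvature. -/
theorem curv_transition (hT : ContDiffAt ℝ ∞ T y) (hΓ : ContDiffAt ℝ ∞ Γ y)
    (hΓ' : ContDiffAt ℝ ∞ Γ' (T y))
    (h : ∀ᶠ z in 𝓝 y, ∀ X Y, fderiv ℝ T z (Γ z X Y) =
      Γ' (T z) (fderiv ℝ T z X) (fderiv ℝ T z Y) + fderiv ℝ (fderiv ℝ T) z X Y) (X Y Z : E) :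
    fderiv ℝ T y (curv Γ y X Y Z) =
      curv Γ' (T y) (fderiv ℝ T y X) (fderiv ℝ T y Y) (fderiv ℝ T y Z) := by
  have hT' := hT.fderiv_right (m := ∞) (by simp)
  have hT'' := hT'.fderiv_right (m := ∞) (by simp)
  have h1 := (hT.differentiableAt (by simp)).hasFDerivAt
  have h2 := (hT'.differentiableAt (by simp)).hasFDerivAt
  have h3 := (hT''.differentiableAt (by simp)).hasFDerivAt
  have hG := (hΓ.differentiableAt (by simp)).hasFDerivAt
  have hG' := (hΓ'.differentiableAt (by simp)).hasFDerivAt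
  have s2 : ∀ A B, fderiv ℝ (fderiv ℝ T) y A B = fderiv ℝ (fderiv ℝ T) y B A := fun A B =>
    (hT.isSymmSndFDerivAt (by simpa using two_le_infty)) A B
  have s3 : ∀ A B C, fderiv ℝ (fderiv ℝ (fderiv ℝ T)) y A B C =
      fderiv ℝ (fderiv ℝ (fderiv ℝ T)) y B A C := fun A B C =>
    DFunLike.congr_fun ((hT'.isSymmSndFDerivAt (by simpa using two_le_infty)) A B) C
  -- The derivative of the transformation law in direction `W`, solved for the term containing the
  -- derivative of `Γ`.
  have e : ∀ W A B, fderiv ℝ T y (fderiv ℝ Γ y W A B) =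
      fderiv ℝ Γ' (T y) (fderiv ℝ T y W) (fderiv ℝ T y A) (fderiv ℝ T y B)
      + Γ' (T y) (fderiv ℝ (fderiv ℝ T) y W A) (fderiv ℝ T y B)
      + Γ' (T y) (fderiv ℝ T y A) (fderiv ℝ (fderiv ℝ T) y W B)
      + fderiv ℝ (fderiv ℝ (fderiv ℝ T)) y W A B - fderiv ℝ (fderiv ℝ T) y W (Γ y A B) := by
    intro W A B
    have cA := hasFDerivAt_const (𝕜 := ℝ) A y
    have cB := hasFDerivAt_const (𝕜 := ℝ) B y
    have d1 := h2.clm_apply ((hG.clm_apply cA).clm_apply cB)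
    have d2 := (((hG'.comp y h1).clm_apply (h2.clm_apply cA)).clm_apply (h2.clm_apply cB)).add
      ((h3.clm_apply cA).clm_apply cB)
    have d3 := DFunLike.congr_fun (d1.unique (d2.congr_of_eventuallyEq
      (h.mono fun z hz => hz A B))) W
    simp at d3
    rw [← eq_sub_iff_add_eq] at d3
    rw [d3]
    abel
  have hy := h.self_of_nhds
  simp only [curv_apply, map_sub, map_add, e, hy, s2 Y X, s3 Y X]
  abel

/-- Differentiating the tensor law of the curvature produces second derivatives of `T`; these are
the inhomogeneous terms in the law for `Γ`, with opposite sign. -/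
theorem covCurv_transition (hT : ContDiffAt ℝ ∞ T y) (hΓ : ContDiffAt ℝ ∞ Γ y)
    (hΓ' : ContDiffAt ℝ ∞ Γ' (T y))
    (h : ∀ᶠ z in 𝓝 y, ∀ X Y, fderiv ℝ T z (Γ z X Y) =
      Γ' (T z) (fderiv ℝ T z X) (fderiv ℝ T z Y) + fderiv ℝ (fderiv ℝ T) z X Y)
    (hc : ∀ᶠ z in 𝓝 y, ∀ X Y Z, fderiv ℝ T z (curv Γ z X Y Z) =
      curv Γ' (T z) (fderiv ℝ T z X) (fderiv ℝ T z Y) (fderiv ℝ T z Z)) (W X Y Z : E) :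
    fderiv ℝ T y (covCurv Γ y W X Y Z) = covCurv Γ' (T y) (fderiv ℝ T y W) (fderiv ℝ T y X)
      (fderiv ℝ T y Y) (fderiv ℝ T y Z) := by
  have hT' := hT.fderiv_right (m := ∞) (by simp)
  have h1 := (hT.differentiableAt (by simp)).hasFDerivAt
  have h2 := (hT'.differentiableAt (by simp)).hasFDerivAt
  have hR := ((contDiffAt_curv hΓ).differentiableAt (by simp)).hasFDerivAt
  have hR' := ((contDiffAt_curv hΓ').differentiableAt (by simp)).hasFDerivAt
  have cX := hasFDerivAt_const (𝕜 := ℝ) X y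
  have cY := hasFDerivAt_const (𝕜 := ℝ) Y y
  have cZ := hasFDerivAt_const (𝕜 := ℝ) Z y
  have d1 := h2.clm_apply (((hR.clm_apply cX).clm_apply cY).clm_apply cZ)
  have d2 := (((hR'.comp y h1).clm_apply (h2.clm_apply cX)).clm_apply (h2.clm_apply cY)).clm_apply
    (h2.clm_apply cZ)
  have d3 := DFunLike.congr_fun (d1.unique (d2.congr_of_eventuallyEq
      (hc.mono fun z hz => hz X Y Z))) W
  simp at d3
  rw [← eq_sub_iff_add_eq] at d3
  have hy := h.self_of_nhds
  have hcy := hc.self_of_nhds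
  simp only [covCurv, map_sub, map_add, d3, hy, hcy, add_apply]
  abel

/-- The second derivative of `H' ∘ T` contains `dH'(D²T)`, which the inhomogeneous term in the law
for `Γ` removes. -/
theorem hessian_transition {H H' : E → ℝ} (hT : ContDiffAt ℝ ∞ T y)
    (hH' : ContDiffAt ℝ ∞ H' (T y))
    (h : ∀ X Y, fderiv ℝ T y (Γ y X Y) =
      Γ' (T y) (fderiv ℝ T y X) (fderiv ℝ T y Y) + fderiv ℝ (fderiv ℝ T) y X Y)
    (hHH : H =ᶠ[𝓝 y] H' ∘ T) (X Y : E) :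
    hessian Γ H y X Y = hessian Γ' H' (T y) (fderiv ℝ T y X) (fderiv ℝ T y Y) := by
  have hT' := hT.fderiv_right (m := ∞) (by simp)
  have h1 := (hT.differentiableAt (by simp)).hasFDerivAt
  have h2 := (hT'.differentiableAt (by simp)).hasFDerivAt
  have hD := (hH'.fderiv_right (m := ∞) (by simp)).differentiableAt (by simp) |>.hasFDerivAt
  have hd : fderiv ℝ H =ᶠ[𝓝 y] fun z => (fderiv ℝ H' (T z)).comp (fderiv ℝ T z) := by
    have hev : ∀ᶠ z in 𝓝 y, DifferentiableAt ℝ T z := by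
      filter_upwards [(hT.of_le (one_le_two.trans two_le_infty)).eventually (by simp)] with z hz using hz.differentiableAt (by simp)
    have hev' : ∀ᶠ z in 𝓝 y, DifferentiableAt ℝ H' (T z) := by
      refine (hT.continuousAt.eventually ?_)
      filter_upwards [(hH'.of_le (one_le_two.trans two_le_infty)).eventually (by simp)] with z hz using hz.differentiableAt (by simp)
    filter_upwards [hHH.eventuallyEq_nhds, hev, hev'] with z hz ha hb
    rw [hz.fderiv_eq, fderiv_comp z hb ha]
  have hdy := hd.self_of_nhds
  have e1 := ((hD.comp y h1).clm_comp h2).congr_of_eventuallyEq hd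
  have e2 := DFunLike.congr_fun (DFunLike.congr_fun e1.fderiv X) Y
  simp at e2
  simp only [hessian, hdy, e2, ContinuousLinearMap.comp_apply, h, map_add]
  ring

end Connections

namespace LorentzMetric

section Tensoriality

variable {n : ℕ} {M : Type*} [TopologicalSpace M]
  [ChartedSpace (EuclideanSpace ℝ (Fin n)) M] [IsManifold (𝓡 n) ∞ M]
  (g : LorentzMetric n M) {φ ψ : OpenPartialHomeomorph M (EuclideanSpace ℝ (Fin n))}
  {y : EuclideanSpace ℝ (Fin n)}

theorem pd_comp_apply {F : EuclideanSpace ℝ (Fin n) → EuclideanSpace ℝ (Fin n)}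
    (hF : DifferentiableAt ℝ F y) (i l : Fin n) :
    pd i (fun z => F z l) y = fderiv ℝ F y (EuclideanSpace.single i 1) l := by
  have := ((EuclideanSpace.proj l : EuclideanSpace ℝ (Fin n) →L[ℝ] ℝ).hasFDerivAt.comp y
    hF.hasFDerivAt).fderiv
  have h2 : (fun z => F z l) = (EuclideanSpace.proj l : EuclideanSpace ℝ (Fin n) →L[ℝ] ℝ) ∘ F := rfl
  rw [pd, h2, this]
  rfl

theorem connection_apply (X Y : EuclideanSpace ℝ (Fin n)) (k : Fin n) :
    g.connection φ y X Y k = ∑ i, ∑ j, g.christoffel φ k i j y * X i * Y j := by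
  rw [expand_apply_left (g.connection φ y) X]
  simp only [sum_apply, smul_apply]
  rw [WithLp.ofLp_sum, Finset.sum_apply]
  refine Finset.sum_congr rfl fun i _ => ?_
  rw [expand_apply_left (g.connection φ y (EuclideanSpace.single i 1)) Y]
  rw [PiLp.smul_apply, WithLp.ofLp_sum, Finset.sum_apply, smul_eq_mul, Finset.mul_sum]
  refine Finset.sum_congr rfl fun j _ => ?_
  rw [PiLp.smul_apply, connection_single, smul_eq_mul]
  ring

theorem curv_single (hφ : IsChart φ) (hy : y ∈ φ.target) (l i j k : Fin n) :
    curv (g.connection φ) y (EuclideanSpace.single i 1) (EuclideanSpace.single j 1)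
      (EuclideanSpace.single k 1) l = g.riem φ l i j k y := by
  have hΓ := ((g.contDiffAt_connection hφ hy).differentiableAt (by simp)).hasFDerivAt
  have e : ∀ i j k, pd i (g.christoffel φ l j k) y = fderiv ℝ (g.connection φ) y
      (EuclideanSpace.single i 1) (EuclideanSpace.single j 1) (EuclideanSpace.single k 1) l := by
    intro i j k
    have hd := (hΓ.clm_apply (hasFDerivAt_const (EuclideanSpace.single j (1:ℝ)) y)).clm_apply
      (hasFDerivAt_const (EuclideanSpace.single k (1:ℝ)) y)
    have := pd_comp_apply hd.differentiableAt i l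
    rw [hd.fderiv] at this
    simp only [connection_single] at this
    rw [show g.christoffel φ l j k = fun z => g.christoffel φ l j k z from rfl, this]
    simp
  have e2 : ∀ i j k, g.connection φ y (EuclideanSpace.single i 1) (g.connection φ y
      (EuclideanSpace.single j 1) (EuclideanSpace.single k 1)) l =
      ∑ m, g.christoffel φ l i m y * g.christoffel φ m j k y := by
    intro i j k
    rw [connection_apply, Finset.sum_eq_single i (by simp +contextual) (by simp)]
    simp [connection_single]
  rw [riem, e, e, curv_apply, Finset.sum_sub_distrib, ← e2, ← e2]
  rfl

theorem eventually_connection_transition (hφ : IsChart φ) (hψ : IsChart ψ)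
    (hy : y ∈ φ.target) (hy' : φ.symm y ∈ ψ.source) :
    ∀ᶠ z in 𝓝 y, ∀ X Y, fderiv ℝ (ψ ∘ φ.symm) z (g.connection φ z X Y) =
      g.connection ψ ((ψ ∘ φ.symm) z) (fderiv ℝ (ψ ∘ φ.symm) z X) (fderiv ℝ (ψ ∘ φ.symm) z Y)
        + fderiv ℝ (fderiv ℝ (ψ ∘ φ.symm)) z X Y :=
  (eventually_overlap hy hy').mono fun _ hz => g.connection_transition hφ hψ hz.1 hz.2

theorem curvature_transition (hφ : IsChart φ) (hψ : IsChart ψ)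
    (hy : y ∈ φ.target) (hy' : φ.symm y ∈ ψ.source) (X Y Z : EuclideanSpace ℝ (Fin n)) :
    fderiv ℝ (ψ ∘ φ.symm) y (curv (g.connection φ) y X Y Z) =
      curv (g.connection ψ) ((ψ ∘ φ.symm) y) (fderiv ℝ (ψ ∘ φ.symm) y X)
        (fderiv ℝ (ψ ∘ φ.symm) y Y) (fderiv ℝ (ψ ∘ φ.symm) y Z) :=
  curv_transition (contDiffAt_transition hφ hψ hy hy') (g.contDiffAt_connection hφ hy)
    (g.contDiffAt_connection hψ (transition_mem_target hy'))
    (g.eventually_connection_transition hφ hψ hy hy') X Y Z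

theorem covCurvature_transition (hφ : IsChart φ) (hψ : IsChart ψ)
    (hy : y ∈ φ.target) (hy' : φ.symm y ∈ ψ.source) (W X Y Z : EuclideanSpace ℝ (Fin n)) :
    fderiv ℝ (ψ ∘ φ.symm) y (covCurv (g.connection φ) y W X Y Z) =
      covCurv (g.connection ψ) ((ψ ∘ φ.symm) y) (fderiv ℝ (ψ ∘ φ.symm) y W)
        (fderiv ℝ (ψ ∘ φ.symm) y X) (fderiv ℝ (ψ ∘ φ.symm) y Y) (fderiv ℝ (ψ ∘ φ.symm) y Z) :=
  covCurv_transition (contDiffAt_transition hφ hψ hy hy') (g.contDiffAt_connection hφ hy)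
    (g.contDiffAt_connection hψ (transition_mem_target hy'))
    (g.eventually_connection_transition hφ hψ hy hy')
    ((eventually_overlap hy hy').mono fun _ hz => g.curvature_transition hφ hψ hz.1 hz.2) W X Y Z

theorem covCurv_single (hφ : IsChart φ) (hy : y ∈ φ.target) (m l i j k : Fin n) :
    covCurv (g.connection φ) y (EuclideanSpace.single m 1) (EuclideanSpace.single i 1)
      (EuclideanSpace.single j 1) (EuclideanSpace.single k 1) l = g.covRiem φ m l i j k y := by
  have hR := ((contDiffAt_curv (g.contDiffAt_connection hφ hy)).differentiableAt
    (by simp)).hasFDerivAt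
  have e : pd m (g.riem φ l i j k) y = fderiv ℝ (curv (g.connection φ)) y
      (EuclideanSpace.single m 1) (EuclideanSpace.single i 1) (EuclideanSpace.single j 1)
      (EuclideanSpace.single k 1) l := by
    have hd := ((hR.clm_apply (hasFDerivAt_const (EuclideanSpace.single i (1:ℝ)) y)).clm_apply
      (hasFDerivAt_const (EuclideanSpace.single j (1:ℝ)) y)).clm_apply
      (hasFDerivAt_const (EuclideanSpace.single k (1:ℝ)) y)
    have := pd_comp_apply hd.differentiableAt m l
    rw [hd.fderiv] at this
    have h2 : g.riem φ l i j k =ᶠ[𝓝 y] fun z => curv (g.connection φ) z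
        (EuclideanSpace.single i 1) (EuclideanSpace.single j 1) (EuclideanSpace.single k 1) l := by
      filter_upwards [φ.open_target.mem_nhds hy] with z hz using (g.curv_single hφ hz l i j k).symm
    rw [pd, h2.fderiv_eq, ← pd, this]
    simp
  have e1 : ∀ a : Fin n, ∀ f : Fin n → ℝ, ∑ b, (EuclideanSpace.single a (1:ℝ)) b * f b = f a := by
    intro a f
    simp [PiLp.single_apply]
  rw [covRiem, e, covCurv]
  simp only [PiLp.sub_apply, PiLp.add_apply, Finset.sum_sub_distrib]
  have c1 : g.connection φ y (EuclideanSpace.single m 1) (curv (g.connection φ) y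
      (EuclideanSpace.single i 1) (EuclideanSpace.single j 1) (EuclideanSpace.single k 1)) l =
      ∑ a, g.christoffel φ l m a y * g.riem φ a i j k y := by
    rw [connection_apply, Finset.sum_eq_single m (by simp +contextual) (by simp)]
    simp [g.curv_single hφ hy]
  have c2 : curv (g.connection φ) y (g.connection φ y (EuclideanSpace.single m 1)
      (EuclideanSpace.single i 1)) (EuclideanSpace.single j 1) (EuclideanSpace.single k 1) l =
      ∑ a, g.christoffel φ a m i y * g.riem φ l a j k y := by
    rw [expand_apply_left (curv (g.connection φ) y)]
    simp [g.curv_single hφ hy, connection_single]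
  have c3 : curv (g.connection φ) y (EuclideanSpace.single i 1) (g.connection φ y
      (EuclideanSpace.single m 1) (EuclideanSpace.single j 1)) (EuclideanSpace.single k 1) l =
      ∑ a, g.christoffel φ a m j y * g.riem φ l i a k y := by
    rw [expand_apply_left (curv (g.connection φ) y (EuclideanSpace.single i 1))]
    simp [g.curv_single hφ hy, connection_single]
  have c4 : curv (g.connection φ) y (EuclideanSpace.single i 1) (EuclideanSpace.single j 1)
      (g.connection φ y (EuclideanSpace.single m 1) (EuclideanSpace.single k 1)) l =
      ∑ a, g.christoffel φ a m k y * g.riem φ l i j a y := by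
    rw [expand_apply_left (curv (g.connection φ) y (EuclideanSpace.single i 1)
      (EuclideanSpace.single j 1))]
    simp [g.curv_single hφ hy, connection_single]
  rw [c1, c2, c3, c4]
  ring

end Tensoriality

end LorentzMetric

namespace LorentzMetric

/-! ### Invariance of the field equation, flatness and transversal parallelism -/

section Einstein

variable {n : ℕ} {M : Type*} [TopologicalSpace M]
  [ChartedSpace (EuclideanSpace ℝ (Fin n)) M] [IsManifold (𝓡 n) ∞ M]
  (g : LorentzMetric n M) {φ ψ : OpenPartialHomeomorph M (EuclideanSpace ℝ (Fin n))}
  {y : EuclideanSpace ℝ (Fin n)}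

theorem trace_eq_sum_single (L : EuclideanSpace ℝ (Fin n) →ₗ[ℝ] EuclideanSpace ℝ (Fin n)) :
    LinearMap.trace ℝ _ L = ∑ i, L (EuclideanSpace.single i 1) i := by
  rw [LinearMap.trace_eq_matrix_trace ℝ (EuclideanSpace.basisFun (Fin n) ℝ).toBasis, Matrix.trace]
  refine Finset.sum_congr rfl fun i _ => ?_
  simp [LinearMap.toMatrix_apply]

theorem fderiv_transition_bijective (hφ : IsChart φ) (hψ : IsChart ψ)
    (hy : y ∈ φ.target) (hy' : φ.symm y ∈ ψ.source) :
    Function.Bijective (fderiv ℝ (ψ ∘ φ.symm) y) := by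
  have hinj : Function.Injective (fderiv ℝ (ψ ∘ φ.symm) y) := by
    refine (injective_iff_map_eq_zero _).2 fun a ha => ?_
    have h2 := DFunLike.congr_fun (dchart_comp_dsymm hφ hy) a
    rw [dsymm_transition hφ hψ hy hy'] at h2
    simp only [ContinuousLinearMap.comp_apply, ContinuousLinearMap.id_apply, ha, map_zero] at h2
    exact h2.symm
  exact ⟨hinj, LinearMap.surjective_of_injective (f := (fderiv ℝ (ψ ∘ φ.symm) y).toLinearMap) hinj⟩

/-- Conjugate endomorphisms have the same trace. The Ricci tensor and the Laplacian are both traces,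
so this carries their invariance without any manipulation of inverse matrices. -/
theorem trace_eq_of_semiconj {J L L' : EuclideanSpace ℝ (Fin n) →ₗ[ℝ] EuclideanSpace ℝ (Fin n)}
    (hJ : Function.Bijective J) (h : ∀ X, J (L X) = L' (J X)) :
    LinearMap.trace ℝ _ L = LinearMap.trace ℝ _ L' := by
  have : L' = (LinearEquiv.ofBijective J hJ).conj L := by
    ext1 X
    obtain ⟨X, rfl⟩ := hJ.2 X
    have h2 : (LinearEquiv.ofBijective J hJ).symm (J X) = X :=
      (LinearEquiv.ofBijective J hJ).symm_apply_apply X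
    rw [LinearEquiv.conj_apply_apply, h2, LinearEquiv.ofBijective_apply, h]
  rw [this, LinearMap.trace_conj']

/-- The Ricci tensor as a bilinear map. -/
def ricciForm (φ : OpenPartialHomeomorph M (EuclideanSpace ℝ (Fin n)))
    (y Y Z : EuclideanSpace ℝ (Fin n)) : ℝ :=
  LinearMap.trace ℝ _ (((curv (g.connection φ) y).flip Y).flip Z).toLinearMap

theorem ricciForm_single (hφ : IsChart φ) (hy : y ∈ φ.target) (j k : Fin n) :
    g.ricciForm φ y (EuclideanSpace.single j 1) (EuclideanSpace.single k 1) = g.ricci φ j k y := by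
  rw [ricciForm, trace_eq_sum_single]
  exact Finset.sum_congr rfl fun i _ => g.curv_single hφ hy i i j k

theorem ricciForm_transition (hφ : IsChart φ) (hψ : IsChart ψ)
    (hy : y ∈ φ.target) (hy' : φ.symm y ∈ ψ.source) (Y Z : EuclideanSpace ℝ (Fin n)) :
    g.ricciForm φ y Y Z = g.ricciForm ψ ((ψ ∘ φ.symm) y) (fderiv ℝ (ψ ∘ φ.symm) y Y)
      (fderiv ℝ (ψ ∘ φ.symm) y Z) :=
  trace_eq_of_semiconj (J := (fderiv ℝ (ψ ∘ φ.symm) y).toLinearMap)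
    (fderiv_transition_bijective hφ hψ hy hy')
    fun X => g.curvature_transition hφ hψ hy hy' X Y Z

theorem fderiv_fderiv_single {H : EuclideanSpace ℝ (Fin n) → ℝ} (hH : ContDiffAt ℝ ∞ H y)
    (i j : Fin n) : fderiv ℝ (fderiv ℝ H) y (EuclideanSpace.single i 1) (EuclideanSpace.single j 1)
      = pd i (pd j H) y := by
  have h1 := ((hH.fderiv_right (m := ∞) (by simp)).differentiableAt (by simp)).hasFDerivAt
  have := (h1.clm_apply (hasFDerivAt_const (EuclideanSpace.single j (1:ℝ)) y)).fderiv
  have h2 : pd j H = fun z => fderiv ℝ H z (EuclideanSpace.single j 1) := rfl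
  rw [pd, h2, this]
  simp

theorem hessian_single {h : M → ℝ} (hh : ContMDiff (𝓡 n) 𝓘(ℝ, ℝ) ∞ h) (hφ : IsChart φ)
    (hy : y ∈ φ.target) (i j : Fin n) :
    hessian (g.connection φ) (h ∘ φ.symm) y (EuclideanSpace.single i 1)
      (EuclideanSpace.single j 1) = g.hess φ h i j y := by
  rw [hessian, hess, fderiv_fderiv_single (contDiffAt_comp_symm hh hφ hy),
    expand_apply_left (fderiv ℝ (h ∘ φ.symm) y)]
  simp [connection_single, pd]

theorem hessian_chart_transition {h : M → ℝ} (hh : ContMDiff (𝓡 n) 𝓘(ℝ, ℝ) ∞ h) (hφ : IsChart φ)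
    (hψ : IsChart ψ) (hy : y ∈ φ.target) (hy' : φ.symm y ∈ ψ.source)
    (X Y : EuclideanSpace ℝ (Fin n)) :
    hessian (g.connection φ) (h ∘ φ.symm) y X Y = hessian (g.connection ψ) (h ∘ ψ.symm)
      ((ψ ∘ φ.symm) y) (fderiv ℝ (ψ ∘ φ.symm) y X) (fderiv ℝ (ψ ∘ φ.symm) y Y) := by
  refine hessian_transition (contDiffAt_transition hφ hψ hy hy')
    (contDiffAt_comp_symm hh hψ (transition_mem_target hy'))
    (g.connection_transition hφ hψ hy hy') ?_ X Y
  filter_upwards [eventually_overlap hy hy'] with z hz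
  simp only [Function.comp_apply]
  rw [ψ.left_inv hz.2]

theorem isLinearMap_hessian_left {E : Type*} [NormedAddCommGroup E] [NormedSpace ℝ E]
    (Γ : E → E →L[ℝ] E →L[ℝ] E) (H : E → ℝ) (y Y : E) :
    IsLinearMap ℝ fun X => hessian Γ H y X Y :=
  ⟨fun a b => by simp [hessian]; ring, fun a b => by simp [hessian]; ring⟩

theorem isLinearMap_hessian_right {E : Type*} [NormedAddCommGroup E] [NormedSpace ℝ E]
    (Γ : E → E →L[ℝ] E →L[ℝ] E) (H : E → ℝ) (y X : E) :
    IsLinearMap ℝ fun Y => hessian Γ H y X Y :=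
  ⟨fun a b => by simp [hessian]; ring, fun a b => by simp [hessian]; ring⟩

/-- The Laplacian is the trace of the endomorphism associated with the Hessian. -/
theorem exists_hessian_endomorphism {h : M → ℝ} (hh : ContMDiff (𝓡 n) 𝓘(ℝ, ℝ) ∞ h)
    (hφ : IsChart φ) (hy : y ∈ φ.target) :
    ∃ S : EuclideanSpace ℝ (Fin n) →ₗ[ℝ] EuclideanSpace ℝ (Fin n),
      (∀ X Y, g.chartForm φ y (S X) Y = hessian (g.connection φ) (h ∘ φ.symm) y X Y) ∧
      LinearMap.trace ℝ _ S = g.lap φ h y := by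
  have hl := fun Y => isLinearMap_hessian_left (g.connection φ) (h ∘ φ.symm) y Y
  have hr := fun X => isLinearMap_hessian_right (g.connection φ) (h ∘ φ.symm) y X
  -- The Hessian with its second index raised by the inverse metric.
  let f : EuclideanSpace ℝ (Fin n) → EuclideanSpace ℝ (Fin n) := fun X => WithLp.toLp 2 fun i =>
    ∑ j, g.invMat φ y i j *
      hessian (g.connection φ) (h ∘ φ.symm) y X (EuclideanSpace.single j 1)
  have hf : IsLinearMap ℝ f := by
    constructor
    · intro a b
      ext i
      simp [f, (hl _).map_add, mul_add, Finset.sum_add_distrib]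
    · intro c a
      ext i
      simp only [f, (hl _).map_smul, PiLp.smul_apply, smul_eq_mul, Finset.mul_sum]
      exact Finset.sum_congr rfl fun j _ => by ring
  refine ⟨hf.mk' f, fun X Y => ?_, ?_⟩
  · revert Y
    refine linear_ext_single ⟨by simp, by simp⟩ (hr X) fun l => ?_
    set w : Fin n → ℝ := fun j =>
      hessian (g.connection φ) (h ∘ φ.symm) y X (EuclideanSpace.single j 1)
    have e : (g.mat φ y).mulVec ((g.invMat φ y).mulVec w) = w := by
      rw [Matrix.mulVec_mulVec, g.mat_mul_invMat hφ hy, Matrix.one_mulVec]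
    have e2 := congrFun e l
    change _ = w l
    rw [← e2, chartForm_symm, expand_apply_left]
    simp only [Matrix.mulVec, dotProduct, mat_eq_chartForm]
    refine Finset.sum_congr rfl fun i _ => ?_
    rw [smul_eq_mul, mul_comm]
    rfl
  · rw [trace_eq_sum_single, lap]
    simp only [← g.hessian_single hh hφ hy]
    rfl

/-- The Hessian endomorphisms of the two charts are conjugate by the transition differential: paired
with the metric, both give the same Hessian. -/
theorem lap_transition {h : M → ℝ} (hh : ContMDiff (𝓡 n) 𝓘(ℝ, ℝ) ∞ h) (hφ : IsChart φ)
    (hψ : IsChart ψ) (hy : y ∈ φ.target) (hy' : φ.symm y ∈ ψ.source) :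
    g.lap φ h y = g.lap ψ h ((ψ ∘ φ.symm) y) := by
  have hyψ := transition_mem_target hy'
  obtain ⟨S, hS, hS'⟩ := g.exists_hessian_endomorphism hh hφ hy
  obtain ⟨R, hR, hR'⟩ := g.exists_hessian_endomorphism hh hψ hyψ
  have hb := fderiv_transition_bijective hφ hψ hy hy'
  rw [← hS', ← hR']
  refine trace_eq_of_semiconj (J := (fderiv ℝ (ψ ∘ φ.symm) y).toLinearMap) hb fun X => ?_
  rw [← sub_eq_zero]
  refine g.chartForm_nondegenerate hψ hyψ fun Z => ?_
  obtain ⟨Z, rfl⟩ := hb.2 Z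
  rw [map_sub, sub_apply, hR, ContinuousLinearMap.coe_coe,
    ← g.chartForm_transition hφ hψ hy hy', hS, g.hessian_chart_transition hh hφ hψ hy hy', sub_self]

/-- The tensor is bilinear and transforms tensorially. Vanishing on the coordinate basis of `ψ`
therefore means vanishing on all pairs of vectors, including the images of the coordinate basis of
`φ`. -/
theorem weightedEinstein_of_transition {h : M → ℝ} (hh : ContMDiff (𝓡 n) 𝓘(ℝ, ℝ) ∞ h)
    (hφ : IsChart φ) (hψ : IsChart ψ) (hy : y ∈ φ.target) (hy' : φ.symm y ∈ ψ.source) {Λ : ℝ}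
    (hE : ∀ i j, g.weightedEinstein ψ h Λ i j ((ψ ∘ φ.symm) y) = 0) (i j : Fin n) :
    g.weightedEinstein φ h Λ i j y = 0 := by
  have hyψ := transition_mem_target hy'
  have key : ∀ A B, h (φ.symm y) * g.ricciForm ψ ((ψ ∘ φ.symm) y) A B
      - hessian (g.connection ψ) (h ∘ ψ.symm) ((ψ ∘ φ.symm) y) A B
      + (g.lap ψ h ((ψ ∘ φ.symm) y) + Λ) * g.chartForm ψ ((ψ ∘ φ.symm) y) A B = 0 := by
    intro A B
    revert A
    refine linear_ext_single (f' := fun _ => (0:ℝ))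
      ⟨fun a b => by simp [hessian, ricciForm]; ring,
        fun c a => by simp [hessian, ricciForm]; ring⟩ ⟨by simp, by simp⟩ fun i => ?_
    revert B
    refine linear_ext_single (f' := fun _ => (0:ℝ))
      ⟨fun a b => by simp [hessian, ricciForm]; ring,
        fun c a => by simp [hessian, ricciForm]; ring⟩ ⟨by simp, by simp⟩ fun j => ?_
    rw [g.ricciForm_single hψ hyψ, g.hessian_single hh hψ hyψ, ← mat_eq_chartForm]
    have := hE i j
    rwa [weightedEinstein, symm_transition hy'] at this
  rw [weightedEinstein, ← g.ricciForm_single hφ hy, ← g.hessian_single hh hφ hy, mat_eq_chartForm,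
    g.ricciForm_transition hφ hψ hy hy', g.hessian_chart_transition hh hφ hψ hy hy',
    g.lap_transition hh hφ hψ hy hy', g.chartForm_transition hφ hψ hy hy']
  exact key _ _

theorem curv_eq_zero_iff (hφ : IsChart φ) (hy : y ∈ φ.target) :
    curv (g.connection φ) y = 0 ↔ ∀ l i j k, g.riem φ l i j k y = 0 := by
  constructor
  · intro h l i j k
    rw [← g.curv_single hφ hy, h]
    simp
  · intro h
    ext1 X
    revert X
    refine linear_ext_single ⟨by simp, by simp⟩ ⟨by simp, by simp⟩ fun i => ?_
    ext1 X
    revert X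
    refine linear_ext_single ⟨by simp, by simp⟩ ⟨by simp, by simp⟩ fun j => ?_
    ext1 X
    revert X
    refine linear_ext_single ⟨by simp, by simp⟩ ⟨by simp, by simp⟩ fun k => ?_
    ext l
    rw [g.curv_single hφ hy, h]
    simp

theorem curv_eq_zero_of_transition (hφ : IsChart φ) (hψ : IsChart ψ) (hy : y ∈ φ.target)
    (hy' : φ.symm y ∈ ψ.source) (h : curv (g.connection ψ) ((ψ ∘ φ.symm) y) = 0) :
    curv (g.connection φ) y = 0 := by
  ext1 X; ext1 Y; ext1 Z
  apply (fderiv_transition_bijective hφ hψ hy hy').1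
  rw [g.curvature_transition hφ hψ hy hy', h]
  simp

/-- Flatness at a point can be checked in a single chart. -/
theorem isFlatAt_iff {p : M} (hφ : IsChart φ) (hp : p ∈ φ.source) :
    g.IsFlatAt p ↔ ∀ l i j k, g.riem φ l i j k (φ p) = 0 := by
  refine ⟨fun h => h φ hφ hp, fun h ψ hψ hp' => ?_⟩
  rw [← g.curv_eq_zero_iff hφ (φ.map_source hp)] at h
  rw [← g.curv_eq_zero_iff hψ (ψ.map_source hp')]
  have e : ψ.symm (ψ p) = p := ψ.left_inv hp'
  refine g.curv_eq_zero_of_transition hψ hφ (ψ.map_source hp') (by rwa [e]) ?_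
  rw [Function.comp_apply, e, h]

/-- The vacuum equation can be checked in charts around each point. -/
theorem solvesVacuum_of_exists_chart {h : M → ℝ} (hh : ContMDiff (𝓡 n) 𝓘(ℝ, ℝ) ∞ h) {Λ : ℝ}
    (H : ∀ p : M, ∃ ψ : OpenPartialHomeomorph M (EuclideanSpace ℝ (Fin n)), IsChart ψ ∧
      p ∈ ψ.source ∧ ∀ y ∈ ψ.target, ∀ i j, g.weightedEinstein ψ h Λ i j y = 0) :
    g.SolvesVacuum h Λ := by
  intro φ hφ y hy i j
  obtain ⟨ψ, hψ, hp, hE⟩ := H (φ.symm y)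
  exact g.weightedEinstein_of_transition hh hφ hψ hy hp (hE _ (transition_mem_target hp)) i j

/-- The components of a vector field, as a vector. -/
def vecCoord (φ : OpenPartialHomeomorph M (EuclideanSpace ℝ (Fin n)))
    (V : ∀ p : M, TangentSpace (𝓡 n) p) (y : EuclideanSpace ℝ (Fin n)) :
    EuclideanSpace ℝ (Fin n) :=
  dchart φ (φ.symm y) (V (φ.symm y))

theorem vecCoord_apply (V : ∀ p : M, TangentSpace (𝓡 n) p) (i : Fin n) :
    vecCoord φ V y i = vecComp φ V i y := rfl

theorem vecCoord_transition (V : ∀ p : M, TangentSpace (𝓡 n) p) (hφ : IsChart φ)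
    (hψ : IsChart ψ) (hy : y ∈ φ.target) (hy' : φ.symm y ∈ ψ.source) :
    vecCoord ψ V ((ψ ∘ φ.symm) y) = fderiv ℝ (ψ ∘ φ.symm) y (vecCoord φ V y) := by
  have e : ψ.symm ((ψ ∘ φ.symm) y) = φ.symm y := symm_transition hy'
  unfold vecCoord
  rw [e, dchart_transition hφ hψ hy hy']
  rfl

theorem dsymm_vecCoord (V : ∀ p : M, TangentSpace (𝓡 n) p) (hφ : IsChart φ) (hy : y ∈ φ.target) :
    dsymm φ y (vecCoord φ V y) = V (φ.symm y) :=
  DFunLike.congr_fun (dsymm_comp_dchart hφ hy) (V (φ.symm y))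

theorem isPerp_iff (V : ∀ p : M, TangentSpace (𝓡 n) p) (hφ : IsChart φ) (hy : y ∈ φ.target)
    (X : Fin n → ℝ) :
    g.IsPerp V φ y X ↔ g.chartForm φ y (vecCoord φ V y) (WithLp.toLp 2 X) = 0 := by
  have e : dsymm φ y (WithLp.toLp 2 X) = ∑ i, X i • coordVec φ y i := by
    rw [expand_apply_left]
    rfl
  rw [chartForm, ContinuousLinearMap.bilinearComp_apply, dsymm_vecCoord V hφ hy, e]
  rfl

theorem covRiem_contract (hφ : IsChart φ) (hy : y ∈ φ.target) (X : Fin n → ℝ) (l i j k : Fin n) :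
    ∑ m, X m * g.covRiem φ m l i j k y = covCurv (g.connection φ) y (WithLp.toLp 2 X)
      (EuclideanSpace.single i 1) (EuclideanSpace.single j 1) (EuclideanSpace.single k 1) l := by
  have hlin : IsLinearMap ℝ fun W => covCurv (g.connection φ) y W (EuclideanSpace.single i 1)
      (EuclideanSpace.single j 1) (EuclideanSpace.single k 1) :=
    ⟨fun a b => by simp [covCurv]; abel, fun c a => by simp [covCurv, smul_sub, smul_add]⟩
  have e := congrArg (hlin.mk' _) (single_sum (WithLp.toLp 2 X))
  rw [map_sum] at e
  simp only [IsLinearMap.mk'_apply, map_smul] at e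
  rw [← e, WithLp.ofLp_sum, Finset.sum_apply]
  refine Finset.sum_congr rfl fun m _ => ?_
  rw [← g.covCurv_single hφ hy]
  rfl

/-- Transversal parallelism of the curvature can be checked in charts around each point. -/
theorem covRiem_perp_of_exists_chart (V : ∀ p : M, TangentSpace (𝓡 n) p)
    (H : ∀ p : M, ∃ ψ : OpenPartialHomeomorph M (EuclideanSpace ℝ (Fin n)), IsChart ψ ∧
      p ∈ ψ.source ∧ ∀ y ∈ ψ.target, ∀ W X Y Z : EuclideanSpace ℝ (Fin n),
        g.chartForm ψ y (vecCoord ψ V y) W = 0 → covCurv (g.connection ψ) y W X Y Z = 0)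
    (hφ : IsChart φ) (hy : y ∈ φ.target) (X : Fin n → ℝ) (hX : g.IsPerp V φ y X)
    (l i j k : Fin n) : ∑ m, X m * g.covRiem φ m l i j k y = 0 := by
  obtain ⟨ψ, hψ, hp, hE⟩ := H (φ.symm y)
  have e : covCurv (g.connection φ) y (WithLp.toLp 2 X) (EuclideanSpace.single i 1)
      (EuclideanSpace.single j 1) (EuclideanSpace.single k 1) = 0 := by
    apply (fderiv_transition_bijective hφ hψ hy hp).1
    rw [g.covCurvature_transition hφ hψ hy hp, map_zero]
    apply hE _ (transition_mem_target hp)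
    rw [vecCoord_transition V hφ hψ hy hp, ← g.chartForm_transition hφ hψ hy hp]
    exact (g.isPerp_iff V hφ hy X).1 hX
  rw [g.covRiem_contract hφ hy, e]
  rfl

end Einstein

end LorentzMetric

/-! ### Partial derivatives and functions of the middle coordinate -/

section PartialDerivatives

variable {n : ℕ} {y : EuclideanSpace ℝ (Fin n)} {f f' : EuclideanSpace ℝ (Fin n) → ℝ}

theorem ContDiffAt.diff {E F : Type*} [NormedAddCommGroup E] [NormedSpace ℝ E]
    [NormedAddCommGroup F] [NormedSpace ℝ F] {f : E → F} {y : E} (h : ContDiffAt ℝ ∞ f y) :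
    DifferentiableAt ℝ f y := h.differentiableAt (by simp)

theorem pd_congr (h : f =ᶠ[𝓝 y] f') (i : Fin n) : pd i f y = pd i f' y := by
  rw [pd, pd, h.fderiv_eq]

theorem pd_const (c : ℝ) (i : Fin n) : pd i (fun _ => c) y = 0 := by
  simp [pd]

theorem pd_add (hf : DifferentiableAt ℝ f y) (hf' : DifferentiableAt ℝ f' y) (i : Fin n) :
    pd i (fun z => f z + f' z) y = pd i f y + pd i f' y := by
  rw [pd, fderiv_fun_add hf hf']; rfl

theorem pd_sub (hf : DifferentiableAt ℝ f y) (hf' : DifferentiableAt ℝ f' y) (i : Fin n) :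
    pd i (fun z => f z - f' z) y = pd i f y - pd i f' y := by
  rw [pd, fderiv_fun_sub hf hf']; rfl

theorem pd_mul (hf : DifferentiableAt ℝ f y) (hf' : DifferentiableAt ℝ f' y) (i : Fin n) :
    pd i (fun z => f z * f' z) y = f y * pd i f' y + f' y * pd i f y := by
  rw [pd, fderiv_fun_mul hf hf']; rfl

theorem pd_const_mul (c : ℝ) (hf : DifferentiableAt ℝ f y) (i : Fin n) :
    pd i (fun z => c * f z) y = c * pd i f y := by
  rw [pd_mul (differentiableAt_const c) hf, pd_const, mul_zero, add_zero]

theorem pd_coord (i j : Fin n) :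
    pd i (fun z : EuclideanSpace ℝ (Fin n) => z j) y = if j = i then 1 else 0 := by
  have h : (fun z : EuclideanSpace ℝ (Fin n) => z j) =
    (EuclideanSpace.proj j : EuclideanSpace ℝ (Fin n) →L[ℝ] ℝ) := rfl
  rw [pd, h, ContinuousLinearMap.fderiv]
  simp [PiLp.single_apply]

theorem contDiff_coord (j : Fin n) : ContDiff ℝ ∞ fun z : EuclideanSpace ℝ (Fin n) => z j :=
  (EuclideanSpace.proj j : EuclideanSpace ℝ (Fin n) →L[ℝ] ℝ).contDiff

theorem pd_comp {a : ℝ → ℝ} (ha : DifferentiableAt ℝ a (f y)) (hf : DifferentiableAt ℝ f y)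
    (i : Fin n) : pd i (fun z => a (f z)) y = deriv a (f y) * pd i f y := by
  have := (ha.hasDerivAt.comp_hasFDerivAt y hf.hasFDerivAt).fderiv
  rw [pd, show (fun z => a (f z)) = a ∘ f from rfl, this]
  rfl

theorem pd_comp_coord {a : ℝ → ℝ} {j : Fin n} (ha : DifferentiableAt ℝ a (y j)) (i : Fin n) :
    pd i (fun z => a (z j)) y = if j = i then deriv a (y j) else 0 := by
  rw [pd_comp (f := fun z => z j) ha ((contDiff_coord j).contDiffAt.diff), pd_coord]
  simp

theorem pd_pd_comm (hf : ContDiffAt ℝ ∞ f y) (i j : Fin n) :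
    pd i (pd j f) y = pd j (pd i f) y := by
  rw [← LorentzMetric.fderiv_fderiv_single hf, ← LorentzMetric.fderiv_fderiv_single hf]
  exact (hf.isSymmSndFDerivAt (by simpa using two_le_infty)) _ _

theorem fderiv_eq_sum_pd (v : EuclideanSpace ℝ (Fin n)) :
    fderiv ℝ f y v = ∑ i, v i * pd i f y := by
  rw [LorentzMetric.expand_apply_left (fderiv ℝ f y) v]
  rfl

/-- Restriction to a segment. Only the derivative in the direction of the segment has to vanish, so
points of one leaf `y₁ = const` can be compared. -/
theorem eq_of_fderiv_segment_eq_zero {s : Set (EuclideanSpace ℝ (Fin n))} (hs : Convex ℝ s)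
    (hf : ∀ z ∈ s, DifferentiableAt ℝ f z) {x : EuclideanSpace ℝ (Fin n)} (hx : x ∈ s)
    (hy : y ∈ s) (h : ∀ z ∈ s, fderiv ℝ f z (y - x) = 0) : f y = f x := by
  have hmem : ∀ t ∈ Set.Icc (0:ℝ) 1, x + t • (y - x) ∈ s := fun t ht =>
    hs.add_smul_sub_mem hx hy ht
  have hd : ∀ t ∈ Set.Icc (0:ℝ) 1, HasDerivAt (fun t : ℝ => f (x + t • (y - x))) 0 t := by
    intro t ht
    have h1 : HasDerivAt (fun t : ℝ => x + t • (y - x)) (y - x) t := by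
      simpa using ((hasDerivAt_id t).smul_const (y - x)).const_add x
    have := (hf _ (hmem t ht)).hasFDerivAt.comp_hasDerivAt t h1
    rwa [h _ (hmem t ht)] at this
  have := constant_of_has_deriv_right_zero
    (fun t ht => (hd t ht).continuousAt.continuousWithinAt)
    (fun t ht => (hd t ⟨ht.1, ht.2.le⟩).hasDerivWithinAt) 1 (by simp)
  simpa using this

end PartialDerivatives

section AxisFunctions

variable {r : ℝ} {f : EuclideanSpace ℝ (Fin 3) → ℝ}

/-- The point with coordinates `(0, v, 0)`. -/
def axisPt (v : ℝ) : EuclideanSpace ℝ (Fin 3) := !₂[0, v, 0]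

theorem norm_axisPt (v : ℝ) : ‖axisPt v‖ = |v| := by
  rw [EuclideanSpace.norm_eq, Fin.sum_univ_three]
  simp [axisPt, Real.sqrt_sq_eq_abs]

theorem axisPt_mem_ball {v : ℝ} : axisPt v ∈ Metric.ball (0 : EuclideanSpace ℝ (Fin 3)) r ↔
    v ∈ Set.Ioo (-r) r := by
  rw [mem_ball_zero_iff, norm_axisPt, abs_lt, Set.mem_Ioo]

theorem coord_mem_Ioo {y : EuclideanSpace ℝ (Fin 3)} (hy : y ∈ Metric.ball 0 r) (i : Fin 3) :
    y i ∈ Set.Ioo (-r) r := by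
  rw [mem_ball_zero_iff] at hy
  have := (PiLp.norm_apply_le y i).trans_lt hy
  rwa [Real.norm_eq_abs, abs_lt] at this

theorem axisPt_coord_mem {y : EuclideanSpace ℝ (Fin 3)} (hy : y ∈ Metric.ball 0 r) :
    axisPt (y 1) ∈ Metric.ball (0 : EuclideanSpace ℝ (Fin 3)) r :=
  axisPt_mem_ball.2 (coord_mem_Ioo hy 1)

theorem contDiff_axisPt : ContDiff ℝ ∞ axisPt := by
  refine contDiff_euclidean.2 fun i => ?_
  fin_cases i <;> simp [axisPt] <;> first | exact contDiff_const | exact contDiff_id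

theorem hasDerivAt_axisPt (v : ℝ) : HasDerivAt axisPt (EuclideanSpace.single 1 1) v := by
  have h : axisPt = fun v : ℝ => v • EuclideanSpace.single (1 : Fin 3) (1:ℝ) := by
    ext v i
    fin_cases i <;> simp [axisPt]
  rw [h]
  simpa using (hasDerivAt_id v).smul_const (EuclideanSpace.single (1 : Fin 3) (1:ℝ))

theorem contDiffOn_comp_axisPt (hf : ∀ y ∈ Metric.ball 0 r, ContDiffAt ℝ ∞ f y) :
    ContDiffOn ℝ ∞ (fun v => f (axisPt v)) (Set.Ioo (-r) r) := fun v hv =>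
  ((hf _ (axisPt_mem_ball.2 hv)).comp v contDiff_axisPt.contDiffAt).contDiffWithinAt

theorem hasDerivAt_comp_axisPt {v : ℝ} (hf : DifferentiableAt ℝ f (axisPt v)) :
    HasDerivAt (fun v => f (axisPt v)) (pd 1 f (axisPt v)) v :=
  hf.hasFDerivAt.comp_hasDerivAt v (hasDerivAt_axisPt v)

theorem deriv_comp_axisPt {v : ℝ} (hf : DifferentiableAt ℝ f (axisPt v)) :
    deriv (fun v => f (axisPt v)) v = pd 1 f (axisPt v) :=
  (hasDerivAt_comp_axisPt hf).deriv

/-- A function on a ball with `∂₀ f = ∂₂ f = 0` depends on the middle coordinate only. -/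
theorem eq_comp_axisPt (hf : ∀ y ∈ Metric.ball 0 r, DifferentiableAt ℝ f y)
    (h0 : ∀ y ∈ Metric.ball 0 r, pd 0 f y = 0) (h2 : ∀ y ∈ Metric.ball 0 r, pd 2 f y = 0)
    {y : EuclideanSpace ℝ (Fin 3)} (hy : y ∈ Metric.ball 0 r) : f y = f (axisPt (y 1)) := by
  refine eq_of_fderiv_segment_eq_zero (convex_ball 0 r) hf (axisPt_coord_mem hy) hy fun z hz => ?_
  rw [fderiv_eq_sum_pd, Fin.sum_univ_three, h0 z hz, h2 z hz]
  simp [axisPt]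

theorem eq_const_of_pd_eq_zero (hf : ∀ y ∈ Metric.ball 0 r, DifferentiableAt ℝ f y)
    (h : ∀ i, ∀ y ∈ Metric.ball 0 r, pd i f y = 0)
    {y y' : EuclideanSpace ℝ (Fin 3)} (hy : y ∈ Metric.ball 0 r) (hy' : y' ∈ Metric.ball 0 r) :
    f y = f y' := by
  refine eq_of_fderiv_segment_eq_zero (convex_ball 0 r) hf hy' hy fun z hz => ?_
  simp [fderiv_eq_sum_pd, h _ z hz]

end AxisFunctions

/-! ### Smooth parametric integrals and the leafwise Poincaré lemma -/

section ParametricIntegral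

open MeasureTheory intervalIntegral

universe u

variable {E F : Type u} [NormedAddCommGroup E] [NormedSpace ℝ E] [FiniteDimensional ℝ E]
  [NormedAddCommGroup F] [NormedSpace ℝ F] [CompleteSpace F]

/-- Differentiation under the integral sign. A closed ball times `[0,1]` is compact, so the
derivative of the integrand is bounded there by a constant, which is the dominating function. -/
theorem hasFDerivAt_intervalIntegral_param {k : E × ℝ → F} {O : Set (E × ℝ)} (hO : IsOpen O)
    (hk : ContDiffOn ℝ ∞ k O) {s : Set E} (hs : IsOpen s)
    (hsO : s ×ˢ Set.Icc (0:ℝ) 1 ⊆ O) {y : E} (hy : y ∈ s) :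
    HasFDerivAt (fun z => ∫ t in (0:ℝ)..1, k (z, t))
      (∫ t in (0:ℝ)..1, (fderiv ℝ k (y, t)).comp (ContinuousLinearMap.inl ℝ E ℝ)) y := by
  have hk' : ContDiffOn ℝ ∞ (fun x => (fderiv ℝ k x).comp (ContinuousLinearMap.inl ℝ E ℝ)) O :=
    (hk.fderiv_of_isOpen hO (by simp)).clm_comp contDiffOn_const
  have : ProperSpace E := FiniteDimensional.proper ℝ E
  obtain ⟨ε, hε, hball⟩ := Metric.nhds_basis_closedBall.mem_iff.1 (hs.mem_nhds hy)
  have hsub : Metric.closedBall y ε ×ˢ Set.Icc (0:ℝ) 1 ⊆ O :=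
    (Set.prod_mono hball subset_rfl).trans hsO
  obtain ⟨C, hC⟩ := ((isCompact_closedBall y ε).prod isCompact_Icc).exists_bound_of_continuousOn
    (hk'.continuousOn.mono hsub)
  have hsec : ∀ z ∈ s, ∀ (G : Type u) [NormedAddCommGroup G], ∀ q : E × ℝ → G,
      ContinuousOn q O → ContinuousOn (fun t => q (z, t)) (Set.uIcc (0:ℝ) 1) := by
    intro z hz G _ q hq
    refine hq.comp (by fun_prop) fun t ht => hsO ⟨hz, ?_⟩
    rwa [Set.uIcc_of_le zero_le_one] at ht
  refine (hasFDerivAt_integral_of_dominated_of_fderiv_le (𝕜 := ℝ) (bound := fun _ => C)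
    (F' := fun z t => (fderiv ℝ k (z, t)).comp (ContinuousLinearMap.inl ℝ E ℝ))
    (Metric.closedBall_mem_nhds y hε) ?_ ?_ ?_ ?_ ?_ ?_)
  · filter_upwards [hs.mem_nhds hy] with z hz
    exact (intervalIntegrable_iff.1
      (hsec z hz F k hk.continuousOn).intervalIntegrable).aestronglyMeasurable
  · exact (hsec y hy F k hk.continuousOn).intervalIntegrable
  · exact (intervalIntegrable_iff.1
      (hsec y hy _ _ hk'.continuousOn).intervalIntegrable).aestronglyMeasurable
  · refine Filter.Eventually.of_forall fun t ht z hz => hC (z, t) ⟨hz, ?_⟩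
    rw [Set.uIoc_of_le zero_le_one] at ht
    exact ⟨ht.1.le, ht.2⟩
  · exact intervalIntegrable_const
  · refine Filter.Eventually.of_forall fun t ht z hz => ?_
    rw [Set.uIoc_of_le zero_le_one] at ht
    have hm : (z, t) ∈ O := hsub ⟨hz, ht.1.le, ht.2⟩
    have h1 := ((hk.contDiffAt (hO.mem_nhds hm)).diff).hasFDerivAt
    exact h1.comp z ((hasFDerivAt_id z).prodMk (hasFDerivAt_const t z))

/-- The derivative is again a parametric integral, now with values in a space of linear maps. The
induction therefore quantifies over the codomain, and a common universe keeps it closed under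
passing to that space. -/
theorem contDiffOn_intervalIntegral_param_nat (m : ℕ) :
    ∀ {F : Type u} [NormedAddCommGroup F] [NormedSpace ℝ F] [CompleteSpace F]
    {k : E × ℝ → F} {O : Set (E × ℝ)} (_ : IsOpen O)
    (_ : ContDiffOn ℝ ∞ k O) {s : Set E} (_ : IsOpen s)
    (_ : s ×ˢ Set.Icc (0:ℝ) 1 ⊆ O),
    ContDiffOn ℝ m (fun z => ∫ t in (0:ℝ)..1, k (z, t)) s := by
  induction m with
  | zero =>
    intro F _ _ _ k O hO hk s hs hsO
    exact contDiffOn_zero.2 fun y hy =>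
      (hasFDerivAt_intervalIntegral_param hO hk hs hsO hy).continuousAt.continuousWithinAt
  | succ m ih =>
    intro F _ _ _ k O hO hk s hs hsO
    have hd := fun y hy => hasFDerivAt_intervalIntegral_param hO hk hs hsO (y := y) hy
    have hk' : ContDiffOn ℝ ∞ (fun x => (fderiv ℝ k x).comp (ContinuousLinearMap.inl ℝ E ℝ)) O :=
      (hk.fderiv_of_isOpen hO (by simp)).clm_comp contDiffOn_const
    push_cast
    rw [contDiffOn_succ_iff_fderiv_of_isOpen hs]
    refine ⟨fun y hy => (hd y hy).differentiableAt.differentiableWithinAt, by simp, ?_⟩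
    exact (ih hO hk' hs hsO).congr fun y hy => (hd y hy).fderiv

theorem contDiffOn_intervalIntegral_param {k : E × ℝ → F} {O : Set (E × ℝ)} (hO : IsOpen O)
    (hk : ContDiffOn ℝ ∞ k O) {s : Set E} (hs : IsOpen s)
    (hsO : s ×ˢ Set.Icc (0:ℝ) 1 ⊆ O) :
    ContDiffOn ℝ ∞ (fun z => ∫ t in (0:ℝ)..1, k (z, t)) s :=
  contDiffOn_infty.2 fun m => contDiffOn_intervalIntegral_param_nat m hO hk hs hsO

end ParametricIntegral

section LeafwisePrimitive

open MeasureTheory intervalIntegral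

variable {r : ℝ}

/-- The linear map `(y₀, y₁, y₂) ↦ (0, y₁, 0)`. -/
def axisProj : EuclideanSpace ℝ (Fin 3) →L[ℝ] EuclideanSpace ℝ (Fin 3) :=
  (EuclideanSpace.proj 1 : EuclideanSpace ℝ (Fin 3) →L[ℝ] ℝ).smulRight
    (EuclideanSpace.single (1 : Fin 3) (1:ℝ))

/-- The linear map `(y₀, y₁, y₂) ↦ (t y₀, y₁, t y₂)`. -/
def leafScale (t : ℝ) : EuclideanSpace ℝ (Fin 3) →L[ℝ] EuclideanSpace ℝ (Fin 3) :=
  axisProj + t • (ContinuousLinearMap.id ℝ _ - axisProj)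

theorem leafScale_apply (t : ℝ) (y : EuclideanSpace ℝ (Fin 3)) :
    leafScale t y = axisProj y + t • (y - axisProj y) := rfl

theorem axisProj_apply (y : EuclideanSpace ℝ (Fin 3)) : axisProj y = axisPt (y 1) := by
  ext i
  fin_cases i <;> simp [axisProj, axisPt]

theorem leafScale_mem_ball {t : ℝ} (ht : t ∈ Set.Icc (0:ℝ) 1) {y : EuclideanSpace ℝ (Fin 3)}
    (hy : y ∈ Metric.ball 0 r) : leafScale t y ∈ Metric.ball (0 : EuclideanSpace ℝ (Fin 3)) r := by
  rw [leafScale_apply, axisProj_apply]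
  exact (convex_ball 0 r).add_smul_sub_mem (axisPt_coord_mem hy) hy ht

theorem pd_comp_leafScale {P : EuclideanSpace ℝ (Fin 3) → ℝ} {t : ℝ}
    {y : EuclideanSpace ℝ (Fin 3)} (hP : DifferentiableAt ℝ P (leafScale t y)) {i : Fin 3}
    (hi : i ≠ 1) : pd i (fun z => P (leafScale t z)) y = t * pd i P (leafScale t y) := by
  have h := (hP.hasFDerivAt.comp y (leafScale t).hasFDerivAt).fderiv
  have e : leafScale t (EuclideanSpace.single i (1:ℝ)) = t • EuclideanSpace.single i (1:ℝ) := by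
    rw [leafScale_apply, axisProj_apply]
    have : axisPt ((EuclideanSpace.single i (1:ℝ) : EuclideanSpace ℝ (Fin 3)) 1) = 0 := by
      ext j
      fin_cases j <;> simp [axisPt, hi.symm]
    rw [this]
    simp
  rw [pd, show (fun z => P (leafScale t z)) = P ∘ leafScale t from rfl, h,
    ContinuousLinearMap.comp_apply, e, map_smul]
  rfl

theorem hasDerivAt_comp_leafScale {P : EuclideanSpace ℝ (Fin 3) → ℝ} {t : ℝ}
    {y : EuclideanSpace ℝ (Fin 3)} (hP : DifferentiableAt ℝ P (leafScale t y)) :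
    HasDerivAt (fun s => P (leafScale s y))
      (y 0 * pd 0 P (leafScale t y) + y 2 * pd 2 P (leafScale t y)) t := by
  have h1 : HasDerivAt (fun s => leafScale s y) (y - axisProj y) t := by
    simpa [leafScale_apply] using
      ((hasDerivAt_id t).smul_const (y - axisProj y)).const_add (axisProj y)
  have h2 := hP.hasFDerivAt.comp_hasDerivAt t h1
  have e : fderiv ℝ P (leafScale t y) (y - axisProj y) =
      y 0 * pd 0 P (leafScale t y) + y 2 * pd 2 P (leafScale t y) := by
    rw [fderiv_eq_sum_pd, Fin.sum_univ_three, axisProj_apply]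
    simp [axisPt]
  rw [e] at h2
  exact h2

/-- The Poincaré lemma on the leaves `y₁ = const`, with smooth dependence on the leaf. -/
theorem exists_leafwise_primitive (hr : 0 < r) {P Q : EuclideanSpace ℝ (Fin 3) → ℝ}
    (hP : ∀ y ∈ Metric.ball 0 r, ContDiffAt ℝ ∞ P y)
    (hQ : ∀ y ∈ Metric.ball 0 r, ContDiffAt ℝ ∞ Q y)
    (hPQ : ∀ y ∈ Metric.ball 0 r, pd 2 P y = pd 0 Q y) :
    ∃ f : EuclideanSpace ℝ (Fin 3) → ℝ, (∀ y ∈ Metric.ball 0 r, ContDiffAt ℝ ∞ f y) ∧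
      (∀ y ∈ Metric.ball 0 r, pd 0 f y = P y) ∧ (∀ y ∈ Metric.ball 0 r, pd 2 f y = Q y) ∧
      f 0 = 0 ∧ pd 1 f 0 = 0 := by
  -- The integrand of the Poincaré homotopy formula, with the contraction to the point `(0, y₁, 0)`
  -- performed inside each leaf.
  let k : EuclideanSpace ℝ (Fin 3) × ℝ → ℝ := fun x =>
    x.1 0 * P (leafScale x.2 x.1) + x.1 2 * Q (leafScale x.2 x.1)
  have hσ : ContDiff ℝ ∞ fun x : EuclideanSpace ℝ (Fin 3) × ℝ => leafScale x.2 x.1 := by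
    simp only [leafScale_apply]
    have h1 : ContDiff ℝ ∞ fun x : EuclideanSpace ℝ (Fin 3) × ℝ => axisProj x.1 :=
      axisProj.contDiff.comp contDiff_fst
    exact h1.add (contDiff_snd.smul (contDiff_fst.sub h1))
  let O : Set (EuclideanSpace ℝ (Fin 3) × ℝ) :=
    (fun x => leafScale x.2 x.1) ⁻¹' Metric.ball 0 r
  have hO : IsOpen O := Metric.isOpen_ball.preimage hσ.continuous
  have hk : ContDiffOn ℝ ∞ k O := by
    intro x hx
    have c : ∀ i, ContDiffAt ℝ ∞ (fun x : EuclideanSpace ℝ (Fin 3) × ℝ => x.1 i) x := fun i =>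
      ((contDiff_coord i).comp contDiff_fst).contDiffAt
    exact (((c 0).mul ((hP _ hx).comp x hσ.contDiffAt)).add
      ((c 2).mul ((hQ _ hx).comp x hσ.contDiffAt))).contDiffWithinAt
  have hs : IsOpen (Metric.ball (0 : EuclideanSpace ℝ (Fin 3)) r) := Metric.isOpen_ball
  have hsO : Metric.ball (0 : EuclideanSpace ℝ (Fin 3)) r ×ˢ Set.Icc (0:ℝ) 1 ⊆ O :=
    fun x hx => leafScale_mem_ball hx.2 hx.1
  have hk' : ContDiffOn ℝ ∞ (fun x => (fderiv ℝ k x).comp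
      (ContinuousLinearMap.inl ℝ (EuclideanSpace ℝ (Fin 3)) ℝ)) O :=
    (hk.fderiv_of_isOpen hO (by simp)).clm_comp contDiffOn_const
  -- The assumed expression is the derivative of `t * R (leafScale t y)`, so its integral over
  -- `[0,1]` is `R y`. Closedness brings the derivative of `k` to this form, with `R = P` for `i =
  -- 0` and `R = Q` for `i = 2`.
  have main : ∀ i : Fin 3, ∀ R : EuclideanSpace ℝ (Fin 3) → ℝ, i ≠ 1 →
      (∀ y ∈ Metric.ball 0 r, ContDiffAt ℝ ∞ R y) → ∀ y ∈ Metric.ball 0 r,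
      (∀ t ∈ Set.Icc (0:ℝ) 1, pd i (fun z => k (z, t)) y =
        1 * R (leafScale t y) + t * (y 0 * pd 0 R (leafScale t y) + y 2 * pd 2 R (leafScale t y))) →
      pd i (fun z => ∫ t in (0:ℝ)..1, k (z, t)) y = R y := by
    intro i R hi hR y hy h
    have hcont : ContinuousOn (fun t => (fderiv ℝ k (y, t)).comp
        (ContinuousLinearMap.inl ℝ (EuclideanSpace ℝ (Fin 3)) ℝ)) (Set.uIcc (0:ℝ) 1) := by
      refine hk'.continuousOn.comp (f := fun t : ℝ => (y, t)) (by fun_prop) fun t ht => hsO ⟨hy, ?_⟩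
      rwa [Set.uIcc_of_le zero_le_one] at ht
    have e : ∀ t ∈ Set.uIcc (0:ℝ) 1, ((fderiv ℝ k (y, t)).comp
        (ContinuousLinearMap.inl ℝ (EuclideanSpace ℝ (Fin 3)) ℝ)) (EuclideanSpace.single i 1) =
        1 * R (leafScale t y) +
          t * (y 0 * pd 0 R (leafScale t y) + y 2 * pd 2 R (leafScale t y)) := by
      intro t ht
      rw [Set.uIcc_of_le zero_le_one] at ht
      rw [← h t ht, pd]
      have hm : (y, t) ∈ O := hsO ⟨hy, ht⟩
      have h1 := ((hk.contDiffAt (hO.mem_nhds hm)).diff).hasFDerivAt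
      have h2 : HasFDerivAt (fun z : EuclideanSpace ℝ (Fin 3) => (z, t))
        (ContinuousLinearMap.inl ℝ (EuclideanSpace ℝ (Fin 3)) ℝ) y :=
        (hasFDerivAt_id y).prodMk (hasFDerivAt_const t y)
      rw [show (fun z => k (z, t)) = k ∘ fun z => (z, t) from rfl, (h1.comp y h2).fderiv]
    rw [pd, (hasFDerivAt_intervalIntegral_param hO hk hs hsO hy).fderiv,
      ContinuousLinearMap.intervalIntegral_apply hcont.intervalIntegrable, integral_congr e,
      integral_eq_sub_of_hasDerivAt (f := fun t => t * R (leafScale t y))]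
    · have : leafScale 1 y = y := by simp [leafScale_apply]
      rw [this]; ring
    · intro t ht
      rw [Set.uIcc_of_le zero_le_one] at ht
      exact (hasDerivAt_id t).mul
        (hasDerivAt_comp_leafScale ((hR _ (leafScale_mem_ball ht hy)).diff))
    · refine (ContinuousOn.congr ?_ fun t ht => (e t ht).symm).intervalIntegrable
      exact hcont.clm_apply continuousOn_const
  have hkpd : ∀ i : Fin 3, i ≠ 1 → ∀ y ∈ Metric.ball 0 r, ∀ t ∈ Set.Icc (0:ℝ) 1,
      pd i (fun z => k (z, t)) y =
        (if (0:Fin 3) = i then 1 else 0) * P (leafScale t y)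
          + (if (2:Fin 3) = i then 1 else 0) * Q (leafScale t y)
          + t * (y 0 * pd i P (leafScale t y) + y 2 * pd i Q (leafScale t y)) := by
    intro i hi y hy t ht
    have hm := leafScale_mem_ball ht hy
    have c : ∀ i, DifferentiableAt ℝ (fun z : EuclideanSpace ℝ (Fin 3) => z i) y := fun i =>
      (contDiff_coord i).contDiffAt.diff
    have dP : DifferentiableAt ℝ (fun z => P (leafScale t z)) y :=
      (hP _ hm).diff.comp y (leafScale t).differentiableAt
    have dQ : DifferentiableAt ℝ (fun z => Q (leafScale t z)) y :=
      (hQ _ hm).diff.comp y (leafScale t).differentiableAt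
    simp only [k]
    rw [pd_add ((c 0).fun_mul dP) ((c 2).fun_mul dQ), pd_mul (c 0) dP, pd_mul (c 2) dQ, pd_coord, pd_coord,
      pd_comp_leafScale (hP _ hm).diff hi, pd_comp_leafScale (hQ _ hm).diff hi]
    ring
  have hzero : ∀ v : ℝ, ∫ t in (0:ℝ)..1, k (axisPt v, t) = 0 := by
    intro v
    simp [k, axisPt]
  have hsm : ∀ y ∈ Metric.ball (0 : EuclideanSpace ℝ (Fin 3)) r,
      ContDiffAt ℝ ∞ (fun z => ∫ t in (0:ℝ)..1, k (z, t)) y := fun y hy =>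
    (contDiffOn_intervalIntegral_param hO hk hs hsO).contDiffAt (hs.mem_nhds hy)
  have h00 : axisPt 0 = 0 := by
    rw [← norm_eq_zero, norm_axisPt, abs_zero]
  refine ⟨fun z => ∫ t in (0:ℝ)..1, k (z, t), hsm, fun y hy => ?_, fun y hy => ?_, ?_, ?_⟩
  · refine main 0 P (by decide) hP y hy fun t ht => ?_
    rw [hkpd 0 (by decide) y hy t ht, ← hPQ _ (leafScale_mem_ball ht hy)]
    simp
  · refine main 2 Q (by decide) hQ y hy fun t ht => ?_
    rw [hkpd 2 (by decide) y hy t ht, hPQ _ (leafScale_mem_ball ht hy)]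
    simp
  · have := hzero 0
    rwa [h00] at this
  · have h := deriv_comp_axisPt (v := 0) (f := fun z => ∫ t in (0:ℝ)..1, k (z, t))
      (by rw [h00]; exact (hsm 0 (Metric.mem_ball_self hr)).diff)
    rw [h00] at h
    rw [← h]
    simp only [hzero, deriv_const]

end LeafwisePrimitive

namespace LorentzMetric

/-! ### New coordinates from the inverse function theorem -/

section ChangeOfChart

variable {n : ℕ} {M : Type*} [TopologicalSpace M]
  [ChartedSpace (EuclideanSpace ℝ (Fin n)) M] [IsManifold (𝓡 n) ∞ M]
  (g : LorentzMetric n M) {φ ψ : OpenPartialHomeomorph M (EuclideanSpace ℝ (Fin n))}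
  {f : EuclideanSpace ℝ (Fin n) → EuclideanSpace ℝ (Fin n)} {U : Set (EuclideanSpace ℝ (Fin n))}

/-- New coordinates from the inverse function theorem. -/
theorem exists_chart_of_fderiv_bijective (hφ : IsChart φ) {p : M} (hp : p ∈ φ.source)
    (hU : IsOpen U) (hpU : φ p ∈ U) (hf : ∀ y ∈ U, ContDiffAt ℝ ∞ f y)
    (hb : Function.Bijective (fderiv ℝ f (φ p))) (h0 : f (φ p) = 0) :
    ∃ (ψ : OpenPartialHomeomorph M (EuclideanSpace ℝ (Fin n))) (r : ℝ), IsChart ψ ∧ 0 < r ∧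
      p ∈ ψ.source ∧ ψ.target = Metric.ball 0 r ∧
      ∀ q ∈ ψ.source, q ∈ φ.source ∧ φ q ∈ U ∧ ψ q = f (φ q) := by
  let A := ContinuousLinearEquiv.ofBijective (fderiv ℝ f (φ p))
    (LinearMap.ker_eq_bot.2 hb.1) (LinearMap.range_eq_top.2 hb.2)
  have hA : (A : EuclideanSpace ℝ (Fin n) →L[ℝ] EuclideanSpace ℝ (Fin n)) = fderiv ℝ f (φ p) :=
    ContinuousLinearEquiv.coe_ofBijective _ _ _
  have hfp := hf _ hpU
  have hd : HasFDerivAt f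
      (A : EuclideanSpace ℝ (Fin n) →L[ℝ] EuclideanSpace ℝ (Fin n)) (φ p) := by
    rw [hA]; exact hfp.diff.hasFDerivAt
  let e := hfp.toOpenPartialHomeomorph f hd (by simp)
  have he : ∀ y, e y = f y := fun y => rfl
  have hpe : φ p ∈ e.source := hfp.mem_toOpenPartialHomeomorph_source hd (by simp)
  -- the open set on which everything is as it should be
  let N : Set (EuclideanSpace ℝ (Fin n)) := U ∩ φ.target ∩
    {y | fderiv ℝ f y ∈ Set.range ((↑) : (EuclideanSpace ℝ (Fin n) ≃L[ℝ] EuclideanSpace ℝ (Fin n)) →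
      EuclideanSpace ℝ (Fin n) →L[ℝ] EuclideanSpace ℝ (Fin n))}
  have hN : N ∈ 𝓝 (φ p) := by
    refine Filter.inter_mem (Filter.inter_mem (hU.mem_nhds hpU)
      (φ.open_target.mem_nhds (φ.map_source hp))) ?_
    have hc : ContinuousAt (fderiv ℝ f) (φ p) :=
      (hfp.fderiv_right (m := ∞) (by simp)).continuousAt
    exact hc (ContinuousLinearEquiv.isOpen.mem_nhds ⟨A, hA⟩)
  have hN' : e.symm ⁻¹' N ∩ e.target ∈ 𝓝 (0 : EuclideanSpace ℝ (Fin n)) := by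
    have e0 : e (φ p) = 0 := h0
    have ht : (0 : EuclideanSpace ℝ (Fin n)) ∈ e.target := e0 ▸ e.map_source hpe
    have es : e.symm 0 = φ p := by rw [← e0, e.left_inv hpe]
    refine Filter.inter_mem ((e.continuousAt_symm ht).preimage_mem_nhds ?_) (e.open_target.mem_nhds ht)
    rwa [es]
  obtain ⟨r, hr, hball⟩ := Metric.mem_nhds_iff.1 hN'
  let χ := φ.trans e
  have hχt : Metric.ball 0 r ⊆ χ.target := by
    intro z hz
    have := hball hz
    rw [OpenPartialHomeomorph.trans_target]
    exact ⟨this.2, this.1.1.2⟩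
  -- The restriction is made on the coordinate side, so that the target is exactly a ball. Its
  -- convexity is what the integrations in coordinates rely on.
  let ψ := (χ.symm.restrOpen (Metric.ball 0 r) Metric.isOpen_ball).symm
  have hψt : ψ.target = Metric.ball 0 r := by
    change χ.target ∩ Metric.ball 0 r = _
    exact Set.inter_eq_right.2 hχt
  have hψsymm : ∀ z, ψ.symm z = φ.symm (e.symm z) := fun z => rfl
  have hψ : ∀ q, ψ q = f (φ q) := fun q => rfl
  have hsrc : ∀ q ∈ ψ.source, q ∈ φ.source ∧ φ q ∈ N := by
    intro q hq
    have h1 : ψ q ∈ Metric.ball 0 r := hψt ▸ ψ.map_source hq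
    have h2 : q = φ.symm (e.symm (ψ q)) := by rw [← hψsymm, ψ.left_inv hq]
    have h3 := (hball h1).1
    rw [h2]
    refine ⟨φ.map_target h3.1.2, ?_⟩
    rw [φ.right_inv h3.1.2]
    exact h3
  refine ⟨ψ, r, ?_, hr, ?_, hψt, fun q hq => ⟨(hsrc q hq).1, (hsrc q hq).2.1.1, hψ q⟩⟩
  · refine OpenPartialHomeomorph.mem_maximalAtlas_of_contMDiffOn _ ?_ ?_
    · intro q hq
      exact ((hf _ (hsrc q hq).2.1.1).contMDiffAt.comp q
        (hφ.contMDiffAt (hsrc q hq).1)).contMDiffWithinAt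
    · intro z hz
      rw [hψt] at hz
      have h3 := hball hz
      obtain ⟨B, hB⟩ := h3.1.2
      -- Smoothness of the inverse is needed on the whole ball and not only at `0`; this is why
      -- invertibility of the differential was built into `N`.
      have h4 : ContDiffAt ℝ ∞ e.symm z := by
        refine e.contDiffAt_symm (f₀' := B) h3.2 ?_ (hf _ h3.1.1.1)
        rw [hB]
        exact (hf _ h3.1.1.1).diff.hasFDerivAt
      exact ((hφ.contMDiffAt_symm h3.1.1.2).comp z h4.contMDiffAt).contMDiffWithinAt
  · have h1 : p = ψ.symm 0 := by
      rw [hψsymm, ← h0, ← he, e.left_inv hpe, φ.left_inv hp]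
    rw [h1]
    exact ψ.map_target (by rw [hψt]; exact Metric.mem_ball_self hr)

/-- How the metric and vector fields change when `ψ = f ∘ φ`. -/
theorem change_of_chart (hφ : IsChart φ) (hψ : IsChart ψ)
    (h : ∀ q ∈ ψ.source, q ∈ φ.source ∧ φ q ∈ U ∧ ψ q = f (φ q))
    {z : EuclideanSpace ℝ (Fin n)} (hz : z ∈ ψ.target) :
    ∃ y ∈ φ.target, y ∈ U ∧ f y = z ∧ φ.symm y = ψ.symm z ∧ Function.Bijective (fderiv ℝ f y) ∧
      (∀ X Y, g.chartForm φ y X Y = g.chartForm ψ z (fderiv ℝ f y X) (fderiv ℝ f y Y)) ∧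
      ∀ V : ∀ p : M, TangentSpace (𝓡 n) p, vecCoord ψ V z = fderiv ℝ f y (vecCoord φ V y) := by
  have hq := ψ.map_target hz
  obtain ⟨h1, h2, h3⟩ := h _ hq
  have e : φ.symm (φ (ψ.symm z)) = ψ.symm z := φ.left_inv h1
  have hy' : φ.symm (φ (ψ.symm z)) ∈ ψ.source := by rwa [e]
  have hy := φ.map_source h1
  have hev : (ψ ∘ φ.symm) =ᶠ[𝓝 (φ (ψ.symm z))] f := by
    filter_upwards [eventually_overlap hy hy'] with w hw
    rw [Function.comp_apply, (h _ hw.2).2.2, φ.right_inv hw.1]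
  have ez : (ψ ∘ φ.symm) (φ (ψ.symm z)) = z := by
    rw [Function.comp_apply, e, ψ.right_inv hz]
  refine ⟨φ (ψ.symm z), hy, h2, ?_, e, ?_, fun X Y => ?_, fun V => ?_⟩
  · rw [← h3, ψ.right_inv hz]
  · rw [← hev.fderiv_eq]
    exact fderiv_transition_bijective hφ hψ hy hy'
  · rw [g.chartForm_transition hφ hψ hy hy', ez, hev.fderiv_eq]
  · have := vecCoord_transition V hφ hψ hy hy'
    rwa [ez, hev.fderiv_eq] at this

end ChangeOfChart

end LorentzMetric

section VectorValued

variable {f₀ f₁ f₂ : EuclideanSpace ℝ (Fin 3) → ℝ} {y : EuclideanSpace ℝ (Fin 3)}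

theorem contDiffAt_vec3 (h₀ : ContDiffAt ℝ ∞ f₀ y) (h₁ : ContDiffAt ℝ ∞ f₁ y)
    (h₂ : ContDiffAt ℝ ∞ f₂ y) :
    ContDiffAt ℝ ∞ (fun z => (!₂[f₀ z, f₁ z, f₂ z] : EuclideanSpace ℝ (Fin 3))) y := by
  refine contDiffAt_euclidean.2 fun i => ?_
  fin_cases i
  · exact h₀
  · exact h₁
  · exact h₂

theorem fderiv_vec3 (h₀ : DifferentiableAt ℝ f₀ y) (h₁ : DifferentiableAt ℝ f₁ y)
    (h₂ : DifferentiableAt ℝ f₂ y) (X : EuclideanSpace ℝ (Fin 3)) :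
    fderiv ℝ (fun z => (!₂[f₀ z, f₁ z, f₂ z] : EuclideanSpace ℝ (Fin 3))) y X =
      !₂[fderiv ℝ f₀ y X, fderiv ℝ f₁ y X, fderiv ℝ f₂ y X] := by
  have hd : HasFDerivAt (fun z => (!₂[f₀ z, f₁ z, f₂ z] : EuclideanSpace ℝ (Fin 3)))
      ((PiLp.continuousLinearEquiv 2 ℝ fun _ : Fin 3 => ℝ).symm.toContinuousLinearMap.comp
        (ContinuousLinearMap.pi ![fderiv ℝ f₀ y, fderiv ℝ f₁ y, fderiv ℝ f₂ y])) y := by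
    rw [← hasFDerivWithinAt_univ, hasFDerivWithinAt_euclidean]
    intro i
    rw [hasFDerivWithinAt_univ]
    fin_cases i
    · exact h₀.hasFDerivAt
    · exact h₁.hasFDerivAt
    · exact h₂.hasFDerivAt
  rw [hd.fderiv]
  ext i
  fin_cases i <;> rfl

theorem fderiv_coord (i : Fin 3) (X : EuclideanSpace ℝ (Fin 3)) :
    fderiv ℝ (fun z : EuclideanSpace ℝ (Fin 3) => z i) y X = X i := by
  have h : (fun z : EuclideanSpace ℝ (Fin 3) => z i) =
    (EuclideanSpace.proj i : EuclideanSpace ℝ (Fin 3) →L[ℝ] ℝ) := rfl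
  rw [h, ContinuousLinearMap.fderiv]
  rfl

theorem bijective_of_apply_eq_zero
    {L : EuclideanSpace ℝ (Fin 3) →L[ℝ] EuclideanSpace ℝ (Fin 3)}
    (h : ∀ X, L X = 0 → X = 0) : Function.Bijective L := by
  have hinj : Function.Injective L := (injective_iff_map_eq_zero _).2 h
  exact ⟨hinj, LinearMap.surjective_of_injective (f := L.toLinearMap) hinj⟩

theorem pd_sqrt {f : EuclideanSpace ℝ (Fin 3) → ℝ} (hf : DifferentiableAt ℝ f y) (h : f y ≠ 0)
    (i : Fin 3) : pd i (fun z => √(f z)) y = pd i f y / (2 * √(f y)) := by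
  rw [pd, (hf.hasFDerivAt.sqrt h).fderiv]
  simp [pd]
  ring

end VectorValued

namespace LorentzMetric

/-! ### Parallel fields: Killing equation and closed dual form -/

section ParallelFields

variable {M : Type*} [TopologicalSpace M]
  [ChartedSpace (EuclideanSpace ℝ (Fin 3)) M] [IsManifold (𝓡 3) ∞ M]
  {g : LorentzMetric 3 M} {φ : OpenPartialHomeomorph M (EuclideanSpace ℝ (Fin 3))}
  {y : EuclideanSpace ℝ (Fin 3)} {V : ∀ p : M, TangentSpace (𝓡 3) p}

theorem chartForm_eq_sum (X Y : EuclideanSpace ℝ (Fin 3)) :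
    g.chartForm φ y X Y = ∑ i, ∑ j, X i * Y j * g.mat φ y i j := by
  rw [expand_apply_left (g.chartForm φ y) X, sum_apply]
  refine Finset.sum_congr rfl fun i _ => ?_
  rw [smul_apply, expand_apply_left (g.chartForm φ y (EuclideanSpace.single i 1)) Y, smul_eq_mul,
    Finset.mul_sum]
  refine Finset.sum_congr rfl fun j _ => ?_
  rw [mat_eq_chartForm, smul_eq_mul]
  ring

theorem contDiffAt_vecCoord
    (hV : ContMDiff (𝓡 3) (𝓡 3).tangent ∞ (fun p ↦ (⟨p, V p⟩ : TangentBundle (𝓡 3) M)))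
    (hφ : IsChart φ) (hy : y ∈ φ.target) : ContDiffAt ℝ ∞ (vecCoord φ V) y :=
  contDiffAt_euclidean.2 fun i => contDiffAt_vecComp hV hφ hy i

/-- The covariant derivative of `V` with its upper index lowered. Its symmetric part in `i, l` is
the Killing equation, its antisymmetric part the closedness of the dual form. -/
theorem IsParallel.lower (hV : g.IsParallel V) (hφ : IsChart φ) (hy : y ∈ φ.target)
    (i l : Fin 3) : ∑ k, g.mat φ y l k * pd i (vecComp φ V k) y
      + (1 / 2) * ∑ j, vecComp φ V j y * (pd i (fun z => g.mat φ z j l) y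
        + pd j (fun z => g.mat φ z i l) y - pd l (fun z => g.mat φ z i j) y) = 0 := by
  have h : ∑ k, g.mat φ y l k * (pd i (vecComp φ V k) y
      + ∑ j, g.christoffel φ k i j y * vecComp φ V j y) = 0 :=
    Finset.sum_eq_zero fun k _ => by rw [hV φ hφ y hy i k, mul_zero]
  have e : ∀ j, vecComp φ V j y * ∑ k, g.mat φ y l k * g.christoffel φ k i j y =
      vecComp φ V j y * ((1 / 2) * (pd i (fun z => g.mat φ z j l) y
        + pd j (fun z => g.mat φ z i l) y - pd l (fun z => g.mat φ z i j) y)) := fun j => by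
    rw [g.sum_mat_christoffel hφ hy]
  have e0 := e 0
  have e1 := e 1
  have e2 := e 2
  simp only [Fin.sum_univ_three] at h e0 e1 e2 ⊢
  linear_combination h - e0 - e1 - e2

theorem pd_mat_symm (i j k : Fin 3) :
    pd k (fun z => g.mat φ z i j) y = pd k (fun z => g.mat φ z j i) y := by
  congr 1
  ext z
  exact g.mat_symm z i j

/-- A parallel field is a Killing field. -/
theorem IsParallel.killing (hV : g.IsParallel V) (hφ : IsChart φ) (hy : y ∈ φ.target)
    (i j : Fin 3) : ∑ k, (vecComp φ V k y * pd k (fun z => g.mat φ z i j) y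
      + g.mat φ y k j * pd i (vecComp φ V k) y + g.mat φ y i k * pd j (vecComp φ V k) y) = 0 := by
  have h1 := hV.lower hφ hy i j
  have h2 := hV.lower hφ hy j i
  simp only [Fin.sum_univ_three] at h1 h2 ⊢
  have e := fun k => congrArg (vecComp φ V k y * ·) (pd_mat_symm (g := g) (φ := φ) (y := y) k j i)
  have e' := fun k => congrArg (vecComp φ V k y * ·) (pd_mat_symm (g := g) (φ := φ) (y := y) i k j)
  have e'' := fun k => congrArg (vecComp φ V k y * ·) (pd_mat_symm (g := g) (φ := φ) (y := y) i j k)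
  have a0 := e 0
  have a1 := e 1
  have a2 := e 2
  have b0 := e' 0
  have b1 := e' 1
  have b2 := e' 2
  have c0 := e'' 0
  have c1 := e'' 1
  have c2 := e'' 2
  rw [g.mat_symm y 0 j, g.mat_symm y 1 j, g.mat_symm y 2 j]
  linear_combination h1 + h2 + (1 / 2) * (-a0 - a1 - a2 + b0 + b1 + b2 + c0 + c1 + c2)

/-- The one-form metrically dual to a vector field. -/
def flatForm (g : LorentzMetric 3 M) (φ : OpenPartialHomeomorph M (EuclideanSpace ℝ (Fin 3)))
    (V : ∀ p : M, TangentSpace (𝓡 3) p) (y : EuclideanSpace ℝ (Fin 3)) :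
    EuclideanSpace ℝ (Fin 3) →L[ℝ] ℝ :=
  g.chartForm φ y (vecCoord φ V y)

theorem contDiffAt_flatForm
    (hV : ContMDiff (𝓡 3) (𝓡 3).tangent ∞ (fun p ↦ (⟨p, V p⟩ : TangentBundle (𝓡 3) M)))
    (hφ : IsChart φ) (hy : y ∈ φ.target) : ContDiffAt ℝ ∞ (g.flatForm φ V) y :=
  (g.contDiffAt_chartForm hφ hy).clm_apply (contDiffAt_vecCoord hV hφ hy)

theorem flatForm_single (l : Fin 3) :
    g.flatForm φ V y (EuclideanSpace.single l 1) = ∑ k, g.mat φ y l k * vecComp φ V k y := by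
  rw [flatForm, chartForm_symm, expand_apply_left]
  exact Finset.sum_congr rfl fun k _ => by rw [mat_eq_chartForm, smul_eq_mul, mul_comm]; rfl

theorem fderiv_flatForm_single
    (hV : ContMDiff (𝓡 3) (𝓡 3).tangent ∞ (fun p ↦ (⟨p, V p⟩ : TangentBundle (𝓡 3) M)))
    (hφ : IsChart φ) (hy : y ∈ φ.target) (i l : Fin 3) :
    fderiv ℝ (g.flatForm φ V) y (EuclideanSpace.single i 1) (EuclideanSpace.single l 1) =
      ∑ k, (g.mat φ y l k * pd i (vecComp φ V k) y
        + vecComp φ V k y * pd i (fun z => g.mat φ z l k) y) := by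
  have hd := ((contDiffAt_flatForm (g := g) hV hφ hy).diff.hasFDerivAt).clm_apply
    (hasFDerivAt_const (EuclideanSpace.single l (1:ℝ)) y)
  have e : fderiv ℝ (g.flatForm φ V) y (EuclideanSpace.single i 1) (EuclideanSpace.single l 1) =
      pd i (fun z => g.flatForm φ V z (EuclideanSpace.single l 1)) y := by
    rw [pd, hd.fderiv]
    simp
  have dm := fun k => (g.contDiffAt_mat hφ hy l k).diff
  have dv := fun k => (contDiffAt_vecComp hV hφ hy k).diff
  rw [e]
  simp only [flatForm_single, Fin.sum_univ_three]
  rw [pd_add (((dm 0).fun_mul (dv 0)).fun_add ((dm 1).fun_mul (dv 1))) ((dm 2).fun_mul (dv 2)),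
    pd_add ((dm 0).fun_mul (dv 0)) ((dm 1).fun_mul (dv 1)),
    pd_mul (dm 0) (dv 0), pd_mul (dm 1) (dv 1), pd_mul (dm 2) (dv 2)]

/-- The dual form of a parallel field is closed. -/
theorem IsParallel.fderiv_flatForm_symm (hV : g.IsParallel V)
    (hVs : ContMDiff (𝓡 3) (𝓡 3).tangent ∞ (fun p ↦ (⟨p, V p⟩ : TangentBundle (𝓡 3) M)))
    (hφ : IsChart φ) (hy : y ∈ φ.target) (X Y : EuclideanSpace ℝ (Fin 3)) :
    fderiv ℝ (g.flatForm φ V) y X Y = fderiv ℝ (g.flatForm φ V) y Y X := by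
  revert X
  refine linear_ext_single ⟨by simp, by simp⟩ ⟨by simp, by simp⟩ fun i => ?_
  revert Y
  refine linear_ext_single ⟨by simp, by simp⟩ ⟨by simp, by simp⟩ fun l => ?_
  rw [fderiv_flatForm_single hVs hφ hy, fderiv_flatForm_single hVs hφ hy]
  have h1 := hV.lower hφ hy i l
  have h2 := hV.lower hφ hy l i
  simp only [Fin.sum_univ_three] at h1 h2 ⊢
  rw [pd_mat_symm 0 l i, pd_mat_symm 1 l i, pd_mat_symm 2 l i, pd_mat_symm l i 0, pd_mat_symm l i 1,
    pd_mat_symm l i 2] at *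
  rw [pd_mat_symm i l 0, pd_mat_symm i l 1, pd_mat_symm i l 2, pd_mat_symm 0 i l,
    pd_mat_symm 1 i l, pd_mat_symm 2 i l] at *
  linear_combination h1 - h2

theorem chartForm_vecCoord_self (hφ : IsChart φ) (hy : y ∈ φ.target) :
    g.chartForm φ y (vecCoord φ V y) (vecCoord φ V y) =
      g.val (φ.symm y) (V (φ.symm y)) (V (φ.symm y)) := by
  rw [chartForm, ContinuousLinearMap.bilinearComp_apply, dsymm_vecCoord V hφ hy]
  rfl

theorem vecCoord_ne_zero (hφ : IsChart φ) (hy : y ∈ φ.target) (h : V (φ.symm y) ≠ 0) :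
    vecCoord φ V y ≠ 0 := by
  intro h0
  apply h
  rw [← dsymm_vecCoord V hφ hy, h0, map_zero]
  rfl

/-- Vectors orthogonal, but not proportional, to a null vector are spacelike. -/
theorem chartForm_pos_of_perp_null (hφ : IsChart φ) (hy : y ∈ φ.target)
    {N W : EuclideanSpace ℝ (Fin 3)} (hN : N ≠ 0) (hNN : g.chartForm φ y N N = 0)
    (hNW : g.chartForm φ y N W = 0) (hW : ∀ c : ℝ, W ≠ c • N) : 0 < g.chartForm φ y W W := by
  obtain ⟨t, -, ht⟩ := g.signature (φ.symm y)
  have key : ∀ X : EuclideanSpace ℝ (Fin 3), g.chartForm φ y (dchart φ (φ.symm y) t) X = 0 →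
      X ≠ 0 → 0 < g.chartForm φ y X X := by
    intro X hX hX0
    have e : dsymm φ y (dchart φ (φ.symm y) t) = t := DFunLike.congr_fun (dsymm_comp_dchart hφ hy) t
    rw [chartForm, ContinuousLinearMap.bilinearComp_apply, e] at hX
    refine ht (dsymm φ y X) hX fun h0 => hX0 ?_
    have e2 := DFunLike.congr_fun (dchart_comp_dsymm hφ hy) X
    have h0' : dsymm φ y X = 0 := h0
    simp only [ContinuousLinearMap.comp_apply, ContinuousLinearMap.id_apply, h0', map_zero] at e2
    exact e2.symm
  set T := dchart φ (φ.symm y) t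
  have hTN : g.chartForm φ y T N ≠ 0 := fun h => by
    have := key N h hN
    rw [hNN] at this
    exact lt_irrefl _ this
  -- Subtracting this multiple of `N` makes `W` orthogonal to the timelike vector `T`, where the
  -- metric is positive. The square is unchanged, because `N` is null and orthogonal to `W`.
  have := key (W - (g.chartForm φ y T W / g.chartForm φ y T N) • N)
    (by rw [map_sub, map_smul, smul_eq_mul, div_mul_cancel₀ _ hTN, sub_self])
    (fun h => hW _ (sub_eq_zero.1 h))
  have hWN : g.chartForm φ y W N = 0 := by rw [chartForm_symm, hNW]
  simpa [hNN, hNW, hWN] using this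

end ParallelFields

end LorentzMetric

namespace LorentzMetric

/-! ### Construction of Brinkmann coordinates -/

section AdaptedCharts

variable {M : Type*} [TopologicalSpace M]
  [ChartedSpace (EuclideanSpace ℝ (Fin 3)) M] [IsManifold (𝓡 3) ∞ M]
  {g : LorentzMetric 3 M} {φ ψ : OpenPartialHomeomorph M (EuclideanSpace ℝ (Fin 3))}
  {y : EuclideanSpace ℝ (Fin 3)} {V : ∀ p : M, TangentSpace (𝓡 3) p}

theorem IsPPField.contDiffAt_vecComp (hV : g.IsPPField V) (hφ : IsChart φ) (hy : y ∈ φ.target)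
    (i : Fin 3) : ContDiffAt ℝ ∞ (vecComp φ V i) y :=
  LorentzMetric.contDiffAt_vecComp hV.1 hφ hy i

theorem IsPPField.flatForm_vecCoord (hV : g.IsPPField V) (hφ : IsChart φ) (hy : y ∈ φ.target) :
    g.flatForm φ V y (vecCoord φ V y) = 0 := by
  rw [flatForm, chartForm_vecCoord_self hφ hy]
  exact (hV.2.1 _).2

theorem IsPPField.vecCoord_ne_zero (hV : g.IsPPField V) (hφ : IsChart φ) (hy : y ∈ φ.target) :
    vecCoord φ V y ≠ 0 := LorentzMetric.vecCoord_ne_zero hφ hy (hV.2.1 _).1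

theorem exists_third_index {a b : Fin 3} (h : b ≠ a) :
    ∃ c, c ≠ a ∧ c ≠ b ∧ ∀ i, i = a ∨ i = b ∨ i = c := by
  revert a b
  decide

/-- A closed form on a convex set is exact. The primitive is smooth because its derivative is; it
becomes the coordinate v. -/
theorem exists_primitive_flatForm (hV : g.IsPPField V) (hφ : IsChart φ) {U : Set _}
    (hU : IsOpen U) (hc : Convex ℝ U) (hUt : U ⊆ φ.target) {y₀ : EuclideanSpace ℝ (Fin 3)} :
    ∃ v : EuclideanSpace ℝ (Fin 3) → ℝ, v y₀ = 0 ∧ (∀ y ∈ U, ContDiffAt ℝ ∞ v y) ∧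
      ∀ y ∈ U, fderiv ℝ v y = g.flatForm φ V y := by
  have hs : ∀ y ∈ U, ContDiffAt ℝ ∞ (g.flatForm φ V) y := fun y hy =>
    contDiffAt_flatForm hV.1 hφ (hUt hy)
  obtain ⟨w, hw⟩ := hc.exists_forall_hasFDerivAt_of_fderiv_symmetric hU
    (fun y hy => (hs y hy).diff.differentiableWithinAt)
    (fun y hy => hV.2.2.1.fderiv_flatForm_symm hV.1 hφ (hUt hy))
  have hw' : ∀ y ∈ U, HasFDerivAt (fun z => w z - w y₀) (g.flatForm φ V y) y := fun y hy =>
    (hw y hy).sub_const _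
  refine ⟨fun z => w z - w y₀, sub_self _, fun y hy => ?_, fun y hy => (hw' y hy).fderiv⟩
  refine ContDiffOn.contDiffAt (s := U) ?_ (hU.mem_nhds hy)
  rw [contDiffOn_infty_iff_fderiv_of_isOpen hU]
  refine ⟨fun z hz => (hw' z hz).differentiableAt.differentiableWithinAt, fun z hz => ?_⟩
  exact ((hs z hz).contDiffWithinAt).congr (fun x hx => (hw' x hx).fderiv) (hw' z hz).fderiv

/-- A coordinate change preserves the form dual to `V`. -/
theorem flatForm_change {L : EuclideanSpace ℝ (Fin 3) →L[ℝ] EuclideanSpace ℝ (Fin 3)}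
    {z : EuclideanSpace ℝ (Fin 3)}
    (hB : ∀ X Y, g.chartForm φ y X Y = g.chartForm ψ z (L X) (L Y))
    (hN : vecCoord ψ V z = L (vecCoord φ V y)) (X : EuclideanSpace ℝ (Fin 3)) :
    g.flatForm ψ V z (L X) = g.flatForm φ V y X := by
  rw [flatForm, flatForm, hN, hB]

/-- Some component `V^a` is nonzero, and the dual form has a nonzero component at some index `b ≠
a`. Replacing the coordinate `b` by the primitive v of that form keeps the coordinates independent.
The old coordinate `a` becomes the first one and preserves a nonzero component of `V`. -/
theorem IsPPField.exists_chart_flatForm (hV : g.IsPPField V) (p : M) :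
    ∃ (ψ : OpenPartialHomeomorph M (EuclideanSpace ℝ (Fin 3))) (r : ℝ), IsChart ψ ∧ 0 < r ∧
      p ∈ ψ.source ∧ ψ p = 0 ∧ ψ.target = Metric.ball 0 r ∧
      ∀ z ∈ ψ.target, (∀ X, g.flatForm ψ V z X = X 1) ∧ vecComp ψ V 0 z ≠ 0 := by
  let φ := chartAt (EuclideanSpace ℝ (Fin 3)) p
  have hφ : IsChart φ := IsManifold.chart_mem_maximalAtlas p
  have hp : p ∈ φ.source := mem_chart_source _ p
  have hpt : φ p ∈ φ.target := φ.map_source hp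
  obtain ⟨ε, hε, hball⟩ := Metric.isOpen_iff.1 φ.open_target _ hpt
  obtain ⟨v, hv0, hvs, hvd⟩ := exists_primitive_flatForm hV hφ Metric.isOpen_ball
    (convex_ball (φ p) ε) hball (y₀ := φ p)
  obtain ⟨a, ha⟩ : ∃ a, vecComp φ V a (φ p) ≠ 0 := by
    by_contra! hcon
    exact hV.vecCoord_ne_zero hφ hpt (by ext i; exact hcon i)
  have hθV := hV.flatForm_vecCoord hφ hpt
  -- If all components away from `a` vanished, nullity `θ(V) = V^a θ_a = 0` would kill the last one
  -- as well, and then `V = 0` by nondegeneracy.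
  obtain ⟨b, hba, hb⟩ : ∃ b, b ≠ a ∧ g.flatForm φ V (φ p) (EuclideanSpace.single b 1) ≠ 0 := by
    by_contra! hcon
    rw [expand_apply_left (g.flatForm φ V (φ p)), Finset.sum_eq_single a
      (fun b _ hb => by rw [hcon b hb, smul_zero]) (by simp), smul_eq_mul] at hθV
    have h0 := (mul_eq_zero.1 hθV).resolve_left ha
    refine hV.vecCoord_ne_zero hφ hpt (g.chartForm_nondegenerate hφ hpt fun Z => ?_)
    change g.flatForm φ V (φ p) Z = 0
    rw [expand_apply_left (g.flatForm φ V (φ p))]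
    refine Finset.sum_eq_zero fun i _ => ?_
    by_cases hi : i = a
    · rw [hi, h0, smul_zero]
    · rw [hcon i hi, smul_zero]
  obtain ⟨c, hca, hcb, habc⟩ := exists_third_index hba
  let U : Set (EuclideanSpace ℝ (Fin 3)) :=
    Metric.ball (φ p) ε ∩ vecComp φ V a ⁻¹' {0}ᶜ
  have hU : IsOpen U := by
    refine ContinuousOn.isOpen_inter_preimage ?_ Metric.isOpen_ball isOpen_compl_singleton
    exact fun y hy => (hV.contDiffAt_vecComp hφ (hball hy) a).continuousAt.continuousWithinAt
  have hpU : φ p ∈ U := ⟨Metric.mem_ball_self hε, ha⟩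
  let f : EuclideanSpace ℝ (Fin 3) → EuclideanSpace ℝ (Fin 3) := fun y =>
    !₂[y a - φ p a, v y, y c - φ p c]
  have hsub : ∀ (i : Fin 3) (k : ℝ) (y : EuclideanSpace ℝ (Fin 3)),
    ContDiffAt ℝ ∞ (fun y : EuclideanSpace ℝ (Fin 3) => y i - k) y := fun i k y =>
    ((contDiff_coord i).sub contDiff_const).contDiffAt
  have hf : ∀ y ∈ U, ContDiffAt ℝ ∞ f y := fun y hy =>
    contDiffAt_vec3 (hsub _ _ y) (hvs y hy.1) (hsub _ _ y)
  have hfd : ∀ y ∈ U, ∀ X, fderiv ℝ f y X = !₂[X a, g.flatForm φ V y X, X c] := by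
    intro y hy X
    rw [fderiv_vec3 (hsub _ _ y).diff (hvs y hy.1).diff (hsub _ _ y).diff, hvd y hy.1,
      fderiv_sub_const, fderiv_sub_const, fderiv_coord, fderiv_coord]
  have hbij : Function.Bijective (fderiv ℝ f (φ p)) := by
    refine bijective_of_apply_eq_zero fun X hX => ?_
    rw [hfd _ hpU] at hX
    have h0 : X a = 0 := congrArg (fun w : EuclideanSpace ℝ (Fin 3) => w 0) hX
    have h1 : g.flatForm φ V (φ p) X = 0 :=
      congrArg (fun w : EuclideanSpace ℝ (Fin 3) => w 1) hX
    have h2 : X c = 0 := congrArg (fun w : EuclideanSpace ℝ (Fin 3) => w 2) hX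
    have h3 : ∀ i, i ≠ b → X i = 0 := by
      intro i hi
      rcases habc i with h | h | h
      · rw [h, h0]
      · exact absurd h hi
      · rw [h, h2]
    rw [expand_apply_left (g.flatForm φ V (φ p)), Finset.sum_eq_single b
      (fun i _ hi => by rw [h3 i hi, zero_smul]) (by simp), smul_eq_mul] at h1
    ext i
    by_cases hi : i = b
    · rw [hi]; exact (mul_eq_zero.1 h1).resolve_right hb
    · exact h3 i hi
  have hf0 : f (φ p) = 0 := by
    ext i
    fin_cases i <;> simp [f, hv0]
  obtain ⟨ψ, r, hψ, hr, hpψ, ht, hψf⟩ := exists_chart_of_fderiv_bijective hφ hp hU hpU hf hbij hf0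
  refine ⟨ψ, r, hψ, hr, hpψ, by rw [(hψf p hpψ).2.2, hf0], ht, fun z hz => ?_⟩
  obtain ⟨y, hy, hyU, -, -, hb', hB, hN⟩ := change_of_chart g hφ hψ hψf hz
  refine ⟨fun X => ?_, ?_⟩
  · obtain ⟨X, rfl⟩ := hb'.2 X
    rw [flatForm_change hB (hN V), hfd y hyU]
    rfl
  · rw [← vecCoord_apply, hN, hfd y hyU]
    exact hyU.2

end AdaptedCharts

end LorentzMetric

namespace LorentzMetric

section BrinkmannCharts

variable {M : Type*} [TopologicalSpace M]
  [ChartedSpace (EuclideanSpace ℝ (Fin 3)) M] [IsManifold (𝓡 3) ∞ M]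
  {g : LorentzMetric 3 M} {φ ψ : OpenPartialHomeomorph M (EuclideanSpace ℝ (Fin 3))}
  {y : EuclideanSpace ℝ (Fin 3)} {V : ∀ p : M, TangentSpace (𝓡 3) p}

theorem sum_mat_vecComp (hθ : ∀ X, g.flatForm φ V y X = X 1) (l : Fin 3) :
    g.mat φ y l 0 * vecComp φ V 0 y + g.mat φ y l 1 * vecComp φ V 1 y
      + g.mat φ y l 2 * vecComp φ V 2 y = if l = 1 then 1 else 0 := by
  have := flatForm_single (g := g) (φ := φ) (V := V) (y := y) l
  rw [hθ, Fin.sum_univ_three] at this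
  rw [← this]
  fin_cases l <;> simp

theorem IsPPField.vecComp_one (hV : g.IsPPField V) (hφ : IsChart φ) (hy : y ∈ φ.target)
    (hθ : ∀ X, g.flatForm φ V y X = X 1) : vecComp φ V 1 y = 0 := by
  rw [← vecCoord_apply, ← hθ, hV.flatForm_vecCoord hφ hy]

theorem IsPPField.mat_two_two_pos (hV : g.IsPPField V) (hφ : IsChart φ) (hy : y ∈ φ.target)
    (hθ : ∀ X, g.flatForm φ V y X = X 1) (h0 : vecComp φ V 0 y ≠ 0) : 0 < g.mat φ y 2 2 := by
  rw [mat_eq_chartForm]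
  refine chartForm_pos_of_perp_null hφ hy (hV.vecCoord_ne_zero hφ hy)
    (hV.flatForm_vecCoord hφ hy) ?_ fun c hc => ?_
  · change g.flatForm φ V y _ = 0
    rw [hθ]
    simp
  · have e0 := congrArg (fun w : EuclideanSpace ℝ (Fin 3) => w 0) hc
    have e2 := congrArg (fun w : EuclideanSpace ℝ (Fin 3) => w 2) hc
    simp [vecCoord_apply] at e0 e2
    rcases e0 with h | h
    · rw [h, zero_mul] at e2
      exact one_ne_zero e2
    · exact h0 h

/-- On a leaf v = const the metric is degenerate with kernel `V`, so it is the square of the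
one-form `(g₀₂/√g₂₂) dy₀ + √g₂₂ dy₂`. This form is closed along the leaf because `V` is Killing, and
its primitive is taken as x. -/
theorem IsPPField.exists_chart_orthonormal (hV : g.IsPPField V) (p : M) :
    ∃ (ψ : OpenPartialHomeomorph M (EuclideanSpace ℝ (Fin 3))) (r : ℝ), IsChart ψ ∧ 0 < r ∧
      p ∈ ψ.source ∧ ψ p = 0 ∧ ψ.target = Metric.ball 0 r ∧
      ∀ z ∈ ψ.target, (∀ X, g.flatForm ψ V z X = X 1) ∧ vecComp ψ V 0 z ≠ 0 ∧
        vecComp ψ V 2 z = 0 ∧ g.mat ψ z 2 2 = 1 := by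
  obtain ⟨φ, r, hφ, hr, hp, hp0, ht, hφV⟩ := hV.exists_chart_flatForm p
  have hθ := fun y (hy : y ∈ φ.target) => (hφV y hy).1
  have ha := fun y (hy : y ∈ φ.target) => (hφV y hy).2
  have h22 := fun y (hy : y ∈ φ.target) => hV.mat_two_two_pos hφ hy (hθ y hy) (ha y hy)
  have hm := fun y (hy : y ∈ φ.target) i j => g.contDiffAt_mat hφ hy i j
  have hv := fun y (hy : y ∈ φ.target) i => hV.contDiffAt_vecComp hφ hy i
  have hsq : ∀ y ∈ φ.target, ContDiffAt ℝ ∞ (fun z => √(g.mat φ z 2 2)) y := fun y hy =>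
    (hm y hy 2 2).sqrt (h22 y hy).ne'
  have hsq0 : ∀ y ∈ φ.target, √(g.mat φ y 2 2) ≠ 0 := fun y hy =>
    (Real.sqrt_pos.2 (h22 y hy)).ne'
  have hPs : ∀ y ∈ φ.target, ContDiffAt ℝ ∞ (fun z => g.mat φ z 0 2 * (√(g.mat φ z 2 2))⁻¹) y :=
    fun y hy => (hm y hy 0 2).mul ((hsq y hy).inv (hsq0 y hy))
  -- Combines the (2,2) Killing equation with the orthogonality `g₀₂ V⁰ + g₂₂ V² = 0` of `V` and
  -- `∂₂`, and with the `∂₂`-derivative of that relation.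
  have hclosed : ∀ y ∈ φ.target, pd 2 (fun z => g.mat φ z 0 2 * (√(g.mat φ z 2 2))⁻¹) y =
      pd 0 (fun z => √(g.mat φ z 2 2)) y := by
    intro y hy
    have hev : ∀ᶠ z in 𝓝 y, z ∈ φ.target := φ.open_target.mem_nhds hy
    have e1 : pd 2 (vecComp φ V 1) y = 0 := by
      rw [pd_congr (f' := fun _ => 0)
        (hev.mono fun z hz => hV.vecComp_one hφ hz (hθ z hz)), pd_const]
    have e2 : pd 2 (fun z => g.mat φ z 0 2 * vecComp φ V 0 z
        + g.mat φ z 2 2 * vecComp φ V 2 z) y = 0 := by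
      rw [pd_congr (f' := fun _ => 0), pd_const]
      filter_upwards [hev] with z hz
      have := sum_mat_vecComp (hθ z hz) 2
      rw [hV.vecComp_one hφ hz (hθ z hz), g.mat_symm z 2 0] at this
      simpa using this
    have e3 := sum_mat_vecComp (hθ y hy) 2
    rw [hV.vecComp_one hφ hy (hθ y hy), g.mat_symm y 2 0] at e3
    rw [pd_add ((hm y hy 0 2).diff.fun_mul (hv y hy 0).diff)
      ((hm y hy 2 2).diff.fun_mul (hv y hy 2).diff), pd_mul (hm y hy 0 2).diff (hv y hy 0).diff,
      pd_mul (hm y hy 2 2).diff (hv y hy 2).diff] at e2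
    have k := hV.2.2.1.killing hφ hy 2 2
    rw [Fin.sum_univ_three, e1, hV.vecComp_one hφ hy (hθ y hy), g.mat_symm y 2 0] at k
    have hs2 := Real.mul_self_sqrt (h22 y hy).le
    have hs := hsq0 y hy
    have hinv : pd 2 (fun z => (√(g.mat φ z 2 2))⁻¹) y =
        -(√(g.mat φ y 2 2) ^ 2)⁻¹ * pd 2 (fun z => √(g.mat φ z 2 2)) y := by
      rw [pd_comp (a := fun t => t⁻¹) (f := fun z => √(g.mat φ z 2 2))
        (differentiableAt_inv hs) (hsq y hy).diff, deriv_inv]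
    rw [pd_mul (f' := fun z => (√(g.mat φ z 2 2))⁻¹) (hm y hy 0 2).diff
      ((hsq y hy).inv (hsq0 y hy)).diff, hinv,
      pd_sqrt (hm y hy 2 2).diff (h22 y hy).ne', pd_sqrt (hm y hy 2 2).diff (h22 y hy).ne']
    have ha0 := ha y hy
    set s := √(g.mat φ y 2 2)
    simp only [show (2 : Fin 3) ≠ 1 by decide, if_false] at e3
    rw [← hs2] at e2 e3 k
    field_simp
    apply mul_left_cancel₀ ha0
    linear_combination (-s ^ 2) * k + 2 * s ^ 2 * e2
      - pd 2 (fun z => g.mat φ z 2 2) y * e3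
  have htb : ∀ {y}, y ∈ Metric.ball 0 r → y ∈ φ.target := fun {y} hy => ht ▸ hy
  obtain ⟨x, hxs, hx0, hx2, hxz, -⟩ := exists_leafwise_primitive hr
    (fun y hy => hPs y (htb hy)) (fun y hy => hsq y (htb hy)) (fun y hy => hclosed y (htb hy))
  let f : EuclideanSpace ℝ (Fin 3) → EuclideanSpace ℝ (Fin 3) := fun y => !₂[y 0, y 1, x y]
  have hc : ∀ (i : Fin 3) (y : EuclideanSpace ℝ (Fin 3)),
    ContDiffAt ℝ ∞ (fun y : EuclideanSpace ℝ (Fin 3) => y i) y := fun i y =>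
    (contDiff_coord i).contDiffAt
  have hf : ∀ y ∈ Metric.ball 0 r, ContDiffAt ℝ ∞ f y := fun y hy =>
    contDiffAt_vec3 (hc _ y) (hc _ y) (hxs y hy)
  have hfd : ∀ y ∈ Metric.ball 0 r, ∀ X, fderiv ℝ f y X =
      !₂[X 0, X 1, X 0 * (g.mat φ y 0 2 * (√(g.mat φ y 2 2))⁻¹) + X 1 * pd 1 x y
        + X 2 * √(g.mat φ y 2 2)] := by
    intro y hy X
    rw [fderiv_vec3 (hc _ y).diff (hc _ y).diff (hxs y hy).diff, fderiv_coord, fderiv_coord,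
      fderiv_eq_sum_pd, Fin.sum_univ_three, hx0 y hy, hx2 y hy]
  have hp0' : φ p ∈ Metric.ball (0 : EuclideanSpace ℝ (Fin 3)) r := by
    rw [hp0]; exact Metric.mem_ball_self hr
  have hbij : Function.Bijective (fderiv ℝ f (φ p)) := by
    refine bijective_of_apply_eq_zero fun X hX => ?_
    rw [hfd _ hp0'] at hX
    have h0 : X 0 = 0 := congrArg (fun w : EuclideanSpace ℝ (Fin 3) => w 0) hX
    have h1 : X 1 = 0 := congrArg (fun w : EuclideanSpace ℝ (Fin 3) => w 1) hX
    have h2 := congrArg (fun w : EuclideanSpace ℝ (Fin 3) => w 2) hX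
    simp only [h0, h1, zero_mul, zero_add] at h2
    have h2' : X 2 = 0 := (mul_eq_zero.1 h2).resolve_right (hsq0 _ (htb hp0'))
    ext i
    fin_cases i
    exacts [h0, h1, h2']
  have hf0 : f (φ p) = 0 := by
    rw [hp0]
    ext i
    fin_cases i <;> simp [f, hxz]
  obtain ⟨ψ, r', hψ, hr', hpψ, ht', hψf⟩ :=
    exists_chart_of_fderiv_bijective hφ hp Metric.isOpen_ball hp0' hf hbij hf0
  refine ⟨ψ, r', hψ, hr', hpψ, by rw [(hψf p hpψ).2.2, hf0], ht', fun z hz => ?_⟩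
  obtain ⟨y, hy, hyU, -, -, hb', hB, hN⟩ := change_of_chart g hφ hψ hψf hz
  have hs := hsq0 y hy
  refine ⟨fun X => ?_, ?_, ?_, ?_⟩
  · obtain ⟨X, rfl⟩ := hb'.2 X
    rw [flatForm_change hB (hN V), hfd y hyU, hθ y hy]
    rfl
  · rw [← vecCoord_apply, hN, hfd y hyU]
    exact ha y hy
  -- The new component is `dx(V) = (g₀₂ V⁰ + g₂₂ V²)/√g₂₂`, which vanishes by the orthogonality of
  -- `V` and `∂₂`.
  · rw [← vecCoord_apply, hN, hfd y hyU]
    have e3 := sum_mat_vecComp (hθ y hy) 2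
    have e1 := hV.vecComp_one hφ hy (hθ y hy)
    rw [e1, g.mat_symm y 2 0] at e3
    change vecComp φ V 0 y * _ + vecComp φ V 1 y * _ + vecComp φ V 2 y * _ = 0
    have hs2 := Real.mul_self_sqrt (h22 y hy).le
    set s := √(g.mat φ y 2 2)
    rw [← hs2] at e3
    simp only [show (2 : Fin 3) ≠ 1 by decide, if_false] at e3
    rw [e1]
    field_simp
    linear_combination e3
  · have e : (EuclideanSpace.single 2 1 : EuclideanSpace ℝ (Fin 3)) =
        fderiv ℝ f y ((√(g.mat φ y 2 2))⁻¹ • EuclideanSpace.single 2 1) := by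
      rw [hfd y hyU]
      ext i
      fin_cases i <;> simp [hs]
    rw [mat_eq_chartForm, e, ← hB, map_smul, map_smul, smul_apply,
      ← mat_eq_chartForm]
    have hs2 := Real.mul_self_sqrt (h22 y hy).le
    rw [smul_eq_mul, smul_eq_mul]
    field_simp
    linear_combination -hs2

end BrinkmannCharts

end LorentzMetric

/-- The coordinate matrix of a metric `dv (2 du + f dv) + dx²`. -/
def ppMatrix (f : ℝ) : Matrix (Fin 3) (Fin 3) ℝ := !![0, 1, 0; 1, f, 0; 0, 0, 1]

namespace LorentzMetric

section BrinkmannCharts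

variable {M : Type*} [TopologicalSpace M]
  [ChartedSpace (EuclideanSpace ℝ (Fin 3)) M] [IsManifold (𝓡 3) ∞ M]
  {g : LorentzMetric 3 M} {φ ψ : OpenPartialHomeomorph M (EuclideanSpace ℝ (Fin 3))}
  {y : EuclideanSpace ℝ (Fin 3)} {V : ∀ p : M, TangentSpace (𝓡 3) p}

theorem mat_eq_ppMatrix {f : ℝ} (h0 : ∀ j, g.mat φ y 0 j = if j = 1 then 1 else 0)
    (h11 : g.mat φ y 1 1 = f) (h12 : g.mat φ y 1 2 = 0) (h22 : g.mat φ y 2 2 = 1) :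
    g.mat φ y = ppMatrix f := by
  have s01 := g.mat_symm (φ := φ) y 1 0
  have s02 := g.mat_symm (φ := φ) y 2 0
  have s12 := g.mat_symm (φ := φ) y 2 1
  have h00 := h0 0
  have h01 := h0 1
  have h02 := h0 2
  simp at h00 h01 h02
  ext i j
  fin_cases i <;> fin_cases j <;> simp [ppMatrix, *]

/-- Around every point of a three-dimensional `pp`-wave there are Brinkmann coordinates, with
`V = ∂_u`. -/
theorem IsPPField.exists_brinkmann_chart (hV : g.IsPPField V) (p : M) :
    ∃ (ψ : OpenPartialHomeomorph M (EuclideanSpace ℝ (Fin 3))) (r : ℝ), IsChart ψ ∧ 0 < r ∧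
      p ∈ ψ.source ∧ ψ p = 0 ∧ ψ.target = Metric.ball 0 r ∧
      ∀ z ∈ ψ.target, vecCoord ψ V z = EuclideanSpace.single 0 1 ∧
        g.mat ψ z = ppMatrix (g.mat ψ z 1 1) ∧ pd 0 (fun z => g.mat ψ z 1 1) z = 0 := by
  obtain ⟨φ, r, hφ, hr, hp, hp0, ht, hφV⟩ := hV.exists_chart_orthonormal p
  have hθ := fun y (hy : y ∈ φ.target) => (hφV y hy).1
  have ha := fun y (hy : y ∈ φ.target) => (hφV y hy).2.1
  have hv2 := fun y (hy : y ∈ φ.target) => (hφV y hy).2.2.1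
  have h22 := fun y (hy : y ∈ φ.target) => (hφV y hy).2.2.2
  have hv1 := fun y (hy : y ∈ φ.target) => hV.vecComp_one hφ hy (hθ y hy)
  have hm := fun y (hy : y ∈ φ.target) i j => g.contDiffAt_mat hφ hy i j
  have hv := fun y (hy : y ∈ φ.target) i => hV.contDiffAt_vecComp hφ hy i
  have hl : ∀ y ∈ φ.target, ∀ l, g.mat φ y l 0 * vecComp φ V 0 y = if l = 1 then 1 else 0 := by
    intro y hy l
    have := sum_mat_vecComp (hθ y hy) l
    rwa [hv1 y hy, hv2 y hy, mul_zero, mul_zero, add_zero, add_zero] at this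
  have h00 : ∀ y ∈ φ.target, g.mat φ y 0 0 = 0 := fun y hy =>
    (mul_eq_zero.1 (hl y hy 0)).resolve_right (ha y hy)
  have h02 : ∀ y ∈ φ.target, g.mat φ y 0 2 = 0 := fun y hy => by
    rw [g.mat_symm]
    exact (mul_eq_zero.1 (hl y hy 2)).resolve_right (ha y hy)
  have h01 : ∀ y ∈ φ.target, g.mat φ y 0 1 * vecComp φ V 0 y = 1 := fun y hy => by
    rw [g.mat_symm]
    exact hl y hy 1
  have h01' : ∀ y ∈ φ.target, g.mat φ y 0 1 ≠ 0 := fun y hy => left_ne_zero_of_mul_eq_one (h01 y hy)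
  -- Now `V = V⁰ ∂₀` and `g₀₁ V⁰ = 1`. The (1,2) Killing equation, compared with the `∂₂`-derivative
  -- of this relation, is the closedness of `g₀₁ dy₀ + g₁₂ dy₂` along the leaves.
  have hclosed : ∀ y ∈ φ.target, pd 2 (fun z => g.mat φ z 0 1) y =
      pd 0 (fun z => g.mat φ z 1 2) y := by
    intro y hy
    have hev : ∀ᶠ z in 𝓝 y, z ∈ φ.target := φ.open_target.mem_nhds hy
    have e1 : pd 2 (vecComp φ V 1) y = 0 := by
      rw [pd_congr (f' := fun _ => 0) (hev.mono hv1), pd_const]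
    have e2 : pd 2 (vecComp φ V 2) y = 0 := by
      rw [pd_congr (f' := fun _ => 0) (hev.mono hv2), pd_const]
    have e1' : pd 1 (vecComp φ V 1) y = 0 := by
      rw [pd_congr (f' := fun _ => 0) (hev.mono hv1), pd_const]
    have e2' : pd 1 (vecComp φ V 2) y = 0 := by
      rw [pd_congr (f' := fun _ => 0) (hev.mono hv2), pd_const]
    have e3 : pd 2 (fun z => g.mat φ z 0 1 * vecComp φ V 0 z) y = 0 := by
      rw [pd_congr (f' := fun _ => 1) (hev.mono h01), pd_const]
    rw [pd_mul (hm y hy 0 1).diff (hv y hy 0).diff] at e3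
    have k := hV.2.2.1.killing hφ hy 1 2
    rw [Fin.sum_univ_three, e1, e2, e1', e2', hv1 y hy, hv2 y hy, h02 y hy, g.mat_symm y 1 0] at k
    apply mul_left_cancel₀ (ha y hy)
    linear_combination e3 - k
  have htb : ∀ {y}, y ∈ Metric.ball 0 r → y ∈ φ.target := fun {y} hy => ht ▸ hy
  -- Modulo dv, `du` is `g₀₁ dy₀ + g₁₂ dy₂`. Taking u as coordinate normalises `g₀₁` to 1 and
  -- removes `g₁₂`; the remaining dv-part only alters the coefficient of dv².
  obtain ⟨u, hus, hu0, hu2, huz, -⟩ := exists_leafwise_primitive hr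
    (fun y hy => hm y (htb hy) 0 1) (fun y hy => hm y (htb hy) 1 2)
    (fun y hy => hclosed y (htb hy))
  let f : EuclideanSpace ℝ (Fin 3) → EuclideanSpace ℝ (Fin 3) := fun y => !₂[u y, y 1, y 2]
  have hc : ∀ (i : Fin 3) (y : EuclideanSpace ℝ (Fin 3)),
    ContDiffAt ℝ ∞ (fun y : EuclideanSpace ℝ (Fin 3) => y i) y := fun i y =>
    (contDiff_coord i).contDiffAt
  have hf : ∀ y ∈ Metric.ball 0 r, ContDiffAt ℝ ∞ f y := fun y hy =>
    contDiffAt_vec3 (hus y hy) (hc _ y) (hc _ y)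
  have hfd : ∀ y ∈ Metric.ball 0 r, ∀ X, fderiv ℝ f y X =
      !₂[X 0 * g.mat φ y 0 1 + X 1 * pd 1 u y + X 2 * g.mat φ y 1 2, X 1, X 2] := by
    intro y hy X
    rw [fderiv_vec3 (hus y hy).diff (hc _ y).diff (hc _ y).diff, fderiv_coord, fderiv_coord,
      fderiv_eq_sum_pd, Fin.sum_univ_three, hu0 y hy, hu2 y hy]
  have hp0' : φ p ∈ Metric.ball (0 : EuclideanSpace ℝ (Fin 3)) r := by
    rw [hp0]; exact Metric.mem_ball_self hr
  have hbij : Function.Bijective (fderiv ℝ f (φ p)) := by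
    refine bijective_of_apply_eq_zero fun X hX => ?_
    rw [hfd _ hp0'] at hX
    have h0 := congrArg (fun w : EuclideanSpace ℝ (Fin 3) => w 0) hX
    have h1 : X 1 = 0 := congrArg (fun w : EuclideanSpace ℝ (Fin 3) => w 1) hX
    have h2 : X 2 = 0 := congrArg (fun w : EuclideanSpace ℝ (Fin 3) => w 2) hX
    simp only [h2, h1, zero_mul, add_zero] at h0
    have h0' : X 0 = 0 := (mul_eq_zero.1 h0).resolve_right (h01' _ (htb hp0'))
    ext i
    fin_cases i
    exacts [h0', h1, h2]
  have hf0 : f (φ p) = 0 := by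
    rw [hp0]
    ext i
    fin_cases i <;> simp [f, huz]
  obtain ⟨ψ, r', hψ, hr', hpψ, ht', hψf⟩ :=
    exists_chart_of_fderiv_bijective hφ hp Metric.isOpen_ball hp0' hf hbij hf0
  have key : ∀ z ∈ ψ.target, vecCoord ψ V z = EuclideanSpace.single 0 1 ∧
      g.mat ψ z = ppMatrix (g.mat ψ z 1 1) := by
    intro z hz
    obtain ⟨y, hy, hyU, -, -, hb', hB, hN⟩ := change_of_chart g hφ hψ hψf hz
    have hVz : vecCoord ψ V z = EuclideanSpace.single 0 1 := by
      rw [hN, hfd y hyU]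
      ext i
      fin_cases i
      · simp [vecCoord_apply, hv1 y hy, hv2 y hy]
        rw [mul_comm, h01 y hy]
      · simp [vecCoord_apply, hv1 y hy]
      · simp [vecCoord_apply, hv2 y hy]
    have hθz : ∀ X, g.flatForm ψ V z X = X 1 := fun X => by
      obtain ⟨X, rfl⟩ := hb'.2 X
      rw [flatForm_change hB (hN V), hfd y hyU, hθ y hy]
      rfl
    have ne := h01' y hy
    have e1 : (EuclideanSpace.single 1 1 : EuclideanSpace ℝ (Fin 3)) = fderiv ℝ f y
        (EuclideanSpace.single 1 1 - (pd 1 u y / g.mat φ y 0 1) • EuclideanSpace.single 0 1) := by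
      rw [hfd y hyU]
      ext i
      fin_cases i <;> simp [ne]
    have e2 : (EuclideanSpace.single 2 1 : EuclideanSpace ℝ (Fin 3)) = fderiv ℝ f y
        (EuclideanSpace.single 2 1 -
          (g.mat φ y 1 2 / g.mat φ y 0 1) • EuclideanSpace.single 0 1) := by
      rw [hfd y hyU]
      ext i
      fin_cases i <;> simp [ne]
    refine ⟨hVz, mat_eq_ppMatrix (fun j => ?_) rfl ?_ ?_⟩
    · rw [mat_eq_chartForm, ← hVz]
      change g.flatForm ψ V z _ = _
      rw [hθz]
      fin_cases j <;> simp
    · rw [mat_eq_chartForm, e1, e2, ← hB]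
      simp only [map_sub, map_smul, sub_apply, smul_apply, ← mat_eq_chartForm, smul_eq_mul,
        h00 y hy, h02 y hy, g.mat_symm y 1 0]
      field_simp
      ring
    · rw [mat_eq_chartForm, e2, ← hB]
      simp only [map_sub, map_smul, sub_apply, smul_apply, ← mat_eq_chartForm, smul_eq_mul,
        h00 y hy, h02 y hy, g.mat_symm y 2 0, h22 y hy]
      ring
  refine ⟨ψ, r', hψ, hr', hpψ, by rw [(hψf p hpψ).2.2, hf0], ht', fun z hz =>
    ⟨(key z hz).1, (key z hz).2, ?_⟩⟩
  have hev : ∀ᶠ w in 𝓝 z, w ∈ ψ.target := ψ.open_target.mem_nhds hz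
  have hcomp : ∀ w ∈ ψ.target, ∀ i, vecComp ψ V i w = if i = 0 then 1 else 0 := by
    intro w hw i
    rw [← vecCoord_apply, (key w hw).1]
    simp
  have hd : ∀ i j, pd i (vecComp ψ V j) z = 0 := fun i j => by
    rw [pd_congr (hev.mono fun w hw => hcomp w hw j), pd_const]
  -- With `V = ∂_u` of constant components, the (1,1) Killing equation reads `∂_u f = 0`.
  have k := hV.2.2.1.killing hψ hz 1 1
  simpa [Fin.sum_univ_three, hd, hcomp z hz] using k

end BrinkmannCharts

end LorentzMetric

/-! ### Connection and curvature of the Brinkmann metric -/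

/-- The Christoffel symbols of `dv (2 du + f dv) + dx²`, where `a = ∂_v f` and `b = ∂_x f`. -/
def ppGamma (a b : ℝ) : Fin 3 → Fin 3 → Fin 3 → ℝ
  | 0, 1, 1 => a / 2
  | 0, 1, 2 => b / 2
  | 0, 2, 1 => b / 2
  | 2, 1, 1 => -b / 2
  | _, _, _ => 0

/-- The curvature components of `dv (2 du + f dv) + dx²`, where `c = ∂_x ∂_x f`. -/
def ppRiem (c : ℝ) : Fin 3 → Fin 3 → Fin 3 → Fin 3 → ℝ
  | 0, 1, 2, 2 => -c / 2
  | 0, 2, 1, 2 => c / 2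
  | 2, 1, 2, 1 => c / 2
  | 2, 2, 1, 1 => -c / 2
  | _, _, _, _ => 0

theorem ppGamma_eq (a b : ℝ) (k i j : Fin 3) :
    ppGamma a b k i j = ppGamma 1 0 k i j * a + ppGamma 0 1 k i j * b := by
  fin_cases k <;> fin_cases i <;> fin_cases j <;> simp [ppGamma] <;> ring

theorem ppGamma_one (a b : ℝ) (i j : Fin 3) : ppGamma a b 1 i j = 0 := by
  simp [ppGamma]

theorem ppGamma_zero_left (a b : ℝ) (k j : Fin 3) : ppGamma a b k 0 j = 0 := by
  simp [ppGamma]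

theorem ppGamma_zero_right (a b : ℝ) (k i : Fin 3) : ppGamma a b k i 0 = 0 := by
  simp [ppGamma]

/-- In the curvature sum over the contracted index only the value 2 survives. A nonzero product on
either side needs `i = j = 1`, so this symmetry removes the quadratic part of the curvature. -/
theorem ppGamma_mul (a b : ℝ) (l i j k : Fin 3) :
    ppGamma a b l i 2 * ppGamma a b 2 j k = ppGamma a b l j 2 * ppGamma a b 2 i k := by
  fin_cases l <;> fin_cases i <;> fin_cases j <;> fin_cases k <;>
    simp only [ppGamma, mul_zero, zero_mul]

theorem ppGamma_two_left (a b : ℝ) (k j : Fin 3) :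
    ppGamma a b k 2 j = if k = 0 ∧ j = 1 then b / 2 else 0 := by
  fin_cases k <;> fin_cases j <;> simp [ppGamma]

theorem ppRiem_zero (c : ℝ) (l i j k : Fin 3) (h : l = 1 ∨ i = 0 ∨ j = 0 ∨ k = 0) :
    ppRiem c l i j k = 0 := by
  rcases h with rfl | rfl | rfl | rfl <;> simp [ppRiem]

theorem ppRiem_eq (c : ℝ) (l i j k : Fin 3) : ppRiem c l i j k = ppRiem 1 l i j k * c := by
  fin_cases l <;> fin_cases i <;> fin_cases j <;> fin_cases k <;> simp [ppRiem] <;> ring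

theorem ppMatrix_inv (f : ℝ) : (ppMatrix f)⁻¹ = !![-f, 1, 0; 1, 0, 0; 0, 0, 1] := by
  refine Matrix.inv_eq_right_inv ?_
  ext i j
  fin_cases i <;> fin_cases j <;> simp [ppMatrix, Matrix.mul_apply, Fin.sum_univ_three]

namespace LorentzMetric

/-- In the chart `φ` the metric is `dv (2 du + f dv) + dx²`, with `f` not depending on `u`. -/
structure IsBrinkmannChart {M : Type*} [TopologicalSpace M]
    [ChartedSpace (EuclideanSpace ℝ (Fin 3)) M] [IsManifold (𝓡 3) ∞ M] (g : LorentzMetric 3 M)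
    (φ : OpenPartialHomeomorph M (EuclideanSpace ℝ (Fin 3)))
    (f : EuclideanSpace ℝ (Fin 3) → ℝ) : Prop where
  isChart : IsChart φ
  mat_eq : ∀ y ∈ φ.target, g.mat φ y = ppMatrix (f y)
  pd_zero : ∀ y ∈ φ.target, pd 0 f y = 0

namespace IsBrinkmannChart

variable {M : Type*} [TopologicalSpace M]
  [ChartedSpace (EuclideanSpace ℝ (Fin 3)) M] [IsManifold (𝓡 3) ∞ M]
  {g : LorentzMetric 3 M} {φ : OpenPartialHomeomorph M (EuclideanSpace ℝ (Fin 3))}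
  {y : EuclideanSpace ℝ (Fin 3)} {f : EuclideanSpace ℝ (Fin 3) → ℝ}

theorem eventually_mem (hy : y ∈ φ.target) : ∀ᶠ z in 𝓝 y, z ∈ φ.target :=
  φ.open_target.mem_nhds hy

theorem contDiffAt (hB : g.IsBrinkmannChart φ f) (hy : y ∈ φ.target) : ContDiffAt ℝ ∞ f y := by
  refine (g.contDiffAt_mat hB.isChart hy 1 1).congr_of_eventuallyEq ?_
  filter_upwards [eventually_mem hy] with z hz
  rw [hB.mat_eq z hz]
  rfl

theorem pd_zero_pd (hB : g.IsBrinkmannChart φ f) (hy : y ∈ φ.target) (i : Fin 3) :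
    pd 0 (pd i f) y = 0 := by
  rw [pd_pd_comm (hB.contDiffAt hy), pd_congr ((eventually_mem hy).mono hB.pd_zero), pd_const]

theorem pd_zero_pd_pd (hB : g.IsBrinkmannChart φ f) (hy : y ∈ φ.target) (i j : Fin 3) :
    pd 0 (pd i (pd j f)) y = 0 := by
  rw [pd_pd_comm (contDiffAt_pd (hB.contDiffAt hy) j),
    pd_congr ((eventually_mem hy).mono fun z hz => hB.pd_zero_pd hz j), pd_const]

theorem pd_mat (hB : g.IsBrinkmannChart φ f) (hy : y ∈ φ.target) (m i j : Fin 3) :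
    pd m (fun z => g.mat φ z i j) y = if i = 1 ∧ j = 1 then pd m f y else 0 := by
  rw [pd_congr ((eventually_mem hy).mono fun z hz => by rw [hB.mat_eq z hz])
    (f' := fun z => ppMatrix (f z) i j)]
  fin_cases i <;> fin_cases j <;> simp [ppMatrix, pd_const]

theorem invMat_eq (hB : g.IsBrinkmannChart φ f) (hy : y ∈ φ.target) :
    g.invMat φ y = !![-f y, 1, 0; 1, 0, 0; 0, 0, 1] := by
  rw [invMat, hB.mat_eq y hy, ppMatrix_inv]

theorem christoffel_eq (hB : g.IsBrinkmannChart φ f) (hy : y ∈ φ.target) (k i j : Fin 3) :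
    g.christoffel φ k i j y = ppGamma (pd 1 f y) (pd 2 f y) k i j := by
  rw [christoffel, hB.invMat_eq hy]
  simp only [hB.pd_mat hy, Fin.sum_univ_three]
  have h0 := hB.pd_zero y hy
  fin_cases k <;> fin_cases i <;> fin_cases j <;> simp [ppGamma, h0] <;> ring

theorem pd_christoffel (hB : g.IsBrinkmannChart φ f) (hy : y ∈ φ.target) (m k i j : Fin 3) :
    pd m (g.christoffel φ k i j) y = ppGamma (pd m (pd 1 f) y) (pd m (pd 2 f) y) k i j := by
  have d := fun i => (contDiffAt_pd (hB.contDiffAt hy) i).diff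
  rw [pd_congr (f' := fun z => ppGamma 1 0 k i j * pd 1 f z + ppGamma 0 1 k i j * pd 2 f z)
    ((eventually_mem hy).mono fun z hz => by rw [hB.christoffel_eq hz, ppGamma_eq]),
    pd_add ((d 1).const_mul _) ((d 2).const_mul _), pd_const_mul _ (d 1), pd_const_mul _ (d 2),
    ← ppGamma_eq]

theorem riem_eq (hB : g.IsBrinkmannChart φ f) (hy : y ∈ φ.target) (l i j k : Fin 3) :
    g.riem φ l i j k y = ppRiem (pd 2 (pd 2 f) y) l i j k := by
  rw [riem]
  simp only [hB.pd_christoffel hy, hB.christoffel_eq hy, Fin.sum_univ_three, ppGamma_one,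
    ppGamma_zero_right, ppGamma_mul _ _ l i j k, mul_zero, zero_mul, sub_self, add_zero]
  have h0 := fun i => hB.pd_zero_pd hy i
  have h21 := pd_pd_comm (hB.contDiffAt hy) 2 1
  fin_cases l <;> fin_cases i <;> fin_cases j <;> fin_cases k <;>
    simp [ppGamma, ppRiem, h0, h21] <;> ring

theorem ricci_eq (hB : g.IsBrinkmannChart φ f) (hy : y ∈ φ.target) (j k : Fin 3) :
    g.ricci φ j k y = if j = 1 ∧ k = 1 then -pd 2 (pd 2 f) y / 2 else 0 := by
  rw [ricci]
  simp only [hB.riem_eq hy, Fin.sum_univ_three]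
  fin_cases j <;> fin_cases k <;> simp [ppRiem]

theorem isFlatAt_iff (hB : g.IsBrinkmannChart φ f) {p : M} (hp : p ∈ φ.source) :
    g.IsFlatAt p ↔ pd 2 (pd 2 f) (φ p) = 0 := by
  rw [LorentzMetric.isFlatAt_iff g hB.isChart hp]
  simp only [hB.riem_eq (φ.map_source hp)]
  refine ⟨fun h => ?_, fun h l i j k => by rw [ppRiem_eq, h, mul_zero]⟩
  have := h 2 1 2 1
  simp [ppRiem] at this
  exact this

/-- In direction ∂_u nothing varies and no Christoffel symbol occurs. In direction ∂_x the only
symbol is `Γ⁰₂₁`, which contracts the curvature in a lower index 0 or an upper index 1, where it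
vanishes; what is left is a multiple of f_xxx. -/
theorem covRiem_eq_zero (hB : g.IsBrinkmannChart φ f) (hy : y ∈ φ.target)
    (h3 : pd 2 (pd 2 (pd 2 f)) y = 0) {m : Fin 3} (hm : m ≠ 1) (l i j k : Fin 3) :
    g.covRiem φ m l i j k y = 0 := by
  have h0 := hB.pd_zero_pd_pd hy 2 2
  have hd : pd m (g.riem φ l i j k) y = 0 := by
    rw [pd_congr (f' := fun z => ppRiem 1 l i j k * pd 2 (pd 2 f) z)
      ((eventually_mem hy).mono fun z hz => by rw [hB.riem_eq hz, ppRiem_eq]),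
      pd_const_mul _ (contDiffAt_pd (contDiffAt_pd (hB.contDiffAt hy) 2) 2).diff]
    fin_cases m
    · simp [h0]
    · exact absurd rfl hm
    · simp [h3]
  rw [covRiem, hd]
  have hz : ∀ l i j k, (l = 1 ∨ i = 0 ∨ j = 0 ∨ k = 0) → g.riem φ l i j k y = 0 :=
    fun l i j k h' => by rw [hB.riem_eq hy, ppRiem_zero _ _ _ _ _ h']
  simp only [hB.christoffel_eq hy, Fin.sum_univ_three]
  fin_cases m
  · simp [ppGamma_zero_left]
  · exact absurd rfl hm
  · simp [ppGamma_two_left, hz]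

section Density

variable {h : M → ℝ}

theorem hess_eq (hB : g.IsBrinkmannChart φ f) (hy : y ∈ φ.target) (i j : Fin 3) :
    g.hess φ h i j y = pd i (pd j (h ∘ φ.symm)) y
      - ppGamma (pd 1 f y) (pd 2 f y) 0 i j * pd 0 (h ∘ φ.symm) y
      - ppGamma (pd 1 f y) (pd 2 f y) 2 i j * pd 2 (h ∘ φ.symm) y := by
  rw [hess]
  simp only [hB.christoffel_eq hy, Fin.sum_univ_three]
  have : ∀ a b : ℝ, ppGamma a b 1 i j = 0 := fun a b => by simp [ppGamma]
  rw [this]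
  ring

theorem lap_eq (hB : g.IsBrinkmannChart φ f)
    (hh : ContMDiff (𝓡 3) 𝓘(ℝ, ℝ) ∞ h) (hy : y ∈ φ.target) :
    g.lap φ h y = -f y * pd 0 (pd 0 (h ∘ φ.symm)) y + 2 * pd 0 (pd 1 (h ∘ φ.symm)) y
      + pd 2 (pd 2 (h ∘ φ.symm)) y := by
  have c := pd_pd_comm (contDiffAt_comp_symm hh hB.isChart hy) 1 0
  rw [lap, hB.invMat_eq hy]
  simp only [hB.hess_eq hy, Fin.sum_univ_three]
  simp [ppGamma, c]
  ring

end Density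

end IsBrinkmannChart

end LorentzMetric

namespace LorentzMetric

/-! ### Gradient, transversal parallelism and the field equation in Brinkmann coordinates -/

section Gradient

variable {n : ℕ} {M : Type*} [TopologicalSpace M]
  [ChartedSpace (EuclideanSpace ℝ (Fin n)) M] [IsManifold (𝓡 n) ∞ M]
  {φ : OpenPartialHomeomorph M (EuclideanSpace ℝ (Fin n))} {h : M → ℝ}
  {y : EuclideanSpace ℝ (Fin n)}

theorem fderiv_comp_symm (hh : ContMDiff (𝓡 n) 𝓘(ℝ, ℝ) ∞ h) (hφ : IsChart φ)
    (hy : y ∈ φ.target) (X : EuclideanSpace ℝ (Fin n)) :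
    fderiv ℝ (h ∘ φ.symm) y X = mfderiv (𝓡 n) 𝓘(ℝ, ℝ) h (φ.symm y) (dsymm φ y X) := by
  have hd : MDifferentiableAt (𝓡 n) 𝓘(ℝ, ℝ) h (φ.symm y) :=
    (hh (φ.symm y)).mdifferentiableAt (by simp)
  have := mfderiv_comp y hd (hφ.mdifferentiableAt_symm hy)
  rw [← mfderiv_eq_fderiv, this]
  rfl

theorem fderiv_vecCoord (hh : ContMDiff (𝓡 n) 𝓘(ℝ, ℝ) ∞ h) (hφ : IsChart φ)
    (hy : y ∈ φ.target) (V : ∀ p : M, TangentSpace (𝓡 n) p) :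
    fderiv ℝ (h ∘ φ.symm) y (vecCoord φ V y) =
      mfderiv (𝓡 n) 𝓘(ℝ, ℝ) h (φ.symm y) (V (φ.symm y)) := by
  rw [fderiv_comp_symm hh hφ hy, dsymm_vecCoord V hφ hy]

theorem chartForm_grad (g : LorentzMetric n M) (hh : ContMDiff (𝓡 n) 𝓘(ℝ, ℝ) ∞ h)
    (hφ : IsChart φ) (hy : y ∈ φ.target) (X : EuclideanSpace ℝ (Fin n)) :
    g.chartForm φ y (vecCoord φ (g.grad h) y) X = fderiv ℝ (h ∘ φ.symm) y X := by
  rw [fderiv_comp_symm hh hφ hy, chartForm, ContinuousLinearMap.bilinearComp_apply,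
    dsymm_vecCoord _ hφ hy]
  exact g.val_grad h _ _

/-- A function that is constant on the domains of charts covering a connected manifold is
constant. -/
theorem exists_eq_const_of_forall_chart [ConnectedSpace M] {F : M → ℝ}
    (H : ∀ p : M, ∃ φ : OpenPartialHomeomorph M (EuclideanSpace ℝ (Fin n)), p ∈ φ.source ∧
      ∃ c, ∀ q ∈ φ.source, F q = c) : ∃ c, ∀ p, F p = c := by
  have hF : IsLocallyConstant F := by
    rw [IsLocallyConstant.iff_exists_open]
    intro p
    obtain ⟨φ, hp, c, hc⟩ := H p
    exact ⟨φ.source, φ.open_source, hp, fun q hq => by rw [hc q hq, hc p hp]⟩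
  obtain ⟨p⟩ := (inferInstance : Nonempty M)
  exact ⟨F p, fun q => hF.apply_eq_of_preconnectedSpace q p⟩

end Gradient

namespace IsBrinkmannChart

variable {M : Type*} [TopologicalSpace M]
  [ChartedSpace (EuclideanSpace ℝ (Fin 3)) M] [IsManifold (𝓡 3) ∞ M]
  {g : LorentzMetric 3 M} {φ : OpenPartialHomeomorph M (EuclideanSpace ℝ (Fin 3))}
  {y : EuclideanSpace ℝ (Fin 3)} {f : EuclideanSpace ℝ (Fin 3) → ℝ} {h : M → ℝ}

theorem chartForm_eq (hB : g.IsBrinkmannChart φ f) (hy : y ∈ φ.target)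
    (X Y : EuclideanSpace ℝ (Fin 3)) :
    g.chartForm φ y X Y = X 0 * Y 1 + X 1 * Y 0 + f y * X 1 * Y 1 + X 2 * Y 2 := by
  rw [chartForm_eq_sum, hB.mat_eq y hy]
  simp [Fin.sum_univ_three, ppMatrix]
  ring

theorem val_grad_grad (hB : g.IsBrinkmannChart φ f) (hh : ContMDiff (𝓡 3) 𝓘(ℝ, ℝ) ∞ h)
    {p : M} (hp : p ∈ φ.source) :
    g.val p (g.grad h p) (g.grad h p) = -f (φ p) * pd 0 (h ∘ φ.symm) (φ p) ^ 2
      + 2 * pd 0 (h ∘ φ.symm) (φ p) * pd 1 (h ∘ φ.symm) (φ p) + pd 2 (h ∘ φ.symm) (φ p) ^ 2 := by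
  have hy := φ.map_source hp
  have key := fun X => chartForm_grad g hh hB.isChart hy X
  have e : g.val p (g.grad h p) (g.grad h p) = g.chartForm φ (φ p)
      (vecCoord φ (g.grad h) (φ p)) (vecCoord φ (g.grad h) (φ p)) := by
    rw [chartForm_vecCoord_self hB.isChart hy, φ.left_inv hp]
  have k0 := key (EuclideanSpace.single 0 1)
  have k1 := key (EuclideanSpace.single 1 1)
  have k2 := key (EuclideanSpace.single 2 1)
  rw [hB.chartForm_eq hy] at k0 k1 k2
  rw [e, hB.chartForm_eq hy, pd, pd, pd, ← k0, ← k1, ← k2]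
  simp
  ring

/-- The condition on `W` says that it is a combination of ∂_u and ∂_x, that is, orthogonal to ∂_u;
linearity reduces the claim to `covRiem_eq_zero`. -/
theorem covCurv_eq_zero (hB : g.IsBrinkmannChart φ f) (hy : y ∈ φ.target)
    (h3 : pd 2 (pd 2 (pd 2 f)) y = 0) {W : EuclideanSpace ℝ (Fin 3)} (hW : W 1 = 0)
    (X Y Z : EuclideanSpace ℝ (Fin 3)) : covCurv (g.connection φ) y W X Y Z = 0 := by
  revert Z
  refine linear_ext_single (f' := fun _ => 0) ⟨fun Z Z' => ?_, fun c Z => ?_⟩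
    ⟨by simp, by simp⟩ fun k => ?_
  · simp only [covCurv, map_add]; abel
  · simp only [covCurv, map_smul]; module
  revert Y
  refine linear_ext_single (f' := fun _ => 0) ⟨fun Z Z' => ?_, fun c Z => ?_⟩
    ⟨by simp, by simp⟩ fun j => ?_
  · simp only [covCurv, map_add, add_apply]; abel
  · simp only [covCurv, map_smul, smul_apply]; module
  revert X
  refine linear_ext_single (f' := fun _ => 0) ⟨fun Z Z' => ?_, fun c Z => ?_⟩
    ⟨by simp, by simp⟩ fun i => ?_
  · simp only [covCurv, map_add, add_apply]; abel
  · simp only [covCurv, map_smul, smul_apply]; module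
  have hz : ∀ m : Fin 3, m ≠ 1 → covCurv (g.connection φ) y (EuclideanSpace.single m 1)
      (EuclideanSpace.single i 1) (EuclideanSpace.single j 1) (EuclideanSpace.single k 1) = 0 := by
    intro m hm
    ext l
    rw [g.covCurv_single hB.isChart hy]
    exact hB.covRiem_eq_zero hy h3 hm l i j k
  have hW' : W = W 0 • EuclideanSpace.single 0 1 + W 2 • EuclideanSpace.single 2 1 := by
    ext i
    fin_cases i <;> simp [hW]
  have h0 := hz 0 (by decide)
  have h2 := hz 2 (by decide)
  rw [hW']
  have e : covCurv (g.connection φ) y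
      (W 0 • EuclideanSpace.single 0 1 + W 2 • EuclideanSpace.single 2 1)
      (EuclideanSpace.single i 1) (EuclideanSpace.single j 1) (EuclideanSpace.single k 1) =
      W 0 • covCurv (g.connection φ) y (EuclideanSpace.single 0 1)
      (EuclideanSpace.single i 1) (EuclideanSpace.single j 1) (EuclideanSpace.single k 1) +
      W 2 • covCurv (g.connection φ) y (EuclideanSpace.single 2 1)
      (EuclideanSpace.single i 1) (EuclideanSpace.single j 1) (EuclideanSpace.single k 1) := by
    simp only [covCurv, map_smul, map_add, add_apply, smul_apply]
    module
  rw [e, h0, h2, smul_zero, smul_zero, add_zero]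

theorem weightedEinstein_eq (hB : g.IsBrinkmannChart φ f)
    (hh : ContMDiff (𝓡 3) 𝓘(ℝ, ℝ) ∞ h) (Λ : ℝ) (hy : y ∈ φ.target) (i j : Fin 3) :
    g.weightedEinstein φ h Λ i j y =
      h (φ.symm y) * (if i = 1 ∧ j = 1 then -pd 2 (pd 2 f) y / 2 else 0)
      - (pd i (pd j (h ∘ φ.symm)) y
        - ppGamma (pd 1 f y) (pd 2 f y) 0 i j * pd 0 (h ∘ φ.symm) y
        - ppGamma (pd 1 f y) (pd 2 f y) 2 i j * pd 2 (h ∘ φ.symm) y)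
      + (-f y * pd 0 (pd 0 (h ∘ φ.symm)) y + 2 * pd 0 (pd 1 (h ∘ φ.symm)) y
      + pd 2 (pd 2 (h ∘ φ.symm)) y + Λ) * ppMatrix (f y) i j := by
  rw [weightedEinstein, hB.ricci_eq hy, hB.hess_eq hy, hB.lap_eq hh hy, hB.mat_eq y hy]

/-- The vacuum weighted Einstein equation in Brinkmann coordinates. -/
theorem weightedEinstein_eq_zero_iff (hB : g.IsBrinkmannChart φ f)
    (hh : ContMDiff (𝓡 3) 𝓘(ℝ, ℝ) ∞ h) (Λ : ℝ) (hy : y ∈ φ.target) :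
    (∀ i j, g.weightedEinstein φ h Λ i j y = 0) ↔
      pd 0 (pd 0 (h ∘ φ.symm)) y = 0 ∧ pd 0 (pd 2 (h ∘ φ.symm)) y = 0 ∧
      pd 0 (pd 1 (h ∘ φ.symm)) y = -Λ / 2 ∧ pd 2 (pd 2 (h ∘ φ.symm)) y = -Λ / 2 ∧
      pd 1 (pd 2 (h ∘ φ.symm)) y = pd 2 f y / 2 * pd 0 (h ∘ φ.symm) y ∧
      pd 1 (pd 1 (h ∘ φ.symm)) y - pd 1 f y / 2 * pd 0 (h ∘ φ.symm) y
        + pd 2 f y / 2 * pd 2 (h ∘ φ.symm) y =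
        -h (φ.symm y) * pd 2 (pd 2 f) y / 2 - Λ / 2 * f y := by
  have hH := contDiffAt_comp_symm hh hB.isChart hy
  have c10 := pd_pd_comm hH 1 0
  have c20 := pd_pd_comm hH 2 0
  have c21 := pd_pd_comm hH 2 1
  constructor
  · intro h'
    have e00 := h' 0 0
    have e01 := h' 0 1
    have e02 := h' 0 2
    have e11 := h' 1 1
    have e12 := h' 1 2
    have e22 := h' 2 2
    rw [hB.weightedEinstein_eq hh Λ hy] at e00 e01 e02 e11 e12 e22
    simp [ppGamma, ppMatrix] at e00 e01 e02 e11 e12 e22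
    rw [e00] at e01 e22 e11
    -- In the (2,2) entry h_xx cancels against its contribution to the Laplacian, which determines
    -- h_uv; the (0,1) entry then determines h_xx.
    have k01 : pd 0 (pd 1 (h ∘ φ.symm)) y = -Λ / 2 := by linear_combination e22 / 2
    have k22 : pd 2 (pd 2 (h ∘ φ.symm)) y = -Λ / 2 := by linear_combination e01 - k01
    refine ⟨e00, e02, k01, k22, by linear_combination -e12, ?_⟩
    rw [k01, k22] at e11
    linear_combination -e11
  · rintro ⟨h00, h02, h01, h22, h12, h11⟩ i j
    rw [hB.weightedEinstein_eq hh Λ hy, h00, h01, h22]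
    fin_cases i <;> fin_cases j <;> simp [ppGamma, ppMatrix, *] <;> linarith

end IsBrinkmannChart

end LorentzMetric

/-! ### The two local forms solve the equation -/

section TwoVariables

variable {f : EuclideanSpace ℝ (Fin 3) → ℝ} {F : ℝ → ℝ → ℝ} {y : EuclideanSpace ℝ (Fin 3)}

theorem pd_eq_of_hasDerivAt {n : ℕ} {f : EuclideanSpace ℝ (Fin n) → ℝ}
    {y : EuclideanSpace ℝ (Fin n)} {i : Fin n} {d : ℝ} (hf : DifferentiableAt ℝ f y)
    (h : HasDerivAt (fun t : ℝ => f (y + t • EuclideanSpace.single i 1)) d 0) : pd i f y = d := by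
  rw [pd, ← hf.lineDeriv_eq_fderiv]
  exact h.deriv

theorem tendsto_add_smul_single (i : Fin 3) :
    Filter.Tendsto (fun t : ℝ => y + t • EuclideanSpace.single i 1) (𝓝 0) (𝓝 y) := by
  have : Continuous fun t : ℝ => y + t • (EuclideanSpace.single i 1 : EuclideanSpace ℝ (Fin 3)) :=
    by fun_prop
  simpa using this.tendsto 0

theorem pd_zero_of_eventually_eq (hf : DifferentiableAt ℝ f y)
    (hF : ∀ᶠ z in 𝓝 y, f z = F (z 1) (z 2)) : pd 0 f y = 0 := by
  refine pd_eq_of_hasDerivAt hf ?_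
  refine (hasDerivAt_const 0 (F (y 1) (y 2))).congr_of_eventuallyEq ?_
  filter_upwards [(tendsto_add_smul_single 0).eventually hF] with t ht
  rw [ht]
  simp

/-- The derivative is evaluated along a coordinate line, so only a one-variable derivative of `F`
enters; joint differentiability is supplied by `f`. -/
theorem pd_two_of_eventually_eq (hf : DifferentiableAt ℝ f y)
    (hF : ∀ᶠ z in 𝓝 y, f z = F (z 1) (z 2)) {d : ℝ} (hd : HasDerivAt (F (y 1)) d (y 2)) :
    pd 2 f y = d := by
  refine pd_eq_of_hasDerivAt hf ?_
  have h1 : HasDerivAt (fun t : ℝ => F (y 1) (y 2 + t)) d 0 := by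
    have : HasDerivAt (F (y 1)) d (y 2 + 0) := by rwa [add_zero]
    exact this.comp_const_add (y 2) 0
  refine h1.congr_of_eventuallyEq ?_
  filter_upwards [(tendsto_add_smul_single 2).eventually hF] with t ht
  rw [ht]
  simp

theorem contDiffAt_deriv {a : ℝ → ℝ} {v : ℝ} (ha : ContDiffAt ℝ ∞ a v) :
    ContDiffAt ℝ ∞ (deriv a) v := by
  have : deriv a = fun x => fderiv ℝ a x 1 := by
    ext x
    rw [fderiv_apply_one_eq_deriv]
  rw [this]
  exact (ha.fderiv_right (m := ∞) (by simp)).clm_apply contDiffAt_const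

end TwoVariables

section LocalForms

variable {M : Type*} [TopologicalSpace M]
  [ChartedSpace (EuclideanSpace ℝ (Fin 3)) M] [IsManifold (𝓡 3) ∞ M]
  {g : LorentzMetric 3 M} {φ : OpenPartialHomeomorph M (EuclideanSpace ℝ (Fin 3))}
  {y : EuclideanSpace ℝ (Fin 3)} {f : EuclideanSpace ℝ (Fin 3) → ℝ} {F : ℝ → ℝ → ℝ} {h : M → ℝ}

theorem isOpen_vRange (φ : OpenPartialHomeomorph M (EuclideanSpace ℝ (Fin 3))) :
    IsOpen (vRange φ) := by
  refine isOpen_iff_mem_nhds.2 ?_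
  rintro _ ⟨y, hy, rfl⟩
  have hc : Continuous fun t : ℝ =>
      y + t • (EuclideanSpace.single 1 1 : EuclideanSpace ℝ (Fin 3)) := by fun_prop
  have hc' : Continuous fun v : ℝ => v - y 1 := by fun_prop
  have ho := φ.open_target.preimage (hc.comp hc')
  refine Filter.mem_of_superset (ho.mem_nhds (by simpa using hy)) fun v hv => ⟨_, hv, ?_⟩
  simp

theorem mem_vRange (hy : y ∈ φ.target) : y 1 ∈ vRange φ := ⟨y, hy, rfl⟩

theorem contDiffAt_of_vRange {a : ℝ → ℝ} (ha : ContDiffOn ℝ ∞ a (vRange φ)) (hy : y ∈ φ.target) :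
    ContDiffAt ℝ ∞ a (y 1) :=
  ha.contDiffAt ((isOpen_vRange φ).mem_nhds (mem_vRange hy))

/-- Smoothness of the coefficient needs no assumption on `F`: on the chart it is a component of a
smooth metric. -/
theorem IsPPChart.isBrinkmannChart (hF : IsPPChart g φ F) :
    g.IsBrinkmannChart φ (fun z => F (z 1) (z 2)) := by
  refine ⟨hF.1, hF.2, fun y hy => ?_⟩
  have hev : ∀ᶠ z in 𝓝 y, z ∈ φ.target := φ.open_target.mem_nhds hy
  refine pd_zero_of_eventually_eq (F := F) ?_ (Filter.Eventually.of_forall fun _ => rfl)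
  refine ((g.contDiffAt_mat hF.1 hy 1 1).congr_of_eventuallyEq ?_).diff
  filter_upwards [hev] with z hz
  rw [hF.2 z hz]
  rfl

namespace LorentzMetric.IsBrinkmannChart

section AffineDensity

variable {c : ℝ} {γ : ℝ → ℝ}
  (hγ : ContDiffOn ℝ ∞ γ (vRange φ)) (hh : ∀ y ∈ φ.target, h (φ.symm y) = c * y 2 + γ (y 1))

include hγ hh

theorem pd_affine (hy : y ∈ φ.target) (i : Fin 3) : pd i (h ∘ φ.symm) y =
    c * (if i = 2 then 1 else 0) + (if i = 1 then deriv γ (y 1) else 0) := by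
  have hd := (contDiffAt_of_vRange hγ hy).diff
  have hc : ∀ i : Fin 3, DifferentiableAt ℝ (fun z : EuclideanSpace ℝ (Fin 3) => z i) y :=
    fun i => (contDiff_coord i).contDiffAt.diff
  have hd' : DifferentiableAt ℝ (fun z : EuclideanSpace ℝ (Fin 3) => γ (z 1)) y :=
    hd.comp y (hc 1)
  rw [pd_congr (f := h ∘ φ.symm) (f' := fun z => c * z 2 + γ (z 1)) ((eventually_mem hy).mono hh),
    pd_add ((hc 2).const_mul c) hd', pd_const_mul _ (hc 2), pd_coord, pd_comp_coord hd]
  simp only [eq_comm]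

theorem pd_pd_affine (hy : y ∈ φ.target) (i j : Fin 3) : pd i (pd j (h ∘ φ.symm)) y =
    if i = 1 ∧ j = 1 then deriv (deriv γ) (y 1) else 0 := by
  have hd := (contDiffAt_deriv (contDiffAt_of_vRange hγ hy)).diff
  rw [pd_congr ((eventually_mem hy).mono fun z hz => pd_affine hγ hh hz j)]
  by_cases hj : j = 1
  · subst hj
    simp only [show (1 : Fin 3) ≠ 2 by decide, if_false, mul_zero, zero_add, if_true, and_true]
    rw [pd_comp_coord hd]
    simp only [eq_comm]
  · simp [hj, pd_const]

/-- If the density is affine in `x`, the vacuum equation is one ordinary equation. -/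
theorem weightedEinstein_affine (hB : g.IsBrinkmannChart φ f)
    (hs : ContMDiff (𝓡 3) 𝓘(ℝ, ℝ) ∞ h) (hy : y ∈ φ.target)
    (he : deriv (deriv γ) (y 1) + pd 2 f y / 2 * c = -h (φ.symm y) * pd 2 (pd 2 f) y / 2)
    (i j : Fin 3) : g.weightedEinstein φ h 0 i j y = 0 := by
  revert i j
  rw [hB.weightedEinstein_eq_zero_iff hs 0 hy]
  simp only [pd_pd_affine hγ hh hy, pd_affine hγ hh hy]
  simpa using he

theorem val_grad_affine (hB : g.IsBrinkmannChart φ f)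
    (hs : ContMDiff (𝓡 3) 𝓘(ℝ, ℝ) ∞ h) {p : M} (hp : p ∈ φ.source) :
    g.val p (g.grad h p) (g.grad h p) = c ^ 2 := by
  rw [hB.val_grad_grad hs hp]
  simp [pd_affine hγ hh (φ.map_source hp)]

end AffineDensity

end LorentzMetric.IsBrinkmannChart

section PlaneWaveChart

variable {α : ℝ → ℝ} (hP : IsPlaneWaveChart g h φ α)

include hP

theorem IsPlaneWaveChart.isBrinkmannChart : g.IsBrinkmannChart φ
    (fun z => -(deriv (deriv α) (z 1) / α (z 1)) * z 2 ^ 2) := hP.2.1.isBrinkmannChart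

theorem IsPlaneWaveChart.pd_two (hy : y ∈ φ.target) :
    pd 2 (fun z => -(deriv (deriv α) (z 1) / α (z 1)) * z 2 ^ 2) y =
      -(deriv (deriv α) (y 1) / α (y 1)) * (2 * y 2) := by
  refine pd_two_of_eventually_eq (hP.isBrinkmannChart.contDiffAt hy).diff
    (F := fun v x => -(deriv (deriv α) v / α v) * x ^ 2) (Filter.Eventually.of_forall fun _ => rfl) ?_
  simpa using (hasDerivAt_pow 2 (y 2)).const_mul (-(deriv (deriv α) (y 1) / α (y 1)))

theorem IsPlaneWaveChart.pd_two_two (hy : y ∈ φ.target) :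
    pd 2 (pd 2 (fun z => -(deriv (deriv α) (z 1) / α (z 1)) * z 2 ^ 2)) y =
      -(deriv (deriv α) (y 1) / α (y 1)) * 2 := by
  refine pd_two_of_eventually_eq
    (LorentzMetric.contDiffAt_pd (hP.isBrinkmannChart.contDiffAt hy) 2).diff
    (F := fun v x => -(deriv (deriv α) v / α v) * (2 * x))
    ((LorentzMetric.IsBrinkmannChart.eventually_mem hy).mono fun z hz => hP.pd_two hz) ?_
  simpa using ((hasDerivAt_id (y 2)).const_mul 2).const_mul (-(deriv (deriv α) (y 1) / α (y 1)))

theorem IsPlaneWaveChart.isFlatAt_iff (hpos : ∀ p, 0 < h p) {q : M} (hq : q ∈ φ.source) :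
    g.IsFlatAt q ↔ deriv (deriv α) (φ q 1) = 0 := by
  have hy := φ.map_source hq
  have hα := (hpos (φ.symm (φ q))).ne'
  rw [hP.2.2 _ hy] at hα
  rw [hP.isBrinkmannChart.isFlatAt_iff hq, hP.pd_two_two hy]
  simp [hα]

theorem IsPlaneWaveChart.weightedEinstein (hpos : ∀ p, 0 < h p)
    (hs : ContMDiff (𝓡 3) 𝓘(ℝ, ℝ) ∞ h) (hy : y ∈ φ.target) (i j : Fin 3) :
    g.weightedEinstein φ h 0 i j y = 0 := by
  refine LorentzMetric.IsBrinkmannChart.weightedEinstein_affine (c := 0) hP.1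
    (fun z hz => by rw [hP.2.2 z hz, zero_mul, zero_add]) hP.isBrinkmannChart hs hy ?_ i j
  have hα := (hpos (φ.symm y)).ne'
  rw [hP.pd_two_two hy]
  rw [hP.2.2 _ hy] at hα ⊢
  field_simp
  ring

theorem IsPlaneWaveChart.val_grad (hs : ContMDiff (𝓡 3) 𝓘(ℝ, ℝ) ∞ h) {q : M}
    (hq : q ∈ φ.source) : g.val q (g.grad h q) (g.grad h q) = 0 := by
  rw [LorentzMetric.IsBrinkmannChart.val_grad_affine (c := 0) hP.1
    (fun z hz => by rw [hP.2.2 z hz, zero_mul, zero_add]) hP.isBrinkmannChart hs hq]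
  simp

end PlaneWaveChart

section LogWaveChart

/-- The metric coefficient of the solutions with spacelike gradient. -/
def logWave (γ₁ : ℝ) (γ₀ α β : ℝ → ℝ) (v x : ℝ) : ℝ :=
  (γ₁ * α v + 2 * γ₀ v * deriv (deriv γ₀) v) * Real.log (γ₀ v + γ₁ * x) / γ₁ ^ 2
    - 2 * x * deriv (deriv γ₀) v / γ₁ + β v

variable {γ₁ : ℝ} {γ₀ α β : ℝ → ℝ}

theorem hasDerivAt_logWave {v x : ℝ} (hne : γ₀ v + γ₁ * x ≠ 0) (h1 : γ₁ ≠ 0) :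
    HasDerivAt (logWave γ₁ γ₀ α β v)
      ((γ₁ * α v + 2 * γ₀ v * deriv (deriv γ₀) v) / (γ₁ * (γ₀ v + γ₁ * x))
        - 2 * deriv (deriv γ₀) v / γ₁) x := by
  have hl : HasDerivAt (fun x => γ₀ v + γ₁ * x) γ₁ x := by
    simpa using ((hasDerivAt_id x).const_mul γ₁).const_add (γ₀ v)
  have h2 : HasDerivAt (fun x => 2 * x * deriv (deriv γ₀) v / γ₁) (2 * deriv (deriv γ₀) v / γ₁) x :=
    by simpa using ((((hasDerivAt_id x).const_mul 2).mul_const (deriv (deriv γ₀) v)).div_const γ₁)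
  refine HasDerivAt.congr_deriv (((((hl.log hne).const_mul
    (γ₁ * α v + 2 * γ₀ v * deriv (deriv γ₀) v)).div_const (γ₁ ^ 2)).sub h2).add_const (β v)) ?_
  field_simp

variable (hP : IsLogWaveChart g h φ γ₁ γ₀ α β)

include hP

theorem IsLogWaveChart.isBrinkmannChart : g.IsBrinkmannChart φ
    (fun z => logWave γ₁ γ₀ α β (z 1) (z 2)) := hP.2.2.2.2.1.isBrinkmannChart

theorem IsLogWaveChart.affine_ne_zero (hpos : ∀ p, 0 < h p) (hy : y ∈ φ.target) :
    γ₀ (y 1) + γ₁ * y 2 ≠ 0 := by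
  rw [add_comm, ← hP.2.2.2.2.2 y hy]
  exact (hpos _).ne'

theorem IsLogWaveChart.pd_two (hpos : ∀ p, 0 < h p) (hy : y ∈ φ.target) :
    pd 2 (fun z => logWave γ₁ γ₀ α β (z 1) (z 2)) y =
      (γ₁ * α (y 1) + 2 * γ₀ (y 1) * deriv (deriv γ₀) (y 1)) / (γ₁ * (γ₀ (y 1) + γ₁ * y 2))
        - 2 * deriv (deriv γ₀) (y 1) / γ₁ :=
  pd_two_of_eventually_eq (hP.isBrinkmannChart.contDiffAt hy).diff
    (F := logWave γ₁ γ₀ α β) (Filter.Eventually.of_forall fun _ => rfl)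
    (hasDerivAt_logWave (hP.affine_ne_zero hpos hy) hP.1)

theorem IsLogWaveChart.pd_two_two (hpos : ∀ p, 0 < h p) (hy : y ∈ φ.target) :
    pd 2 (pd 2 (fun z => logWave γ₁ γ₀ α β (z 1) (z 2))) y =
      -(γ₁ * α (y 1) + 2 * γ₀ (y 1) * deriv (deriv γ₀) (y 1)) / (γ₀ (y 1) + γ₁ * y 2) ^ 2 := by
  have h1 := hP.1
  have hne := hP.affine_ne_zero hpos hy
  refine pd_two_of_eventually_eq
    (LorentzMetric.contDiffAt_pd (hP.isBrinkmannChart.contDiffAt hy) 2).diff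
    (F := fun v x => (γ₁ * α v + 2 * γ₀ v * deriv (deriv γ₀) v) / (γ₁ * (γ₀ v + γ₁ * x))
        - 2 * deriv (deriv γ₀) v / γ₁)
    ((LorentzMetric.IsBrinkmannChart.eventually_mem hy).mono fun z hz => hP.pd_two hpos hz) ?_
  have hl : HasDerivAt (fun x => γ₁ * (γ₀ (y 1) + γ₁ * x)) (γ₁ * γ₁) (y 2) := by
    simpa using (((hasDerivAt_id (y 2)).const_mul γ₁).const_add (γ₀ (y 1))).const_mul γ₁
  refine HasDerivAt.congr_deriv (((hasDerivAt_const (y 2)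
    (γ₁ * α (y 1) + 2 * γ₀ (y 1) * deriv (deriv γ₀) (y 1))).div hl
    (mul_ne_zero h1 hne)).sub_const (2 * deriv (deriv γ₀) (y 1) / γ₁)) ?_
  field_simp
  ring

theorem IsLogWaveChart.isFlatAt_iff (hpos : ∀ p, 0 < h p) {q : M} (hq : q ∈ φ.source) :
    g.IsFlatAt q ↔ γ₁ * α (φ q 1) + 2 * γ₀ (φ q 1) * deriv (deriv γ₀) (φ q 1) = 0 := by
  have hy := φ.map_source hq
  rw [hP.isBrinkmannChart.isFlatAt_iff hq, hP.pd_two_two hpos hy, div_eq_zero_iff, neg_eq_zero,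
    or_iff_left (pow_ne_zero 2 (hP.affine_ne_zero hpos hy))]

theorem IsLogWaveChart.weightedEinstein (hpos : ∀ p, 0 < h p)
    (hs : ContMDiff (𝓡 3) 𝓘(ℝ, ℝ) ∞ h) (hy : y ∈ φ.target) (i j : Fin 3) :
    g.weightedEinstein φ h 0 i j y = 0 := by
  refine LorentzMetric.IsBrinkmannChart.weightedEinstein_affine hP.2.1 hP.2.2.2.2.2
    hP.isBrinkmannChart hs hy ?_ i j
  have h1 := hP.1
  have hne := hP.affine_ne_zero hpos hy
  rw [hP.pd_two hpos hy, hP.pd_two_two hpos hy, hP.2.2.2.2.2 y hy, add_comm (γ₁ * y 2)]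
  field_simp
  ring

theorem IsLogWaveChart.val_grad (hs : ContMDiff (𝓡 3) 𝓘(ℝ, ℝ) ∞ h) {q : M}
    (hq : q ∈ φ.source) : g.val q (g.grad h q) (g.grad h q) = γ₁ ^ 2 :=
  LorentzMetric.IsBrinkmannChart.val_grad_affine hP.2.1 hP.2.2.2.2.2 hP.isBrinkmannChart hs hq

end LogWaveChart

end LocalForms

namespace LorentzMetric

/-! ### Vacuum solutions: vanishing of Λ and affine density -/

section VacuumSolutions

variable {M : Type*} [TopologicalSpace M]
  [ChartedSpace (EuclideanSpace ℝ (Fin 3)) M] [IsManifold (𝓡 3) ∞ M]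
  {g : LorentzMetric 3 M} {φ : OpenPartialHomeomorph M (EuclideanSpace ℝ (Fin 3))}
  {y : EuclideanSpace ℝ (Fin 3)} {f : EuclideanSpace ℝ (Fin 3) → ℝ} {h : M → ℝ} {Λ : ℝ}
  {V : ∀ p : M, TangentSpace (𝓡 3) p}

/-- Differentiating the vacuum equation along the parallel field. -/
theorem IsBrinkmannChart.pd_zero_mul_eq_zero (hB : g.IsBrinkmannChart φ f)
    (hs : ContMDiff (𝓡 3) 𝓘(ℝ, ℝ) ∞ h) (hE : g.SolvesVacuum h Λ) (hy : y ∈ φ.target) :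
    pd 0 (h ∘ φ.symm) y * pd 2 (pd 2 f) y = 0 := by
  have hev := eventually_mem hy
  have heq := fun z (hz : z ∈ φ.target) =>
    (hB.weightedEinstein_eq_zero_iff hs Λ hz).1 (hE φ hB.isChart z hz)
  have hH := contDiffAt_comp_symm hs hB.isChart hy
  have hf := hB.contDiffAt hy
  set H := h ∘ φ.symm
  have d1 : DifferentiableAt ℝ (pd 1 (pd 1 H)) y :=
    (contDiffAt_pd (contDiffAt_pd hH 1) 1).diff
  have d2 := (contDiffAt_pd hf 1).diff
  have d3 := (contDiffAt_pd hH 0).diff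
  have d4 := (contDiffAt_pd hf 2).diff
  have d5 := (contDiffAt_pd hH 2).diff
  have d6 := hH.diff
  have d7 := (contDiffAt_pd (contDiffAt_pd hf 2) 2).diff
  have d8 := hf.diff
  -- The equation for h_vv with all terms on one side. As f is independent of u and h_uu = h_ux = 0,
  -- its u-derivative reduces to h_uvv + h_u f_xx / 2; the first summand vanishes because h_uv is
  -- constant.
  have hz : pd 0 (fun z => pd 1 (pd 1 H) z + (-1 / 2) * (pd 1 f z * pd 0 H z)
      + (1 / 2) * (pd 2 f z * pd 2 H z) + (1 / 2) * (H z * pd 2 (pd 2 f) z)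
      + Λ / 2 * f z) y = 0 := by
    rw [pd_congr (f' := fun _ => 0), pd_const]
    filter_upwards [hev] with z hz
    have := (heq z hz).2.2.2.2.2
    change _ = -H z * pd 2 (pd 2 f) z / 2 - _ at this
    linear_combination this
  have t1 := (d2.fun_mul d3).const_mul (-1 / 2)
  have t2 := (d4.fun_mul d5).const_mul (1 / 2)
  have t3 := (d6.fun_mul d7).const_mul (1 / 2)
  have t4 := d8.const_mul (Λ / 2)
  have e011 : pd 0 (pd 1 (pd 1 H)) y = 0 := by
    rw [pd_pd_comm (contDiffAt_pd hH 1), pd_congr (hev.mono fun z hz => (heq z hz).2.2.1),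
      pd_const]
  rw [pd_add (((d1.fun_add t1).fun_add t2).fun_add t3) t4, pd_add ((d1.fun_add t1).fun_add t2) t3,
    pd_add (d1.fun_add t1) t2, pd_add d1 t1, pd_const_mul _ (d2.fun_mul d3),
    pd_const_mul _ (d4.fun_mul d5), pd_const_mul _ (d6.fun_mul d7), pd_const_mul _ d8,
    pd_mul d2 d3, pd_mul d4 d5, pd_mul d6 d7, e011, (heq y hy).1, (heq y hy).2.1,
    hB.pd_zero_pd hy, hB.pd_zero_pd hy, hB.pd_zero_pd_pd hy, hB.pd_zero y hy] at hz
  linear_combination 2 * hz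

/-- Brinkmann coordinates for a vacuum solution: the density is `c x + γ(v)`. -/
structure IsSolutionChart (g : LorentzMetric 3 M) (h : M → ℝ)
    (φ : OpenPartialHomeomorph M (EuclideanSpace ℝ (Fin 3)))
    (f : EuclideanSpace ℝ (Fin 3) → ℝ) (r c : ℝ) : Prop extends g.IsBrinkmannChart φ f where
  pos : 0 < r
  target_eq : φ.target = Metric.ball 0 r
  pd_zero_density : ∀ y ∈ φ.target, pd 0 (h ∘ φ.symm) y = 0
  pd_two_density : ∀ y ∈ φ.target, pd 2 (h ∘ φ.symm) y = c
  vacuum : ∀ y ∈ φ.target, pd 1 (pd 1 (h ∘ φ.symm)) y + pd 2 f y / 2 * c =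
    -h (φ.symm y) * pd 2 (pd 2 f) y / 2

theorem IsPPField.exists_isBrinkmannChart (hV : g.IsPPField V) (p : M) :
    ∃ (ψ : OpenPartialHomeomorph M (EuclideanSpace ℝ (Fin 3))) (r : ℝ)
      (f : EuclideanSpace ℝ (Fin 3) → ℝ), g.IsBrinkmannChart ψ f ∧ 0 < r ∧
      p ∈ ψ.source ∧ ψ p = 0 ∧ ψ.target = Metric.ball 0 r ∧
      ∀ z ∈ ψ.target, vecCoord ψ V z = EuclideanSpace.single 0 1 := by
  obtain ⟨ψ, r, hψ, hr, hp, hp0, ht, hz⟩ := hV.exists_brinkmann_chart p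
  exact ⟨ψ, r, fun z => g.mat ψ z 1 1,
    ⟨hψ, fun z hz' => (hz z hz').2.1, fun z hz' => (hz z hz').2.2⟩, hr, hp, hp0, ht,
    fun z hz' => (hz z hz').1⟩

/-- At a point of nonzero curvature f_xx ≠ 0 persists nearby, so h_u = 0 on a neighbourhood. Hence
h_uv = 0 at the point, while the field equation gives h_uv = -Λ/2. -/
theorem IsPPField.cosmological_eq_zero (hV : g.IsPPField V) (hs : ContMDiff (𝓡 3) 𝓘(ℝ, ℝ) ∞ h)
    (hE : g.SolvesVacuum h Λ) (hnf : ¬ g.IsFlat) : Λ = 0 := by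
  simp only [IsFlat, not_forall] at hnf
  obtain ⟨p, hp⟩ := hnf
  obtain ⟨ψ, r, f, hB, -, hpψ, -, -, -⟩ := hV.exists_isBrinkmannChart p
  have hy := ψ.map_source hpψ
  rw [hB.isFlatAt_iff hpψ] at hp
  have hH := contDiffAt_comp_symm hs hB.isChart hy
  have h0 : pd 0 (h ∘ ψ.symm) =ᶠ[𝓝 (ψ p)] fun _ => 0 := by
    have hc := (contDiffAt_pd (contDiffAt_pd (hB.contDiffAt hy) 2) 2).continuousAt
    filter_upwards [IsBrinkmannChart.eventually_mem hy, hc.eventually_ne hp] with z hz hz'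
    exact (mul_eq_zero.1 (hB.pd_zero_mul_eq_zero hs hE hz)).resolve_right hz'
  have h10 : pd 1 (pd 0 (h ∘ ψ.symm)) (ψ p) = 0 := by rw [pd_congr h0, pd_const]
  have h01 := ((hB.weightedEinstein_eq_zero_iff hs Λ hy).1 (hE ψ hB.isChart _ hy)).2.2.1
  rw [pd_pd_comm hH, h10] at h01
  linarith

/-- For Λ = 0 the equations annihilate all partial derivatives of h_u = dh(V). This function is
defined without coordinates, so it is constant on M, and it vanishes at a non-flat point. Thus one
non-flat point controls the density on flat regions too. -/
theorem IsPPField.mfderiv_density_eq_zero [ConnectedSpace M] (hV : g.IsPPField V)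
    (hs : ContMDiff (𝓡 3) 𝓘(ℝ, ℝ) ∞ h) (hE : g.SolvesVacuum h 0) (hnf : ¬ g.IsFlat) (p : M) :
    (mfderiv (𝓡 3) 𝓘(ℝ, ℝ) h p (V p) : ℝ) = 0 := by
  have hval : ∀ {ψ : OpenPartialHomeomorph M (EuclideanSpace ℝ (Fin 3))}, IsChart ψ →
      (∀ z ∈ ψ.target, vecCoord ψ V z = EuclideanSpace.single 0 1) → ∀ q ∈ ψ.source,
      (mfderiv (𝓡 3) 𝓘(ℝ, ℝ) h q (V q) : ℝ) = pd 0 (h ∘ ψ.symm) (ψ q) := by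
    intro ψ hψ hv q hq
    have := fderiv_vecCoord hs hψ (ψ.map_source hq) V
    rw [ψ.left_inv hq, hv _ (ψ.map_source hq)] at this
    exact this.symm
  obtain ⟨c, hc⟩ := exists_eq_const_of_forall_chart (n := 3) (M := M)
    (F := fun p => mfderiv (𝓡 3) 𝓘(ℝ, ℝ) h p (V p)) fun p => by
      obtain ⟨ψ, r, f, hB, hr, hpψ, hp0, ht, hv⟩ := hV.exists_isBrinkmannChart p
      refine ⟨ψ, hpψ, pd 0 (h ∘ ψ.symm) 0, fun q hq => ?_⟩
      rw [hval hB.isChart hv q hq]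
      have hH := fun y (hy : y ∈ Metric.ball 0 r) =>
        contDiffAt_comp_symm hs hB.isChart (ht ▸ hy : y ∈ ψ.target)
      refine eq_const_of_pd_eq_zero (r := r) (fun y hy => (contDiffAt_pd (hH y hy) 0).diff)
        (fun i y hy => ?_) (ht ▸ ψ.map_source hq) (Metric.mem_ball_self hr)
      have hy' : y ∈ ψ.target := ht ▸ hy
      have heq := (hB.weightedEinstein_eq_zero_iff hs 0 hy').1 (hE ψ hB.isChart y hy')
      fin_cases i
      · exact heq.1
      · change pd 1 (pd 0 _) y = 0
        rw [pd_pd_comm (hH y hy), heq.2.2.1]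
        norm_num
      · change pd 2 (pd 0 _) y = 0
        rw [pd_pd_comm (hH y hy), heq.2.1]
  simp only [IsFlat, not_forall] at hnf
  obtain ⟨p₀, hp₀⟩ := hnf
  obtain ⟨ψ, r, f, hB, -, hpψ, -, -, hv⟩ := hV.exists_isBrinkmannChart p₀
  rw [hB.isFlatAt_iff hpψ] at hp₀
  have h0 := (mul_eq_zero.1 (hB.pd_zero_mul_eq_zero hs hE (ψ.map_source hpψ))).resolve_right hp₀
  have e := hval hB.isChart hv p₀ hpψ
  rw [h0] at e
  exact (hc p).trans ((hc p₀).symm.trans e)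

/-- Once h_u = 0, the remaining second-order equations say that all derivatives of h_x vanish. On
the ball, which is convex, h_x is a constant, namely its value at the centre. -/
theorem IsPPField.exists_isSolutionChart [ConnectedSpace M] (hV : g.IsPPField V)
    (hs : ContMDiff (𝓡 3) 𝓘(ℝ, ℝ) ∞ h) (hE : g.SolvesVacuum h 0) (hnf : ¬ g.IsFlat) (p : M) :
    ∃ (ψ : OpenPartialHomeomorph M (EuclideanSpace ℝ (Fin 3)))
      (f : EuclideanSpace ℝ (Fin 3) → ℝ) (r c : ℝ), g.IsSolutionChart h ψ f r c ∧
      p ∈ ψ.source ∧ ψ p = 0 ∧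
      ∀ z ∈ ψ.target, vecCoord ψ V z = EuclideanSpace.single 0 1 := by
  obtain ⟨ψ, r, f, hB, hr, hpψ, hp0, ht, hv⟩ := hV.exists_isBrinkmannChart p
  have heq := fun z (hz : z ∈ ψ.target) =>
    (hB.weightedEinstein_eq_zero_iff hs 0 hz).1 (hE ψ hB.isChart z hz)
  have h0 : ∀ y ∈ ψ.target, pd 0 (h ∘ ψ.symm) y = 0 := fun y hy => by
    have := fderiv_vecCoord hs hB.isChart hy V
    rw [hv y hy, hV.mfderiv_density_eq_zero hs hE hnf] at this
    exact this
  have h2 : ∀ y ∈ ψ.target, pd 2 (h ∘ ψ.symm) y = pd 2 (h ∘ ψ.symm) 0 := fun y hy => by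
    refine eq_const_of_pd_eq_zero (r := r) (fun y hy => (contDiffAt_pd
      (contDiffAt_comp_symm hs hB.isChart (ht ▸ hy : y ∈ ψ.target)) 2).diff)
      (fun i y hy => ?_) (ht ▸ hy) (Metric.mem_ball_self hr)
    have hy' : y ∈ ψ.target := ht ▸ hy
    fin_cases i
    · exact (heq y hy').2.1
    · have := (heq y hy').2.2.2.2.1
      rwa [h0 y hy', mul_zero] at this
    · have := (heq y hy').2.2.2.1
      rwa [neg_zero, zero_div] at this
  refine ⟨ψ, f, r, pd 2 (h ∘ ψ.symm) 0, ⟨hB, hr, ht, h0, h2, fun y hy => ?_⟩, hpψ, hp0, hv⟩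
  have := (heq y hy).2.2.2.2.2
  rw [h0 y hy, h2 y hy] at this
  linear_combination this

theorem IsSolutionChart.val_grad {r c : ℝ} (hS : g.IsSolutionChart h φ f r c)
    (hs : ContMDiff (𝓡 3) 𝓘(ℝ, ℝ) ∞ h) {q : M} (hq : q ∈ φ.source) :
    g.val q (g.grad h q) (g.grad h q) = c ^ 2 := by
  rw [hS.val_grad_grad hs hq, hS.pd_zero_density _ (φ.map_source hq),
    hS.pd_two_density _ (φ.map_source hq)]
  ring

/-- The gradient of the density has constant length. -/
theorem IsPPField.exists_val_grad_eq [ConnectedSpace M] (hV : g.IsPPField V)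
    (hs : ContMDiff (𝓡 3) 𝓘(ℝ, ℝ) ∞ h) (hE : g.SolvesVacuum h 0) (hnf : ¬ g.IsFlat) :
    ∃ k : ℝ, ∀ p, g.val p (g.grad h p) (g.grad h p) = k :=
  exists_eq_const_of_forall_chart fun p => by
    obtain ⟨ψ, f, r, c, hS, hp, -, -⟩ := hV.exists_isSolutionChart hs hE hnf p
    exact ⟨ψ, hp, c ^ 2, fun q hq => hS.val_grad hs hq⟩

end VacuumSolutions

end LorentzMetric

/-! ### Ordinary differential equations for the plane wave coordinates -/

section OrdinaryDifferentialEquations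

open Set

/-- Bootstrapping: if `X` is of class Cⁿ, then so is its derivative `G ∘ X`, hence `X` is of class
Cⁿ⁺¹. -/
theorem contDiffOn_of_hasDerivAt_autonomous {E : Type*} [NormedAddCommGroup E] [NormedSpace ℝ E]
    {G : E → E} {O : Set E} (hG : ContDiffOn ℝ ∞ G O) {X : ℝ → E} {s : Set ℝ} (hs : IsOpen s)
    (hX : ∀ t ∈ s, HasDerivAt X (G (X t)) t) (hO : MapsTo X s O) : ContDiffOn ℝ ∞ X s := by
  rw [contDiffOn_infty]
  intro n
  induction n with
  | zero =>
    exact contDiffOn_zero.2 fun t ht => (hX t ht).continuousAt.continuousWithinAt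
  | succ n ih =>
    push_cast
    rw [contDiffOn_succ_iff_deriv_of_isOpen hs]
    refine ⟨fun t ht => (hX t ht).differentiableAt.differentiableWithinAt, fun h => ?_, ?_⟩
    · exact absurd h (WithTop.coe_ne_top)
    · refine ContDiffOn.congr ?_ fun t ht => (hX t ht).deriv
      exact (contDiffOn_infty.1 hG n).comp ih hO

/-- The ordinary differential equations of a change of coordinates along the axis of a plane
wave. -/
theorem exists_plane_wave_shift {r : ℝ} (hr : 0 < r) {a b c : ℝ → ℝ}
    (ha : ContDiffOn ℝ ∞ a (Ioo (-r) r)) (hb : ContDiffOn ℝ ∞ b (Ioo (-r) r))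
    (hc : ContDiffOn ℝ ∞ c (Ioo (-r) r)) :
    ∃ ε > 0, ε ≤ r ∧ ∃ p q s : ℝ → ℝ, p 0 = 0 ∧ q 0 = 0 ∧ s 0 = 0 ∧
      ContDiffOn ℝ ∞ p (Ioo (-ε) ε) ∧ ContDiffOn ℝ ∞ q (Ioo (-ε) ε) ∧
      ContDiffOn ℝ ∞ s (Ioo (-ε) ε) ∧ ∀ t ∈ Ioo (-ε) ε, HasDerivAt p (q t) t ∧
        HasDerivAt q (b t / 2 - c t * p t) t ∧
        HasDerivAt s ((q t ^ 2 - c t * p t ^ 2 + b t * p t + a t) / 2) t := by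
  let O : Set (ℝ × ℝ × ℝ × ℝ) := Prod.fst ⁻¹' Ioo (-r) r
  -- Time is adjoined as the first component to make the system autonomous; the others are `p`, `q`
  -- and `s`.
  let G : ℝ × ℝ × ℝ × ℝ → ℝ × ℝ × ℝ × ℝ := fun x =>
    (1, x.2.2.1, b x.1 / 2 - c x.1 * x.2.1,
      (x.2.2.1 ^ 2 - c x.1 * x.2.1 ^ 2 + b x.1 * x.2.1 + a x.1) / 2)
  have hO : IsOpen O := isOpen_Ioo.preimage continuous_fst
  have hG : ContDiffOn ℝ ∞ G O := by
    have h1 : ContDiffOn ℝ ∞ (Prod.fst : ℝ × ℝ × ℝ × ℝ → ℝ) O := contDiff_fst.contDiffOn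
    have ha' : ContDiffOn ℝ ∞ (fun x : ℝ × ℝ × ℝ × ℝ => a x.1) O := ha.comp h1 fun x hx => hx
    have hb' : ContDiffOn ℝ ∞ (fun x : ℝ × ℝ × ℝ × ℝ => b x.1) O := hb.comp h1 fun x hx => hx
    have hc' : ContDiffOn ℝ ∞ (fun x : ℝ × ℝ × ℝ × ℝ => c x.1) O := hc.comp h1 fun x hx => hx
    have hp : ContDiffOn ℝ ∞ (fun x : ℝ × ℝ × ℝ × ℝ => x.2.1) O := by fun_prop
    have hq : ContDiffOn ℝ ∞ (fun x : ℝ × ℝ × ℝ × ℝ => x.2.2.1) O := by fun_prop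
    exact contDiffOn_const.prodMk (hq.prodMk (((hb'.div_const 2).sub (hc'.mul hp)).prodMk
      (((((hq.pow 2).sub (hc'.mul (hp.pow 2))).add (hb'.mul hp)).add ha').div_const 2)))
  have h0 : (0 : ℝ × ℝ × ℝ × ℝ) ∈ O := ⟨neg_lt_zero.2 hr, hr⟩
  obtain ⟨X, hX0, ε₀, hε₀, hX⟩ :=
    ((hG.contDiffAt (hO.mem_nhds h0)).of_le
      (by simp : (1 : WithTop ℕ∞) ≤ ∞)).exists_forall_mem_closedBall_exists_eq_forall_mem_Ioo_hasDerivAt₀ 0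
  rw [zero_sub, zero_add] at hX
  have hd1 : ∀ t ∈ Ioo (-ε₀) ε₀, HasDerivAt (fun t => (X t).1) 1 t := fun t ht => (hX t ht).fst
  -- The first component has derivative 1 and starts at 0, so it is time, and the original
  -- non-autonomous equations are recovered.
  have ht1 : ∀ t ∈ Ioo (-ε₀) ε₀, (X t).1 = t := by
    intro t ht
    have hdd : ∀ t ∈ Ioo (-ε₀) ε₀, HasDerivAt (fun t => (X t).1 - t) 0 t := fun t ht =>
      ((hd1 t ht).fun_sub (hasDerivAt_id' t)).congr_deriv (sub_self 1)
    have h0' : (0 : ℝ) ∈ Ioo (-ε₀) ε₀ := ⟨neg_lt_zero.2 hε₀, hε₀⟩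
    have := isOpen_Ioo.is_const_of_deriv_eq_zero isPreconnected_Ioo
      (fun t ht => (hdd t ht).differentiableAt.differentiableWithinAt)
      (fun t ht => (hdd t ht).deriv) ht h0'
    simp only [hX0, Prod.fst_zero, sub_zero] at this
    exact sub_eq_zero.1 this
  have hsub : Ioo (-(min ε₀ r)) (min ε₀ r) ⊆ Ioo (-ε₀) ε₀ ∩ Ioo (-r) r := fun t ht =>
    ⟨⟨(neg_le_neg (min_le_left _ _)).trans_lt ht.1, ht.2.trans_le (min_le_left _ _)⟩,
      ⟨(neg_le_neg (min_le_right _ _)).trans_lt ht.1, ht.2.trans_le (min_le_right _ _)⟩⟩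
  have hXs : ContDiffOn ℝ ∞ X (Ioo (-(min ε₀ r)) (min ε₀ r)) :=
    contDiffOn_of_hasDerivAt_autonomous hG isOpen_Ioo (fun t ht => hX t (hsub ht).1) fun t ht => by
      change (X t).1 ∈ Ioo (-r) r
      rw [ht1 t (hsub ht).1]
      exact (hsub ht).2
  refine ⟨min ε₀ r, lt_min hε₀ hr, min_le_right _ _, fun t => (X t).2.1, fun t => (X t).2.2.1,
    fun t => (X t).2.2.2, by simp [hX0], by simp [hX0], by simp [hX0], hXs.snd.fst,
    hXs.snd.snd.fst, hXs.snd.snd.snd, fun t ht => ?_⟩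
  have := hX t (hsub ht).1
  have e := ht1 t (hsub ht).1
  refine ⟨this.snd.fst, ?_, ?_⟩
  · have h := this.snd.snd.fst
    simp only [G, e] at h
    exact h
  · have h := this.snd.snd.snd
    simp only [G, e] at h
    exact h

end OrdinaryDifferentialEquations

namespace LorentzMetric

/-! ### Integration of the vacuum equation: spacelike gradient -/

section SolutionCharts

variable {M : Type*} [TopologicalSpace M]
  [ChartedSpace (EuclideanSpace ℝ (Fin 3)) M] [IsManifold (𝓡 3) ∞ M]
  {g : LorentzMetric 3 M} {φ : OpenPartialHomeomorph M (EuclideanSpace ℝ (Fin 3))}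
  {y : EuclideanSpace ℝ (Fin 3)} {f : EuclideanSpace ℝ (Fin 3) → ℝ} {h : M → ℝ} {r c : ℝ}

theorem IsSolutionChart.mem_ball (hS : g.IsSolutionChart h φ f r c) (hy : y ∈ φ.target) :
    y ∈ Metric.ball (0 : EuclideanSpace ℝ (Fin 3)) r := hS.target_eq ▸ hy

theorem IsSolutionChart.mem_target (hS : g.IsSolutionChart h φ f r c)
    (hy : y ∈ Metric.ball (0 : EuclideanSpace ℝ (Fin 3)) r) : y ∈ φ.target := hS.target_eq ▸ hy

theorem vRange_subset_Ioo (ht : φ.target ⊆ Metric.ball 0 r) : vRange φ ⊆ Set.Ioo (-r) r := by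
  rintro _ ⟨y, hy, rfl⟩
  exact coord_mem_Ioo (ht hy) 1

theorem IsSolutionChart.vRange_subset (hS : g.IsSolutionChart h φ f r c) :
    vRange φ ⊆ Set.Ioo (-r) r := vRange_subset_Ioo hS.target_eq.subset

/-- The difference h - c x has vanishing u- and x-derivatives, so it equals its restriction to the
axis, which is smooth in v. -/
theorem IsSolutionChart.exists_density_eq (hS : g.IsSolutionChart h φ f r c)
    (hs : ContMDiff (𝓡 3) 𝓘(ℝ, ℝ) ∞ h) :
    ∃ γ : ℝ → ℝ, ContDiffOn ℝ ∞ γ (Set.Ioo (-r) r) ∧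
      ∀ y ∈ φ.target, h (φ.symm y) = c * y 2 + γ (y 1) := by
  have hH := fun y (hy : y ∈ Metric.ball 0 r) =>
    contDiffAt_comp_symm hs hS.isChart (hS.mem_target hy)
  have hc2 : ∀ y : EuclideanSpace ℝ (Fin 3), ContDiffAt ℝ ∞
      (fun z : EuclideanSpace ℝ (Fin 3) => c * z 2) y := fun y =>
    (contDiff_const.mul (contDiff_coord 2)).contDiffAt
  have hpd : ∀ y (hy : y ∈ Metric.ball 0 r) (i : Fin 3),
      pd i (fun z => (h ∘ φ.symm) z - c * z 2) y =
        pd i (h ∘ φ.symm) y - c * if 2 = i then 1 else 0 := fun y hy i => by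
    rw [pd_sub (hH y hy).diff (hc2 y).diff, pd_const_mul _ (contDiff_coord 2).contDiffAt.diff,
      pd_coord]
  refine ⟨fun v => (h ∘ φ.symm) (axisPt v) - c * axisPt v 2,
    contDiffOn_comp_axisPt (f := fun z => (h ∘ φ.symm) z - c * z 2)
      fun y hy => (hH y hy).sub (hc2 y), fun y hy => ?_⟩
  have := eq_comp_axisPt (f := fun z => (h ∘ φ.symm) z - c * z 2)
    (fun y hy => ((hH y hy).sub (hc2 y)).diff)
    (fun y hy => by rw [hpd y hy, hS.pd_zero_density y (hS.mem_target hy)]; simp)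
    (fun y hy => by rw [hpd y hy, hS.pd_two_density y (hS.mem_target hy)]; simp) (hS.mem_ball hy)
  simp only [Function.comp_apply] at this ⊢
  linear_combination this

theorem IsSolutionChart.vacuum_affine {γ : ℝ → ℝ} (hS : g.IsSolutionChart h φ f r c)
    (hγ : ContDiffOn ℝ ∞ γ (Set.Ioo (-r) r))
    (hh : ∀ y ∈ φ.target, h (φ.symm y) = c * y 2 + γ (y 1)) (hy : y ∈ φ.target) :
    deriv (deriv γ) (y 1) + pd 2 f y / 2 * c = -h (φ.symm y) * pd 2 (pd 2 f) y / 2 := by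
  rw [← hS.vacuum y hy, IsBrinkmannChart.pd_pd_affine (hγ.mono hS.vRange_subset) hh hy]
  simp

/-- As h_x = c, twice the vacuum equation is the x-derivative of h f_x + 2 γ'' x. This quantity is
therefore a function α(v), so f_x = (α - 2 γ'' x)/(c x + γ); partial fractions and a second
integration give the logarithmic form, with β as the constant of integration. -/
theorem IsSolutionChart.exists_isLogWaveChart (hS : g.IsSolutionChart h φ f r c) (hc : c ≠ 0)
    (hs : ContMDiff (𝓡 3) 𝓘(ℝ, ℝ) ∞ h) (hpos : ∀ p, 0 < h p) :
    ∃ γ₀ α β : ℝ → ℝ, IsLogWaveChart g h φ c γ₀ α β := by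
  obtain ⟨γ, hγ, hh⟩ := hS.exists_density_eq hs
  have htb := fun {y} (hy : y ∈ Metric.ball 0 r) => hS.mem_target hy
  have hIoo : ∀ {y : EuclideanSpace ℝ (Fin 3)}, y ∈ Metric.ball 0 r → y 1 ∈ Set.Ioo (-r) r :=
    fun hy => coord_mem_Ioo hy 1
  have hcomp : ∀ {a : ℝ → ℝ}, ContDiffOn ℝ ∞ a (Set.Ioo (-r) r) → ∀ y ∈ Metric.ball 0 r,
      ContDiffAt ℝ ∞ (fun z : EuclideanSpace ℝ (Fin 3) => a (z 1)) y := fun ha y hy =>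
    (ha.contDiffAt (isOpen_Ioo.mem_nhds (hIoo hy))).comp y (contDiff_coord 1).contDiffAt
  have hγ2 : ContDiffOn ℝ ∞ (deriv (deriv γ)) (Set.Ioo (-r) r) := fun v hv =>
    (contDiffAt_deriv (contDiffAt_deriv
      (hγ.contDiffAt (isOpen_Ioo.mem_nhds hv)))).contDiffWithinAt
  have hpdc : ∀ {a : ℝ → ℝ}, ContDiffOn ℝ ∞ a (Set.Ioo (-r) r) → ∀ y ∈ Metric.ball 0 r,
      ∀ i : Fin 3, i ≠ 1 → pd i (fun z : EuclideanSpace ℝ (Fin 3) => a (z 1)) y = 0 :=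
    fun ha y hy i hi => by
      rw [pd_comp_coord (ha.contDiffAt (isOpen_Ioo.mem_nhds (hIoo hy))).diff, if_neg hi.symm]
  have hH := fun y (hy : y ∈ Metric.ball 0 r) => contDiffAt_comp_symm hs hS.isChart (htb hy)
  have hf2 := fun y (hy : y ∈ Metric.ball 0 r) => contDiffAt_pd (hS.contDiffAt (htb hy)) 2
  have hx : ∀ y : EuclideanSpace ℝ (Fin 3), ContDiffAt ℝ ∞
    (fun z : EuclideanSpace ℝ (Fin 3) => z 2) y := fun y => (contDiff_coord 2).contDiffAt
  -- The first integral h f_x + 2 γ'' x; its values on the axis define α.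
  let A : EuclideanSpace ℝ (Fin 3) → ℝ := fun z =>
    pd 2 f z * (h ∘ φ.symm) z + 2 * (deriv (deriv γ) (z 1) * z 2)
  have hA : ∀ y ∈ Metric.ball 0 r, ContDiffAt ℝ ∞ A y := fun y hy =>
    ((hf2 y hy).mul (hH y hy)).add (contDiffAt_const.mul ((hcomp hγ2 y hy).mul (hx y)))
  have hpdA : ∀ y ∈ Metric.ball 0 r, ∀ i : Fin 3, i ≠ 1 → pd i A y =
      pd 2 f y * pd i (h ∘ φ.symm) y + (h ∘ φ.symm) y * pd i (pd 2 f) y +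
        2 * (deriv (deriv γ) (y 1) * if 2 = i then 1 else 0) := fun y hy i hi => by
    have d1 := (hf2 y hy).diff
    have d2 := (hH y hy).diff
    have d3 := (hcomp hγ2 y hy).diff
    have d4 := (hx y).diff
    rw [pd_add (d1.fun_mul d2) ((d3.fun_mul d4).const_mul 2), pd_mul d1 d2,
      pd_const_mul _ (d3.fun_mul d4), pd_mul d3 d4, pd_coord, hpdc hγ2 y hy i hi]
    ring
  have hAax : ∀ y ∈ Metric.ball 0 r, A y = A (axisPt (y 1)) := fun y hy => by
    refine eq_comp_axisPt (fun y hy => (hA y hy).diff) (fun y hy => ?_) (fun y hy => ?_) hy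
    · rw [hpdA y hy 0 (by decide), hS.pd_zero_density y (htb hy), hS.pd_zero_pd (htb hy)]
      simp
    · rw [hpdA y hy 2 (by decide), hS.pd_two_density y (htb hy), if_pos rfl]
      have := hS.vacuum_affine hγ hh (htb hy)
      rw [Function.comp_apply]
      linear_combination 2 * this
  have hα : ContDiffOn ℝ ∞ (fun v => A (axisPt v)) (Set.Ioo (-r) r) := contDiffOn_comp_axisPt hA
  set α : ℝ → ℝ := fun v => A (axisPt v)
  -- The candidate with β = 0. It has the same u- and x-derivatives as f, so f - K depends on v
  -- alone and supplies β.
  let K : EuclideanSpace ℝ (Fin 3) → ℝ := fun z => logWave c γ α (fun _ => 0) (z 1) (z 2)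
  have hne : ∀ y ∈ Metric.ball (0 : EuclideanSpace ℝ (Fin 3)) r, γ (y 1) + c * y 2 ≠ 0 := fun y hy => by
    rw [add_comm, ← hh y (htb hy)]
    exact (hpos _).ne'
  have hK : ∀ y ∈ Metric.ball 0 r, ContDiffAt ℝ ∞ K y := fun y hy => by
    have d1 := hcomp hγ y hy
    have d2 := hcomp hγ2 y hy
    have d3 := hcomp hα y hy
    exact ((((((contDiffAt_const.mul d3).add ((contDiffAt_const.mul d1).mul d2)).mul
      ((d1.add (contDiffAt_const.mul (hx y))).log (hne y hy))).div_const _).sub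
      (((contDiffAt_const.mul (hx y)).mul d2).div_const _)).add contDiffAt_const)
  have hfK : ∀ y ∈ Metric.ball 0 r, f y - K y = f (axisPt (y 1)) - K (axisPt (y 1)) :=
    fun y hy => by
    refine eq_comp_axisPt (f := fun z => f z - K z)
      (fun y hy => ((hS.contDiffAt (htb hy)).sub (hK y hy)).diff) (fun y hy => ?_)
      (fun y hy => ?_) hy
    · rw [pd_sub (hS.contDiffAt (htb hy)).diff (hK y hy).diff, hS.pd_zero y (htb hy),
        pd_zero_of_eventually_eq (F := logWave c γ α fun _ => 0) (hK y hy).diff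
          (Filter.Eventually.of_forall fun _ => rfl), sub_zero]
    · rw [pd_sub (hS.contDiffAt (htb hy)).diff (hK y hy).diff,
        pd_two_of_eventually_eq (F := logWave c γ α fun _ => 0) (hK y hy).diff
          (Filter.Eventually.of_forall fun _ => rfl) (hasDerivAt_logWave (hne y hy) hc)]
      have e : α (y 1) = pd 2 f y * (c * y 2 + γ (y 1)) + 2 * (deriv (deriv γ) (y 1) * y 2) := by
        rw [← hh y (htb hy)]
        exact (hAax y hy).symm
      have := hne y hy
      rw [e]
      field_simp
      ring
  have hβ : ContDiffOn ℝ ∞ (fun v => f (axisPt v) - K (axisPt v)) (Set.Ioo (-r) r) :=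
    contDiffOn_comp_axisPt (f := fun z => f z - K z)
      fun y hy => (hS.contDiffAt (htb hy)).sub (hK y hy)
  refine ⟨γ, α, fun v => f (axisPt v) - K (axisPt v), hc, hγ.mono hS.vRange_subset,
    hα.mono hS.vRange_subset, hβ.mono hS.vRange_subset, ⟨hS.isChart, fun y hy => ?_⟩, hh⟩
  have e : f y = K y + (f (axisPt (y 1)) - K (axisPt (y 1))) := by
    rw [← hfK y (hS.mem_ball hy)]
    ring
  rw [hS.mat_eq y hy, ppMatrix, e]
  simp [K, logWave]

/-- For c = 0 the vacuum equation reads f_xx = -2 γ''/γ, and the right-hand side depends on v only.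
-/
theorem IsSolutionChart.pd_two_two_two_eq_zero (hS : g.IsSolutionChart h φ f r 0)
    (hs : ContMDiff (𝓡 3) 𝓘(ℝ, ℝ) ∞ h) (hpos : ∀ p, 0 < h p) (hy : y ∈ φ.target) :
    pd 2 (pd 2 (pd 2 f)) y = 0 := by
  obtain ⟨α, hα, hh⟩ := hS.exists_density_eq hs
  refine pd_two_of_eventually_eq
    (contDiffAt_pd (contDiffAt_pd (hS.contDiffAt hy) 2) 2).diff
    (F := fun v _ => -2 * (deriv (deriv α) v / α v)) ?_ (hasDerivAt_const _ _)
  filter_upwards [IsBrinkmannChart.eventually_mem hy] with z hz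
  have := hS.vacuum_affine hα hh hz
  have hne := (hpos (φ.symm z)).ne'
  rw [hh z hz, zero_mul, zero_add] at this hne
  field_simp
  linear_combination 2 * this

end SolutionCharts

end LorentzMetric

namespace LorentzMetric

/-! ### Integration of the vacuum equation: lightlike gradient -/

section PlaneWaveCoordinates

variable {M : Type*} [TopologicalSpace M]
  [ChartedSpace (EuclideanSpace ℝ (Fin 3)) M] [IsManifold (𝓡 3) ∞ M]
  {g : LorentzMetric 3 M} {φ : OpenPartialHomeomorph M (EuclideanSpace ℝ (Fin 3))}
  {y : EuclideanSpace ℝ (Fin 3)} {f : EuclideanSpace ℝ (Fin 3) → ℝ} {h : M → ℝ} {r : ℝ}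

/-- If `∂_x ∂_x f` depends on `v` only, then `f` is a quadratic polynomial in `x`. -/
theorem eq_quadratic_of_pd_two_two {c : ℝ → ℝ} (hc : ContDiffOn ℝ ∞ c (Set.Ioo (-r) r))
    (hf : ∀ y ∈ Metric.ball 0 r, ContDiffAt ℝ ∞ f y)
    (h0 : ∀ y ∈ Metric.ball 0 r, pd 0 f y = 0)
    (h22 : ∀ y ∈ Metric.ball 0 r, pd 2 (pd 2 f) y = -2 * c (y 1))
    (hy : y ∈ Metric.ball (0 : EuclideanSpace ℝ (Fin 3)) r) :
    f y = -c (y 1) * y 2 ^ 2 + pd 2 f (axisPt (y 1)) * y 2 + f (axisPt (y 1)) := by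
  have hcomp : ∀ {a : ℝ → ℝ}, ContDiffOn ℝ ∞ a (Set.Ioo (-r) r) → ∀ y ∈ Metric.ball 0 r,
      ContDiffAt ℝ ∞ (fun z : EuclideanSpace ℝ (Fin 3) => a (z 1)) y := fun ha y hy =>
    (ha.contDiffAt (isOpen_Ioo.mem_nhds (coord_mem_Ioo hy 1))).comp y
      (contDiff_coord 1).contDiffAt
  have hpdc : ∀ {a : ℝ → ℝ}, ContDiffOn ℝ ∞ a (Set.Ioo (-r) r) → ∀ y ∈ Metric.ball 0 r,
      ∀ i : Fin 3, i ≠ 1 → pd i (fun z : EuclideanSpace ℝ (Fin 3) => a (z 1)) y = 0 :=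
    fun ha y hy i hi => by
      rw [pd_comp_coord (ha.contDiffAt (isOpen_Ioo.mem_nhds (coord_mem_Ioo hy 1))).diff,
        if_neg hi.symm]
  have hx : ∀ y : EuclideanSpace ℝ (Fin 3), ContDiffAt ℝ ∞
    (fun z : EuclideanSpace ℝ (Fin 3) => z 2) y := fun y => (contDiff_coord 2).contDiffAt
  have hf2 := fun y (hy : y ∈ Metric.ball 0 r) => contDiffAt_pd (hf y hy) 2
  have h02 : ∀ y ∈ Metric.ball 0 r, pd 0 (pd 2 f) y = 0 := fun y hy => by
    rw [pd_pd_comm (hf y hy), pd_congr (f' := fun _ => 0), pd_const]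
    filter_upwards [Metric.isOpen_ball.mem_nhds hy] with z hz using h0 z hz
  have hb : ContDiffOn ℝ ∞ (fun v => pd 2 f (axisPt v)) (Set.Ioo (-r) r) :=
    contDiffOn_comp_axisPt hf2
  have hpd1 : ∀ y ∈ Metric.ball 0 r, ∀ i : Fin 3, i ≠ 1 →
      pd i (fun z => pd 2 f z + 2 * (c (z 1) * z 2)) y =
        pd i (pd 2 f) y + 2 * (c (y 1) * if 2 = i then 1 else 0) := fun y hy i hi => by
    have d1 := (hcomp hc y hy).diff
    have d2 := (hx y).diff
    rw [pd_add (hf2 y hy).diff ((d1.fun_mul d2).const_mul 2), pd_const_mul _ (d1.fun_mul d2),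
      pd_mul d1 d2, pd_coord, hpdc hc y hy i hi]
    ring
  have key1 : ∀ y ∈ Metric.ball 0 r, pd 2 f y + 2 * (c (y 1) * y 2) = pd 2 f (axisPt (y 1)) :=
    fun y hy => by
    have := eq_comp_axisPt (f := fun z => pd 2 f z + 2 * (c (z 1) * z 2))
      (fun y hy => ((hf2 y hy).add (contDiffAt_const.mul ((hcomp hc y hy).mul (hx y)))).diff)
      (fun y hy => by rw [hpd1 y hy 0 (by decide), h02 y hy]; simp)
      (fun y hy => by rw [hpd1 y hy 2 (by decide), h22 y hy]; simp) hy
    simpa [axisPt] using this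
  have hpd2 : ∀ y ∈ Metric.ball 0 r, ∀ i : Fin 3, i ≠ 1 →
      pd i (fun z => f z + c (z 1) * (z 2 * z 2) - pd 2 f (axisPt (z 1)) * z 2) y =
        pd i f y + (2 * (c (y 1) * y 2) - pd 2 f (axisPt (y 1))) * if 2 = i then 1 else 0 :=
    fun y hy i hi => by
    have d1 := (hcomp hc y hy).diff
    have d2 := (hx y).diff
    have d3 := (hcomp hb y hy).diff
    rw [pd_sub ((hf y hy).diff.fun_add (d1.fun_mul (d2.fun_mul d2))) (d3.fun_mul d2),
      pd_add (hf y hy).diff (d1.fun_mul (d2.fun_mul d2)), pd_mul d1 (d2.fun_mul d2),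
      pd_mul d2 d2, pd_mul d3 d2, pd_coord, hpdc hc y hy i hi, hpdc hb y hy i hi]
    ring
  have := eq_comp_axisPt
    (f := fun z => f z + c (z 1) * (z 2 * z 2) - pd 2 f (axisPt (z 1)) * z 2)
    (fun y hy => (((hf y hy).add ((hcomp hc y hy).mul ((hx y).mul (hx y)))).sub
      ((hcomp hb y hy).mul (hx y))).diff)
    (fun y hy => by rw [hpd2 y hy 0 (by decide), h0 y hy]; simp)
    (fun y hy => by rw [hpd2 y hy 2 (by decide), ← key1 y hy]; simp) hy
  simp [axisPt] at this
  rw [← axisPt] at this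
  linear_combination this

/-- A change of coordinates that moves a curve `x = p(v)` to the axis. -/
def shiftMap (p q s : ℝ → ℝ) (y : EuclideanSpace ℝ (Fin 3)) : EuclideanSpace ℝ (Fin 3) :=
  !₂[y 0 + (q (y 1) * (y 2 - p (y 1)) + s (y 1)), y 1, y 2 - p (y 1)]

section ShiftMap

variable {p q s : ℝ → ℝ} {q' s' : ℝ} (hp : ContDiffAt ℝ ∞ p (y 1)) (hq : ContDiffAt ℝ ∞ q (y 1))
  (hs : ContDiffAt ℝ ∞ s (y 1))

include hp hq hs

theorem contDiffAt_shiftMap : ContDiffAt ℝ ∞ (shiftMap p q s) y := by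
  have hx := fun i : Fin 3 => (contDiff_coord (n := 3) i).contDiffAt (x := y)
  have hp' := hp.comp y (hx 1)
  have hq' := hq.comp y (hx 1)
  have hs' := hs.comp y (hx 1)
  exact contDiffAt_vec3 ((hx 0).add ((hq'.mul ((hx 2).sub hp')).add hs')) (hx 1) ((hx 2).sub hp')

theorem fderiv_shiftMap (hpd : HasDerivAt p (q (y 1)) (y 1)) (hqd : HasDerivAt q q' (y 1))
    (hsd : HasDerivAt s s' (y 1)) (X : EuclideanSpace ℝ (Fin 3)) :
    fderiv ℝ (shiftMap p q s) y X =
      !₂[X 0 + X 1 * (q' * (y 2 - p (y 1)) - q (y 1) ^ 2 + s') + X 2 * q (y 1), X 1,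
        X 2 - q (y 1) * X 1] := by
  have hx := fun i : Fin 3 => ((contDiff_coord (n := 3) i).contDiffAt (x := y)).diff
  have dp : DifferentiableAt ℝ (fun z : EuclideanSpace ℝ (Fin 3) => p (z 1)) y :=
    (hp.comp y (contDiff_coord (n := 3) 1).contDiffAt).diff
  have dq : DifferentiableAt ℝ (fun z : EuclideanSpace ℝ (Fin 3) => q (z 1)) y :=
    (hq.comp y (contDiff_coord (n := 3) 1).contDiffAt).diff
  have ds : DifferentiableAt ℝ (fun z : EuclideanSpace ℝ (Fin 3) => s (z 1)) y :=
    (hs.comp y (contDiff_coord (n := 3) 1).contDiffAt).diff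
  have dx := (hx 2).fun_sub dp
  have e2 : ∀ i : Fin 3, pd i (fun z : EuclideanSpace ℝ (Fin 3) => z 2 - p (z 1)) y =
      (if 2 = i then 1 else 0) - if 1 = i then q (y 1) else 0 := fun i => by
    rw [pd_sub (hx 2) dp, pd_coord, pd_comp_coord hpd.differentiableAt, hpd.deriv]
  have e0 : ∀ i : Fin 3,
      pd i (fun z : EuclideanSpace ℝ (Fin 3) => z 0 + (q (z 1) * (z 2 - p (z 1)) + s (z 1))) y =
      (if 0 = i then 1 else 0) + (q (y 1) * ((if 2 = i then 1 else 0) - if 1 = i then q (y 1) else 0)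
        + (y 2 - p (y 1)) * (if 1 = i then q' else 0) + if 1 = i then s' else 0) := fun i => by
    rw [pd_add (hx 0) ((dq.fun_mul dx).fun_add ds), pd_add (dq.fun_mul dx) ds, pd_mul dq dx,
      e2, pd_coord, pd_comp_coord hqd.differentiableAt, hqd.deriv,
      pd_comp_coord hsd.differentiableAt, hsd.deriv]
  have e := fderiv_vec3 ((hx 0).fun_add ((dq.fun_mul dx).fun_add ds)) (hx 1) dx X
  rw [fderiv_coord, fderiv_eq_sum_pd, fderiv_eq_sum_pd, Fin.sum_univ_three, Fin.sum_univ_three,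
    e0, e0, e0, e2, e2, e2] at e
  change fderiv ℝ (fun z => !₂[z 0 + (q (z 1) * (z 2 - p (z 1)) + s (z 1)), z 1,
    z 2 - p (z 1)]) y X = _
  rw [e]
  ext i
  fin_cases i
  · simp
    exact Or.inl (by ring)
  · simp
  · simp
    ring

end ShiftMap

/-- Here f = -(α''/α) x² + b(v) x + a(v). Only the last two terms differ from the normal form, and
`shiftMap` removes them. It keeps v fixed, so the density is still α(v) in the new chart. -/
theorem IsSolutionChart.exists_isPlaneWaveChart (hS : g.IsSolutionChart h φ f r 0)
    (hs : ContMDiff (𝓡 3) 𝓘(ℝ, ℝ) ∞ h) (hpos : ∀ p, 0 < h p) {p₀ : M} (hp₀ : p₀ ∈ φ.source)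
    (hφ0 : φ p₀ = 0) :
    ∃ (ψ : OpenPartialHomeomorph M (EuclideanSpace ℝ (Fin 3))) (α : ℝ → ℝ),
      p₀ ∈ ψ.source ∧ IsPlaneWaveChart g h ψ α := by
  obtain ⟨α, hα, hh⟩ := hS.exists_density_eq hs
  have htb := fun {y} (hy : y ∈ Metric.ball 0 r) => hS.mem_target hy
  have hα0 : ∀ v ∈ Set.Ioo (-r) r, α v ≠ 0 := fun v hv => by
    have := (hpos (φ.symm (axisPt v))).ne'
    rw [hh _ (htb (axisPt_mem_ball.2 hv))] at this
    simpa [axisPt] using this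
  have hα2 : ContDiffOn ℝ ∞ (deriv (deriv α)) (Set.Ioo (-r) r) := fun v hv =>
    (contDiffAt_deriv (contDiffAt_deriv
      (hα.contDiffAt (isOpen_Ioo.mem_nhds hv)))).contDiffWithinAt
  have hc : ContDiffOn ℝ ∞ (fun v => deriv (deriv α) v / α v) (Set.Ioo (-r) r) :=
    hα2.div hα hα0
  have hf := fun y (hy : y ∈ Metric.ball 0 r) => hS.contDiffAt (htb hy)
  have hquad : ∀ y ∈ Metric.ball 0 r, f y = -(deriv (deriv α) (y 1) / α (y 1)) * y 2 ^ 2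
      + pd 2 f (axisPt (y 1)) * y 2 + f (axisPt (y 1)) := fun y hy => by
    refine eq_quadratic_of_pd_two_two (c := fun v => deriv (deriv α) v / α v) hc hf
      (fun y hy => hS.pd_zero y (htb hy)) (fun y hy => ?_) hy
    have e := hS.vacuum_affine hα hh (htb hy)
    have hne := hα0 _ (coord_mem_Ioo hy 1)
    rw [hh y (htb hy), zero_mul, zero_add] at e
    field_simp
    linear_combination 2 * e
  -- Put X = x - p and U = u + q X + s. The mixed term dX dv drops out if p' = q. With c = α''/α,
  -- the coefficient of dv² becomes f(v, X + p) - 2 (q' X + s') + q². It equals -c X² exactly if q'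
  -- = b/2 - c p and s' = (q² - c p² + b p + a)/2. The initial values 0 keep the base point at the
  -- origin.
  obtain ⟨ε, hε, hεr, p, q, s, hp0, hq0, hs0, hp, hq, hs', hode⟩ := exists_plane_wave_shift hS.pos
    (contDiffOn_comp_axisPt hf) (contDiffOn_comp_axisPt fun y hy => contDiffAt_pd (hf y hy) 2) hc
  have hat : ∀ {a : ℝ → ℝ}, ContDiffOn ℝ ∞ a (Set.Ioo (-ε) ε) →
      ∀ y ∈ Metric.ball (0 : EuclideanSpace ℝ (Fin 3)) ε,
      ContDiffAt ℝ ∞ a (y 1) := fun ha y hy =>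
    ha.contDiffAt (isOpen_Ioo.mem_nhds (coord_mem_Ioo hy 1))
  have hfd := fun y (hy : y ∈ Metric.ball 0 ε) => fderiv_shiftMap (hat hp y hy) (hat hq y hy)
    (hat hs' y hy) (hode _ (coord_mem_Ioo hy 1)).1 (hode _ (coord_mem_Ioo hy 1)).2.1
    (hode _ (coord_mem_Ioo hy 1)).2.2
  have hφU : φ p₀ ∈ Metric.ball (0 : EuclideanSpace ℝ (Fin 3)) ε := by
    rw [hφ0]; exact Metric.mem_ball_self hε
  have hbij : Function.Bijective (fderiv ℝ (shiftMap p q s) (φ p₀)) := by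
    refine bijective_of_apply_eq_zero fun X hX => ?_
    rw [hfd _ hφU] at hX
    have h0 := congrArg (fun w : EuclideanSpace ℝ (Fin 3) => w 0) hX
    have h1 : X 1 = 0 := congrArg (fun w : EuclideanSpace ℝ (Fin 3) => w 1) hX
    have h2 := congrArg (fun w : EuclideanSpace ℝ (Fin 3) => w 2) hX
    simp [h1] at h2
    simp [h1, h2] at h0
    ext i
    fin_cases i
    exacts [h0, h1, h2]
  have hz0 : shiftMap p q s (φ p₀) = 0 := by
    rw [hφ0]
    ext i
    fin_cases i <;> simp [shiftMap, hp0, hs0]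
  obtain ⟨ψ, r', hψ, -, hpψ, -, hψf⟩ := exists_chart_of_fderiv_bijective hS.isChart hp₀
    Metric.isOpen_ball hφU
    (fun y hy => contDiffAt_shiftMap (hat hp y hy) (hat hq y hy) (hat hs' y hy)) hbij hz0
  have hcoord : ∀ z ∈ ψ.target, ∃ y ∈ φ.target, y ∈ Metric.ball 0 ε ∧ z 1 = y 1 ∧
      z 2 = y 2 - p (y 1) ∧ φ.symm y = ψ.symm z ∧ ∀ X Y, g.chartForm φ y X Y =
        g.chartForm ψ z (fderiv ℝ (shiftMap p q s) y X) (fderiv ℝ (shiftMap p q s) y Y) := by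
    intro z hz
    obtain ⟨y, hy, hyU, rfl, e, -, hB, -⟩ := change_of_chart g hS.isChart hψ hψf hz
    exact ⟨y, hy, hyU, rfl, rfl, e, hB⟩
  refine ⟨ψ, α, hpψ, hα.mono ?_, ⟨hψ, fun z hz => ?_⟩, fun z hz => ?_⟩
  · rintro _ ⟨z, hz, rfl⟩
    obtain ⟨y, hy, -, h1, -, -, -⟩ := hcoord z hz
    simp only [h1]
    exact coord_mem_Ioo (hS.mem_ball hy) 1
  · obtain ⟨y, hy, hyε, h1, h2, -, hB⟩ := hcoord z hz
    rw [h1, h2]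
    set Z := y 2 - p (y 1) with hZ
    set Q := pd 2 f (axisPt (y 1)) / 2 - deriv (deriv α) (y 1) / α (y 1) * p (y 1) with hQ
    set S := (q (y 1) ^ 2 - deriv (deriv α) (y 1) / α (y 1) * p (y 1) ^ 2
      + pd 2 f (axisPt (y 1)) * p (y 1) + f (axisPt (y 1))) / 2 with hSd
    have hfy := hfd y hyε
    -- The new coordinate fields are expressed in the old frame by inverting the differential of the
    -- shift; the metric is then evaluated on these preimages.
    have e0 : (EuclideanSpace.single 0 1 : EuclideanSpace ℝ (Fin 3)) =
        fderiv ℝ (shiftMap p q s) y !₂[1, 0, 0] := by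
      rw [hfy]
      ext i
      fin_cases i <;> simp
    have e1 : (EuclideanSpace.single 1 1 : EuclideanSpace ℝ (Fin 3)) =
        fderiv ℝ (shiftMap p q s) y !₂[-(Q * Z + S), 1, q (y 1)] := by
      rw [hfy]
      ext i
      fin_cases i <;> simp
      ring
    have e2 : (EuclideanSpace.single 2 1 : EuclideanSpace ℝ (Fin 3)) =
        fderiv ℝ (shiftMap p q s) y !₂[-q (y 1), 0, 1] := by
      rw [hfy]
      ext i
      fin_cases i <;> simp
    have hquad' := hquad y (hS.mem_ball hy)
    refine mat_eq_ppMatrix (fun j => ?_) ?_ ?_ ?_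
    · fin_cases j
      · change g.mat ψ z 0 0 = _
        rw [mat_eq_chartForm, e0, ← hB, hS.chartForm_eq hy]
        simp
      · change g.mat ψ z 0 1 = _
        rw [mat_eq_chartForm, e0, e1, ← hB, hS.chartForm_eq hy]
        simp
      · change g.mat ψ z 0 2 = _
        rw [mat_eq_chartForm, e0, e2, ← hB, hS.chartForm_eq hy]
        simp
    · rw [mat_eq_chartForm, e1, ← hB, hS.chartForm_eq hy]
      simp
      rw [hquad', hQ, hSd, hZ]
      ring
    · rw [mat_eq_chartForm, e1, e2, ← hB, hS.chartForm_eq hy]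
      simp
    · rw [mat_eq_chartForm, e2, ← hB, hS.chartForm_eq hy]
      simp
  · obtain ⟨y, hy, -, h1, -, e, -⟩ := hcoord z hz
    rw [← e, hh y hy, h1, zero_mul, zero_add]

end PlaneWaveCoordinates

end LorentzMetric

/-! ### The plane wave condition and the theorem -/

namespace LorentzMetric

/-- In the given charts `V` is ∂_u, so orthogonality to `V` means a vanishing v-component. For c = 0
also f_xxx = 0, which makes the curvature parallel in these directions. -/
theorem IsPPField.isPlaneWave {M : Type*} [TopologicalSpace M]
    [ChartedSpace (EuclideanSpace ℝ (Fin 3)) M] [IsManifold (𝓡 3) ∞ M] {g : LorentzMetric 3 M}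
    {h : M → ℝ} {V : ∀ p : M, TangentSpace (𝓡 3) p} (hV : g.IsPPField V)
    (hs : ContMDiff (𝓡 3) 𝓘(ℝ, ℝ) ∞ h) (hpos : ∀ p, 0 < h p)
    (H : ∀ p : M, ∃ (ψ : OpenPartialHomeomorph M (EuclideanSpace ℝ (Fin 3)))
      (f : EuclideanSpace ℝ (Fin 3) → ℝ) (r : ℝ), g.IsSolutionChart h ψ f r 0 ∧ p ∈ ψ.source ∧
      ∀ z ∈ ψ.target, vecCoord ψ V z = EuclideanSpace.single 0 1) : g.IsPlaneWave := by
  refine ⟨V, hV, fun φ hφ y hy X hX l i j k =>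
    g.covRiem_perp_of_exists_chart V (fun p => ?_) hφ hy X hX l i j k⟩
  obtain ⟨ψ, f, r, hS, hp, hv⟩ := H p
  refine ⟨ψ, hS.isChart, hp, fun y hy W X Y Z hW => ?_⟩
  rw [hv y hy, hS.chartForm_eq hy] at hW
  exact hS.covCurv_eq_zero hy (hS.pd_two_two_two_eq_zero hs hpos hy) (by simpa using hW) X Y Z

end LorentzMetric

theorem theorem3p1 {M : Type*} [TopologicalSpace M]
    [ChartedSpace (EuclideanSpace ℝ (Fin 3)) M] [IsManifold (𝓡 3) ∞ M] [ConnectedSpace M]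
    (g : LorentzMetric 3 M) (h : M → ℝ) (hh : g.IsDensity h) :
    -- classification
    (g.IsPPWave → ¬ g.IsFlat → ∀ Λ : ℝ, g.SolvesVacuum h Λ →
      Λ = 0 ∧
      (((∀ p, g.grad h p ≠ 0 → g.IsLightlike p (g.grad h p)) ∧ g.IsPlaneWave ∧
          ∀ p : M, ∃ (φ : OpenPartialHomeomorph M (EuclideanSpace ℝ (Fin 3))) (α : ℝ → ℝ),
            p ∈ φ.source ∧ IsPlaneWaveChart g h φ α ∧
            ∀ q ∈ φ.source, deriv (deriv α) (φ q 1) ≠ 0 ↔ ¬ g.IsFlatAt q) ∨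
        ((∀ p, g.IsSpacelike p (g.grad h p)) ∧
          ∀ p : M, ∃ (φ : OpenPartialHomeomorph M (EuclideanSpace ℝ (Fin 3)))
            (γ₁ : ℝ) (γ₀ α β : ℝ → ℝ),
            p ∈ φ.source ∧ IsLogWaveChart g h φ γ₁ γ₀ α β ∧
            ∀ q ∈ φ.source,
              γ₁ * α (φ q 1) + 2 * γ₀ (φ q 1) * deriv (deriv γ₀) (φ q 1) ≠ 0 ↔
                ¬ g.IsFlatAt q))) ∧
    -- the functions in the local forms are arbitrary: each of them gives a non-flat solution
    ((∀ p : M, ∃ (φ : OpenPartialHomeomorph M (EuclideanSpace ℝ (Fin 3))) (α : ℝ → ℝ),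
        p ∈ φ.source ∧ IsPlaneWaveChart g h φ α ∧
        ∀ q ∈ φ.source, deriv (deriv α) (φ q 1) ≠ 0) →
      g.SolvesVacuum h 0 ∧ (∀ p, ¬ g.IsFlatAt p) ∧
        ∀ p, g.grad h p ≠ 0 → g.IsLightlike p (g.grad h p)) ∧
    ((∀ p : M, ∃ (φ : OpenPartialHomeomorph M (EuclideanSpace ℝ (Fin 3)))
        (γ₁ : ℝ) (γ₀ α β : ℝ → ℝ),
        p ∈ φ.source ∧ IsLogWaveChart g h φ γ₁ γ₀ α β ∧
        ∀ q ∈ φ.source,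
          γ₁ * α (φ q 1) + 2 * γ₀ (φ q 1) * deriv (deriv γ₀) (φ q 1) ≠ 0) →
      g.SolvesVacuum h 0 ∧ (∀ p, ¬ g.IsFlatAt p) ∧
        ∀ p, g.IsSpacelike p (g.grad h p)) := by

  obtain ⟨hs, hpos, -⟩ := hh
  refine ⟨?_, fun H => ⟨?_, fun p => ?_, fun p hp => ⟨hp, ?_⟩⟩, fun H => ⟨?_, fun p => ?_, fun p => ?_⟩⟩
  · rintro ⟨V, hV⟩ hnf Λ hE
    obtain rfl : Λ = 0 := hV.cosmological_eq_zero hs hE hnf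
    obtain ⟨k, hk⟩ := hV.exists_val_grad_eq hs hE hnf
    have hchart := hV.exists_isSolutionChart hs hE hnf
    refine ⟨rfl, ?_⟩
    -- The constant `c` of a solution chart may change from chart to chart, but its square is the
    -- global constant `k`. Hence one of the two cases holds on all of M.
    by_cases hk0 : k = 0
    · subst hk0
      have hchart0 : ∀ p : M, ∃ (ψ : OpenPartialHomeomorph M (EuclideanSpace ℝ (Fin 3)))
          (f : EuclideanSpace ℝ (Fin 3) → ℝ) (r : ℝ), g.IsSolutionChart h ψ f r 0 ∧
          p ∈ ψ.source ∧ ψ p = 0 ∧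
          ∀ z ∈ ψ.target, LorentzMetric.vecCoord ψ V z = EuclideanSpace.single 0 1 := fun p => by
        obtain ⟨ψ, f, r, c, hS, hp, hp0, hv⟩ := hchart p
        obtain rfl : c = 0 := by
          have := hS.val_grad hs hp
          rw [hk] at this
          exact pow_eq_zero_iff two_ne_zero |>.1 this.symm
        exact ⟨ψ, f, r, hS, hp, hp0, hv⟩
      refine Or.inl ⟨fun p hp => ⟨hp, hk p⟩, hV.isPlaneWave hs hpos fun p => ?_, fun p => ?_⟩
      · obtain ⟨ψ, f, r, hS, hp, -, hv⟩ := hchart0 p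
        exact ⟨ψ, f, r, hS, hp, hv⟩
      · obtain ⟨ψ, f, r, hS, hp, hp0, -⟩ := hchart0 p
        obtain ⟨ψ', α, hp', hP⟩ := hS.exists_isPlaneWaveChart hs hpos hp hp0
        exact ⟨ψ', α, hp', hP, fun q hq => not_congr (hP.isFlatAt_iff hpos hq).symm⟩
    · have hc : ∀ {p : M} {ψ : OpenPartialHomeomorph M (EuclideanSpace ℝ (Fin 3))}
          {f : EuclideanSpace ℝ (Fin 3) → ℝ} {r c : ℝ}, g.IsSolutionChart h ψ f r c →
          p ∈ ψ.source → c ≠ 0 := fun {p} {ψ} {f} {r} {c} hS hp h0 => hk0 <| by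
        rw [← hk p, hS.val_grad hs hp, h0]
        ring
      refine Or.inr ⟨fun p => ?_, fun p => ?_⟩
      · obtain ⟨ψ, f, r, c, hS, hp, -, -⟩ := hchart p
        rw [LorentzMetric.IsSpacelike, hS.val_grad hs hp]
        exact sq_pos_of_ne_zero (hc hS hp)
      · obtain ⟨ψ, f, r, c, hS, hp, -, -⟩ := hchart p
        obtain ⟨γ₀, α, β, hP⟩ := hS.exists_isLogWaveChart (hc hS hp) hs hpos
        exact ⟨ψ, c, γ₀, α, β, hp, hP, fun q hq => not_congr (hP.isFlatAt_iff hpos hq).symm⟩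
  · refine g.solvesVacuum_of_exists_chart hs fun p => ?_
    obtain ⟨φ, α, hp, hP, -⟩ := H p
    exact ⟨φ, hP.2.1.1, hp, fun y hy i j => hP.weightedEinstein hpos hs hy i j⟩
  · obtain ⟨φ, α, hp, hP, hα⟩ := H p
    rw [hP.isFlatAt_iff hpos hp]
    exact hα p hp
  · obtain ⟨φ, α, hp, hP, -⟩ := H p
    exact hP.val_grad hs hp
  · refine g.solvesVacuum_of_exists_chart hs fun p => ?_
    obtain ⟨φ, γ₁, γ₀, α, β, hp, hP, -⟩ := H p
    exact ⟨φ, hP.2.2.2.2.1.1, hp, fun y hy i j => hP.weightedEinstein hpos hs hy i j⟩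
  · obtain ⟨φ, γ₁, γ₀, α, β, hp, hP, hα⟩ := H p
    rw [hP.isFlatAt_iff hpos hp]
    exact hα p hp
  · obtain ⟨φ, γ₁, γ₀, α, β, hp, hP, -⟩ := H p
    rw [LorentzMetric.IsSpacelike, hP.val_grad hs hp]
    exact sq_pos_of_ne_zero hP.1
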